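/- Let $(M,\omega)$ be a compact connected symplectic $4$-manifold with an effective Hamiltonian action of the torus $\mathbb T=\mathbb T^2$, with moment map $\mu:M\to\Delta\subset\mathfrak t^*$, $\Delta=\mu(M)$, where $\iota_{\xi^\sharp}\omega=-d\mu^\xi$ for $\xi\in\mathfrak t$ and $\xi^\sharp$ is the vector field induced by $\xi$. Let $\mathring M=\mu^{-1}(\mathring\Delta)$ be the preimage of the interior of $\Delta$, and for a field of endomorphisms $J$ let $J^{*_\omega}$ be its symplectic adjoint, $\omega(JX,Y)=\omega(X,J^{*_\omega}Y)$. Let $J\in DGK^{\mathbb T}_\omega(M)$, that is: $J$ is a $\mathbb T$-invariant integrable almost complex structure on $M$ with $\omega(X,JX)>0$ for $X\neq0$, $J^{*_\omega}$ is integrable as well, and $J^{*_\omega}\mathcal K=J\mathcal K$ on $\mathring M$, where $\mathcal K$ is the distribution tangent to the $\mathbb T$-orbits. Let $g$ be the symmetric part of $\omega(\cdot,J\cdot)$. Fix a basis $(\xi_1,\xi_2)$ of $\mathfrak t$, put $\mu^j=\mu^{\xi_j}$ and $K_j=\xi_j^\sharp$, and let $(\mu^1,\mu^2,t^1,t^2)$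 be local coordinates on an open subset $U$ of $\mathring M$ such that $dt^i(K_j)=\delta^i_j$ and $dt^i(JK_j)=0$. Suppose that $$J=\sum_{i,j=1}^2\Psi_{ij}\frac{\partial}{\partial t^i}\otimes d\mu^j-\sum_{i,j=1}^2\Psi^{ij}\frac{\partial}{\partial\mu^i}\otimes dt^j,\qquad (\Psi^{ij})=\Psi^{-1},$$ on $U$, and let $\Psi=S+C$ be the decomposition of $\Psi$ into its symmetric and antisymmetric parts. For a Hermitian structure $(g,I)$ let $F_I=g(I\cdot,\cdot)$, and let $\rho_I$ be its Chern–Ricci form: the real $2$-form such that the connection induced on the anticanonical bundle $\bigwedge^2T^{1,0}M$ by the Chern connection of $(g,I)$ has curvature $\sqrt{-1}\,\rho_I\otimes\mathrm{Id}$, for the sign convention $R_{X,Y}=\nabla_{[X,Y]}-[\nabla_X,\nabla_Y]$. Its Hermitian scalar curvature is the function $4\rho_I\wedge F_I/(F_I\wedge F_I)$. Put $d^cf=-df\circ J$. Then, on $U$, the Chern–Ricci form of $(g,J)$ is $$\rho_J=-\tfrac12\,dd^c\log\det S+dd^c\log\det\Psi .$$ Moreover, on $U$ the Hermitian scalar curvatures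 of $(g,J)$ and $(g,J^{*_\omega})$ coincide, and their common value $u_J$ is $$u_J=-\sum_{i,j=1}^2\frac{\partial^2S^{ij}}{\partial\mu^i\partial\mu^j}+\frac{4-2p}{1-p}|\theta|^2-\frac{2\langle[J,J^{*_\omega}],d\theta\rangle}{1-p},$$ where $(S^{ij})=S^{-1}$, $p=-\frac14\mathrm{tr}(JJ^{*_\omega})$ is the angle function, $\theta$ is the Lee form of $(g,J)$, i.e. the $1$-form with $dF_J=\theta\wedge F_J$, the norm $|\theta|$ is that of $g$, $[J,J^{*_\omega}]$ is identified with the $2$-form $g([J,J^{*_\omega}]\cdot,\cdot)$, and $\langle\alpha,\beta\rangle=\frac14\sum_{i,j,k,l}g^{ik}g^{jl}\alpha_{ij}\beta_{kl}$ is the inner product of $2$-forms for which the fundamental forms of $g$-orthogonal complex structures have norm one (half of the inner product for which the forms $e^i\wedge e^j$, $i<j$, of an orthonormal coframe are orthonormal), so that $p=\langle F_J,F_{J^{*_\omega}}\rangle$. -/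

import Mathlib

open Bundle FiberBundle VectorField
open scoped Manifold ContDiff Topology Matrix

noncomputable section

namespace ToricGK

/-- The model space of a real `4`-manifold. -/
abbrev E4 : Type := EuclideanSpace ℝ (Fin 4)

/-- The `2`-torus. -/
abbrev Torus : Type := Circle × Circle

/-- The Lie algebra of the `2`-torus. -/
abbrev LieT : Type := ℝ × ℝ

/-- The exponential map of the `2`-torus. -/
def torusExp (ξ : LieT) : Torus := (Circle.exp ξ.1, Circle.exp ξ.2)

variable {M : Type*} [TopologicalSpace M] [ChartedSpace E4 M] [IsManifold (𝓡 4) ∞ M]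

variable (M) in
/-- Vector fields on `M` (no regularity imposed). -/
abbrev VField : Type _ := (x : M) → TangentSpace (𝓡 4) x

variable (M) in
/-- Fields of endomorphisms of the tangent spaces (no regularity imposed). -/
abbrev EndField : Type _ := (x : M) → TangentSpace (𝓡 4) x →L[ℝ] TangentSpace (𝓡 4) x

variable (M) in
/-- Fields of linear forms on the tangent spaces (no regularity imposed). -/
abbrev OneForm : Type _ := (x : M) → TangentSpace (𝓡 4) x →L[ℝ] ℝ

variable (M) in
/-- Fields of bilinear forms on the tangent spaces (no regularity imposed). -/
abbrev BilField : Type _ :=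
  (x : M) → TangentSpace (𝓡 4) x →L[ℝ] TangentSpace (𝓡 4) x →L[ℝ] ℝ

/-! ### Regularity of sections -/

/-- The vector field `X` is differentiable at `x`. -/
def VFieldDiffAt (X : VField M) (x : M) : Prop :=
  MDifferentiableAt (𝓡 4) ((𝓡 4).prod 𝓘(ℝ, E4))
    (fun y ↦ (TotalSpace.mk' E4 y (X y) : TangentBundle (𝓡 4) M)) x

/-- The vector field `X` is smooth at `x`. -/
def VFieldSmoothAt (X : VField M) (x : M) : Prop :=
  ContMDiffAt (𝓡 4) ((𝓡 4).prod 𝓘(ℝ, E4)) ∞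
    (fun y ↦ (TotalSpace.mk' E4 y (X y) : TangentBundle (𝓡 4) M)) x

/-- `J` is a smooth section of `End(TM)`. -/
def EndSmooth (J : EndField M) : Prop :=
  ContMDiff (𝓡 4) ((𝓡 4).prod 𝓘(ℝ, E4 →L[ℝ] E4)) ∞
    (fun x ↦ TotalSpace.mk' (E4 →L[ℝ] E4)
      (E := fun y : M ↦ (TangentSpace (𝓡 4) y →L[ℝ] TangentSpace (𝓡 4) y)) x (J x))

/-- `θ` is a smooth section of `T*M`. -/
def OneFormSmooth (θ : OneForm M) : Prop :=
  ContMDiff (𝓡 4) ((𝓡 4).prod 𝓘(ℝ, E4 →L[ℝ] ℝ)) ∞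
    (fun x ↦ TotalSpace.mk' (E4 →L[ℝ] ℝ)
      (E := fun y : M ↦ (TangentSpace (𝓡 4) y →L[ℝ] Trivial M ℝ y)) x (θ x))

/-- `Ω` is a smooth section of `T*M ⊗ T*M`. -/
def BilSmooth (Ω : BilField M) : Prop :=
  ContMDiff (𝓡 4) ((𝓡 4).prod 𝓘(ℝ, E4 →L[ℝ] E4 →L[ℝ] ℝ)) ∞
    (fun x ↦ TotalSpace.mk' (E4 →L[ℝ] E4 →L[ℝ] ℝ)
      (E := fun y : M ↦ (TangentSpace (𝓡 4) y →L[ℝ] TangentSpace (𝓡 4) y →L[ℝ] ℝ)) x (Ω x))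

/-! ### Exterior calculus -/

/-- The exterior derivative of a `1`-form,
`dα(X, Y) = X(α(Y)) - Y(α(X)) - α([X, Y])`, at the tangent vectors `v, w`; the right-hand side
does not depend on the vector fields that extend `v` and `w`. -/
def dOne (α : OneForm M) (x : M) (v w : TangentSpace (𝓡 4) x) : ℝ :=
  let X : VField M := extend E4 v
  let Y : VField M := extend E4 w
  mvfderiv (𝓡 4) (fun y ↦ α y (Y y)) x v
    - mvfderiv (𝓡 4) (fun y ↦ α y (X y)) x w
    - α x (mlieBracket (𝓡 4) X Y x)

/-- The exterior derivative of a `2`-form,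
`dβ(X, Y, Z) = X(β(Y, Z)) + Y(β(Z, X)) + Z(β(X, Y)) - β([X, Y], Z) - β([Y, Z], X) - β([Z, X], Y)`,
at the tangent vectors `u, v, w`. -/
def dTwo (β : BilField M) (x : M) (u v w : TangentSpace (𝓡 4) x) : ℝ :=
  let X : VField M := extend E4 u
  let Y : VField M := extend E4 v
  let Z : VField M := extend E4 w
  mvfderiv (𝓡 4) (fun y ↦ β y (Y y) (Z y)) x u
    + mvfderiv (𝓡 4) (fun y ↦ β y (Z y) (X y)) x v
    + mvfderiv (𝓡 4) (fun y ↦ β y (X y) (Y y)) x w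
    - β x (mlieBracket (𝓡 4) X Y x) w
    - β x (mlieBracket (𝓡 4) Y Z x) u
    - β x (mlieBracket (𝓡 4) Z X x) v

/-- `d^c f = J df = -df ∘ J`. -/
def dc (J : EndField M) (f : M → ℝ) : OneForm M :=
  fun x ↦ -((mvfderiv (𝓡 4) f x).comp (J x))

/-- `dd^c f`. -/
def ddc (J : EndField M) (f : M → ℝ) (x : M) (v w : TangentSpace (𝓡 4) x) : ℝ :=
  dOne (dc J f) x v w

/-- The wedge product of two alternating bilinear forms, evaluated on four vectors. -/
def wedgeTwoTwo {V : Type*} (α β : V → V → ℝ) (v : Fin 4 → V) : ℝ :=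
  α (v 0) (v 1) * β (v 2) (v 3) - α (v 0) (v 2) * β (v 1) (v 3) + α (v 0) (v 3) * β (v 1) (v 2)
    + α (v 1) (v 2) * β (v 0) (v 3) - α (v 1) (v 3) * β (v 0) (v 2) + α (v 2) (v 3) * β (v 0) (v 1)

/-- The standard basis of the tangent space at `x`. -/
def tangentBasis (x : M) : Module.Basis (Fin 4) ℝ (TangentSpace (𝓡 4) x) :=
  (EuclideanSpace.basisFun (Fin 4) ℝ).toBasis

/-! ### Almost Hermitian geometry -/

/-- The vanishing of the Nijenhuis tensor of `J`. -/
def Integrable (J : EndField M) : Prop :=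
  ∀ (x : M) (X Y : VField M), VFieldDiffAt X x → VFieldDiffAt Y x →
    mlieBracket (𝓡 4) (fun y ↦ J y (X y)) (fun y ↦ J y (Y y)) x
      - J x (mlieBracket (𝓡 4) (fun y ↦ J y (X y)) Y x)
      - J x (mlieBracket (𝓡 4) X (fun y ↦ J y (Y y)) x)
      - mlieBracket (𝓡 4) X Y x = 0

/-- The fundamental form `F = g(J·, ·)`. -/
def fundForm (g : BilField M) (J : EndField M) : BilField M := fun x ↦ (g x).comp (J x)

/-- `θ` is the Lee form of `(g, J)`: the `1`-form with `dF = θ ∧ F`. -/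
structure IsLeeForm (g : BilField M) (J : EndField M) (θ : OneForm M) :
    Prop where
  smooth : OneFormSmooth θ
  eq : ∀ (x : M) (u v w : TangentSpace (𝓡 4) x),
    dTwo (fundForm g J) x u v w
      = θ x u * fundForm g J x v w + θ x v * fundForm g J x w u + θ x w * fundForm g J x u v

/-- The matrix of `g` at `x` in the standard basis. -/
def gram (g : BilField M) (x : M) : Matrix (Fin 4) (Fin 4) ℝ :=
  fun i j ↦ g x (tangentBasis x i) (tangentBasis x j)

/-- The squared `g`-norm `|θ|² = ∑ g^{ij} θ_i θ_j` of a linear form. -/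
def normSqOne (g : BilField M) (x : M) (θ : TangentSpace (𝓡 4) x →L[ℝ] ℝ) : ℝ :=
  ∑ i, ∑ j, (gram g x)⁻¹ i j * θ (tangentBasis x i) * θ (tangentBasis x j)

/-- The inner product `⟨α, β⟩ = ¼ ∑ g^{ik} g^{jl} α_{ij} β_{kl}` of `2`-forms. With the `2`-forms
written as `g(A·, ·)`, `g(B·, ·)` for `g`-skew `A`, `B`, it is `-¼ tr(AB)`: the fundamental form of
a `g`-orthogonal complex structure has norm one, and the angle function is the inner product of the
two fundamental forms. -/
def innerTwo (g : BilField M) (x : M)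
    (α β : TangentSpace (𝓡 4) x → TangentSpace (𝓡 4) x → ℝ) : ℝ :=
  (1 / 4 : ℝ) * ∑ i, ∑ j, ∑ k, ∑ l, (gram g x)⁻¹ i k * (gram g x)⁻¹ j l
    * α (tangentBasis x i) (tangentBasis x j) * β (tangentBasis x k) (tangentBasis x l)

variable (M) in
/-- Connections on the tangent bundle; `cov Y x v` is `∇_v Y`. -/
abbrev Connection : Type _ := CovariantDerivative (𝓡 4) E4 (TangentSpace (𝓡 4) : M → Type)

/-- `cov` is the Chern connection of the almost Hermitian structure `(g, J)`: `∇g = 0`, `∇J = 0`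
and the `J`-invariant part of the torsion vanishes. -/
structure IsChernConnection (g : BilField M) (J : EndField M) (cov : Connection M) : Prop where
  smooth : ContMDiffCovariantDerivativeOn E4 ∞ cov.toFun Set.univ
  metric : ∀ (x : M) (Y Z : VField M), VFieldDiffAt Y x → VFieldDiffAt Z x →
    ∀ v : TangentSpace (𝓡 4) x,
      mvfderiv (𝓡 4) (fun y ↦ g y (Y y) (Z y)) x v
        = g x (cov Y x v) (Z x) + g x (Y x) (cov Z x v)
  complex : ∀ (x : M) (Y : VField M), VFieldDiffAt Y x →
    ∀ v : TangentSpace (𝓡 4) x, cov (fun y ↦ J y (Y y)) x v = J x (cov Y x v)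
  torsion : ∀ (x : M) (v w : TangentSpace (𝓡 4) x),
    cov.torsion x (J x v) (J x w) = -cov.torsion x v w

variable (M) in
/-- Fields of trilinear maps `(v, w, z) ↦ R_{v,w} z`. -/
abbrev CurvField : Type _ :=
  (x : M) → TangentSpace (𝓡 4) x →L[ℝ] TangentSpace (𝓡 4) x →L[ℝ]
    TangentSpace (𝓡 4) x →L[ℝ] TangentSpace (𝓡 4) x

/-- `R` is the curvature of `cov`, with the sign convention `R_{X,Y} = ∇_{[X,Y]} - [∇_X, ∇_Y]`. -/
def IsCurvature (cov : Connection M) (R : CurvField M) : Prop :=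
  ∀ (x : M) (X Y Z : VField M), VFieldSmoothAt X x → VFieldSmoothAt Y x → VFieldSmoothAt Z x →
    R x (X x) (Y x) (Z x)
      = cov Z x (mlieBracket (𝓡 4) X Y x)
        - (cov (fun y ↦ cov Z y (Y y)) x (X x) - cov (fun y ↦ cov Z y (X y)) x (Y x))

/-- The complex trace of an endomorphism `A` of `(V, J)` commuting with `J`. -/
def complexTrace {V : Type*} [AddCommGroup V] [Module ℝ V] (J A : V →ₗ[ℝ] V) : ℂ :=
  ((LinearMap.trace ℝ V A : ℝ) - Complex.I * (LinearMap.trace ℝ V (J ∘ₗ A) : ℝ)) / 2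

/-- `ρ` is the Chern–Ricci form of `(g, J)`: the curvature `R` of the Chern connection induces on
the anticanonical bundle, the top exterior power of `T^{1,0}M ≅ (TM, J)`, the curvature
`tr_ℂ R = √-1 ρ`. -/
def IsChernRicciForm (g : BilField M) (J : EndField M) (ρ : BilField M) : Prop :=
  ∃ (cov : Connection M) (R : CurvField M), IsChernConnection g J cov ∧ IsCurvature cov R ∧
    ∀ (x : M) (v w : TangentSpace (𝓡 4) x),
      complexTrace (J x).toLinearMap (R x v w).toLinearMap = Complex.I * (ρ x v w : ℝ)

/-- The Hermitian scalar curvature `4 ρ ∧ F / (F ∧ F)`, for the Chern–Ricci form `ρ` and the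
fundamental form `F`. -/
def hermScal (ρ F : BilField M) (x : M) : ℝ :=
  4 * wedgeTwoTwo (fun v w ↦ ρ x v w) (fun v w ↦ F x v w) (tangentBasis x)
    / wedgeTwoTwo (fun v w ↦ F x v w) (fun v w ↦ F x v w) (tangentBasis x)

/-! ### Symplectic toric geometry -/

/-- The fundamental vector field `ξ^♯` of the torus action. -/
def fundField [MulAction Torus M] (ξ : LieT) : VField M := fun x ↦
  (mfderiv 𝓘(ℝ, ℝ) (𝓡 4) (fun s : ℝ ↦ torusExp (s • ξ) • x) 0 (1 : ℝ) : E4)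

/-- The differential at `x` of the action of `t`. -/
def actDeriv [MulAction Torus M] (t : Torus) (x : M) :
    TangentSpace (𝓡 4) x →L[ℝ] TangentSpace (𝓡 4) (t • x) :=
  mfderiv (𝓡 4) (𝓡 4) (fun y : M ↦ t • y) x

/-- `(M, ω)` with the given torus action is a symplectic toric manifold with moment map `μ`. -/
structure IsSymplecticToric [MulAction Torus M]
    (Ω : BilField M) (μ : M → (LieT →L[ℝ] ℝ)) : Prop where
  smooth_form : BilSmooth Ω
  alternating : ∀ (x : M) (v : TangentSpace (𝓡 4) x), Ω x v v = 0
  nondegenerate : ∀ (x : M) (v : TangentSpace (𝓡 4) x), (∀ w, Ω x v w = 0) → v = 0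
  closed : ∀ (x : M) (u v w : TangentSpace (𝓡 4) x), dTwo Ω x u v w = 0
  smooth_action : ContMDiff (((𝓡 1).prod (𝓡 1)).prod (𝓡 4)) (𝓡 4) ∞
    (fun q : Torus × M ↦ q.1 • q.2)
  effective : ∀ t : Torus, (∀ x : M, t • x = x) → t = 1
  symplectic : ∀ (t : Torus) (x : M) (v w : TangentSpace (𝓡 4) x),
    Ω (t • x) (actDeriv t x v) (actDeriv t x w) = Ω x v w
  smooth_moment : ContMDiff (𝓡 4) 𝓘(ℝ, LieT →L[ℝ] ℝ) ∞ μ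
  moment_invariant : ∀ (t : Torus) (x : M), μ (t • x) = μ x
  hamiltonian : ∀ (ξ : LieT) (x : M) (v : TangentSpace (𝓡 4) x),
    Ω x (fundField ξ x) v = -mvfderiv (𝓡 4) (fun y ↦ μ y ξ) x v

/-- The part of `M` that lies over the interior of the moment polytope `Δ = μ(M)`. -/
def openPart (μ : M → (LieT →L[ℝ] ℝ)) : Set M := μ ⁻¹' interior (Set.range μ)

/-- The adjoint of `A` with respect to a nondegenerate bilinear form `B`. -/
def adjointE (B : E4 →L[ℝ] E4 →L[ℝ] ℝ) (A : E4 →L[ℝ] E4) : E4 →L[ℝ] E4 :=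
  B.flip.inverse.comp ((ContinuousLinearMap.precomp ℝ A).comp B.flip)

/-- The symmetric part of `B(·, A·)`. -/
def symE (B : E4 →L[ℝ] E4 →L[ℝ] ℝ) (A : E4 →L[ℝ] E4) : E4 →L[ℝ] E4 →L[ℝ] ℝ :=
  (1 / 2 : ℝ) • (B.flip.comp A + (B.flip.comp A).flip)

/-- The symplectic adjoint `J^{*ω}`, determined by `ω(Jv, w) = ω(v, J^{*ω}w)`. -/
def sympAdjoint (Ω : BilField M) (J : EndField M) : EndField M := fun x ↦ adjointE (Ω x) (J x)

/-- The metric `g`, the symmetric part of `ω(·, J·)`. -/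
def metric (Ω : BilField M) (J : EndField M) : BilField M := fun x ↦ symE (Ω x) (J x)

theorem metric_apply (Ω : BilField M) (J : EndField M) (x : M) (v w : TangentSpace (𝓡 4) x) :
    metric Ω J x v w = (1 / 2 : ℝ) * (Ω x v (J x w) + Ω x w (J x v)) := by
  let B : E4 →L[ℝ] E4 →L[ℝ] ℝ := Ω x
  let A : E4 →L[ℝ] E4 := J x
  change (1 / 2 : ℝ) * (B w (A v) + B v (A w)) = (1 / 2 : ℝ) * (B v (A w) + B w (A v))
  ring

theorem sympAdjoint_apply (Ω : BilField M) (J : EndField M) (x : M)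
    (h : ∀ v, (∀ w, Ω x w v = 0) → v = 0) (v w : TangentSpace (𝓡 4) x) :
    Ω x (J x v) w = Ω x v (sympAdjoint Ω J x w) := by
  let B : E4 →L[ℝ] E4 →L[ℝ] ℝ := Ω x
  have hinj : Function.Injective B.flip := by
    rw [injective_iff_map_eq_zero]
    intro a ha
    exact h a fun w ↦ congrArg (fun f : E4 →L[ℝ] ℝ ↦ f w) ha
  have hrank : Module.finrank ℝ E4 = Module.finrank ℝ (E4 →L[ℝ] ℝ) := by
    rw [← (LinearMap.toContinuousLinearMap (𝕜 := ℝ) (E := E4) (F' := ℝ)).finrank_eq]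
    exact (Subspace.dual_finrank_eq (K := ℝ) (V := E4)).symm
  let L : E4 ≃L[ℝ] (E4 →L[ℝ] ℝ) :=
    (LinearEquiv.ofInjectiveOfFinrankEq B.flip.toLinearMap hinj hrank).toContinuousLinearEquiv
  have hL : (L : E4 →L[ℝ] (E4 →L[ℝ] ℝ)) = B.flip := by
    ext a
    rfl
  have key : B.flip (adjointE B (J x) w) = (B.flip w).comp (J x) := by
    unfold adjointE
    rw [← hL, ContinuousLinearMap.inverse_equiv]
    exact L.apply_symm_apply _
  exact (congrArg (fun f : E4 →L[ℝ] ℝ ↦ f v) key).symm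

/-- The angle function `p = -¼ tr(J J^{*ω})`. -/
def angleFn (Ω : BilField M) (J : EndField M) (x : M) : ℝ :=
  -(1 / 4 : ℝ) * LinearMap.trace ℝ (TangentSpace (𝓡 4) x)
    ((J x).comp (sympAdjoint Ω J x)).toLinearMap

/-- The commutator `[J, J^{*ω}]` as the `2`-form `g([J, J^{*ω}]·, ·)`. -/
def commForm (Ω : BilField M) (J : EndField M) (x : M) (v w : TangentSpace (𝓡 4) x) : ℝ :=
  metric Ω J x (J x (sympAdjoint Ω J x v) - sympAdjoint Ω J x (J x v)) w

/-- The tangent space at `x` to the torus orbit. -/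
def orbitTangent [MulAction Torus M] (x : M) : Submodule ℝ (TangentSpace (𝓡 4) x) :=
  Submodule.span ℝ (Set.range fun ξ : LieT ↦ fundField ξ x)

/-- `J` is an element of `DGK_ω^𝕋(M)`: a torus-invariant `ω`-tamed complex structure whose
symplectic adjoint is integrable, and such that `J^{*ω}` and `J` map the tangent spaces of the
torus orbits over the interior of the moment polytope to the same subspaces. -/
structure IsDGK [MulAction Torus M]
    (Ω : BilField M) (μ : M → (LieT →L[ℝ] ℝ)) (J : EndField M) : Prop where
  smooth : EndSmooth J
  sq : ∀ (x : M) (v : TangentSpace (𝓡 4) x), J x (J x v) = -v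
  tamed : ∀ (x : M) (v : TangentSpace (𝓡 4) x), v ≠ 0 → 0 < Ω x v (J x v)
  invariant : ∀ (t : Torus) (x : M) (v : TangentSpace (𝓡 4) x),
    J (t • x) (actDeriv t x v) = actDeriv t x (J x v)
  integrable : Integrable J
  integrable_adjoint : Integrable (sympAdjoint Ω J)
  antidiagonal : ∀ x ∈ openPart μ,
    (orbitTangent x).map (sympAdjoint Ω J x).toLinearMap
      = (orbitTangent x).map (J x).toLinearMap

/-! ### Momentum-angle coordinates -/

/-- The index of the momentum coordinate `μ^i` among the coordinates `(μ^1, μ^2, t^1, t^2)`. -/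
def muIdx (i : Fin 2) : Fin 4 := Fin.castAdd 2 i

/-- The index of the angular coordinate `t^i` among the coordinates `(μ^1, μ^2, t^1, t^2)`. -/
def tIdx (i : Fin 2) : Fin 4 := Fin.natAdd 2 i

/-- The differential at `x` of the `k`-th coordinate of the chart `e`, applied to `v`. -/
def dCoord (e : OpenPartialHomeomorph M E4) (k : Fin 4) (x : M) (v : TangentSpace (𝓡 4) x) : ℝ :=
  (show E4 from mfderiv (𝓡 4) (𝓡 4) e x v) k

/-- The partial derivative of `f` with respect to the `k`-th coordinate of the chart `e`. -/
def partialD (e : OpenPartialHomeomorph M E4) (k : Fin 4) (f : M → ℝ) : M → ℝ :=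
  fun x ↦ fderiv ℝ (f ∘ e.symm) (e x) (EuclideanSpace.single k (1 : ℝ))

/-- `e = (μ^1, μ^2, t^1, t^2)` is a system of coordinates on an open subset of the part of `M` over
the interior of the polytope, where `μ^i = μ^{ξ_i}` for the basis `ξ` of the Lie algebra and
`t^1, t^2` are angular coordinates induced by `J`: with `K_j = ξ_j^♯`, the differentials
`dt^i` are the last two elements of the coframe dual to `(-JK_1, -JK_2, K_1, K_2)`. -/
structure IsAngularChart [MulAction Torus M]
    (μ : M → (LieT →L[ℝ] ℝ)) (J : EndField M) (ξ : Module.Basis (Fin 2) ℝ LieT)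
    (e : OpenPartialHomeomorph M E4) : Prop where
  mem_atlas : e ∈ IsManifold.maximalAtlas (𝓡 4) ∞ M
  source_subset : e.source ⊆ openPart μ
  momentum : ∀ x ∈ e.source, ∀ i, e x (muIdx i) = μ x (ξ i)
  angle_fund : ∀ x ∈ e.source, ∀ i j,
    dCoord e (tIdx i) x (fundField (ξ j) x) = if i = j then 1 else 0
  angle_J_fund : ∀ x ∈ e.source, ∀ i j, dCoord e (tIdx i) x (J x (fundField (ξ j) x)) = 0

/-- In the coordinates `e = (μ^1, μ^2, t^1, t^2)`, `J` has the anti-diagonal form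
`J = ∑ Ψ_{ij} ∂/∂t^i ⊗ dμ^j - ∑ Ψ^{ij} ∂/∂μ^i ⊗ dt^j`, where `Ψ^{ij} = (Ψ⁻¹)_{ij}`. -/
structure IsAntidiagonal (e : OpenPartialHomeomorph M E4) (J : EndField M)
    (Ψ : M → Matrix (Fin 2) (Fin 2) ℝ) : Prop where
  isUnit : ∀ x ∈ e.source, IsUnit (Ψ x)
  t_part : ∀ x ∈ e.source, ∀ (v : TangentSpace (𝓡 4) x) (i : Fin 2),
    dCoord e (tIdx i) x (J x v) = ∑ j, Ψ x i j * dCoord e (muIdx j) x v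
  mu_part : ∀ x ∈ e.source, ∀ (v : TangentSpace (𝓡 4) x) (i : Fin 2),
    dCoord e (muIdx i) x (J x v) = -∑ j, (Ψ x)⁻¹ i j * dCoord e (tIdx j) x v

/-- The symmetric part of `Ψ`. -/
def symPart (Ψ : M → Matrix (Fin 2) (Fin 2) ℝ) : M → Matrix (Fin 2) (Fin 2) ℝ :=
  fun x ↦ (1 / 2 : ℝ) • (Ψ x + (Ψ x)ᵀ)

end ToricGK

end

open ToricGK

open Bundle FiberBundle VectorField
open scoped Manifold ContDiff Topology Matrix

set_option linter.unusedSectionVars false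

noncomputable section

namespace ToricGK

variable {M : Type*} [TopologicalSpace M] [ChartedSpace E4 M] [IsManifold (𝓡 4) ∞ M]


/-! ### Coordinate vector fields -/

/-! In momentum-angle coordinates everything acquires a normal form, after which each term of the
theorem is a rational expression in three functions of the momenta, their derivatives, and one
constant. Indices of momenta and angles run over 0, 1 below.

Normal form. The torus acts by translations in the angles, so invariance of `J` makes `Ψ` a function
of the momenta. The condition `J^{*ω}𝒦 = J𝒦` writes `JK_j` as `J^{*ω}k` with `k` tangent to the
orbit, hence `ω(JK_i, JK_j) = -ω(K_i, k) = 0`; therefore `ω = ∑ dμ^j ∧ dt^j`, and `J^{*ω}` is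
antidiagonal with matrix `-Ψᵀ`. Integrability of `J` closes the rows of `Ψ`, that of `J^{*ω}` closes
its columns; so `C` is constant and `S` is closed. With `Ψ = (a, b + c; b - c, d)`, `D = det S = ad
- b²` and `E = det Ψ = D + c²`, taming gives `D > 0`, and `g = ∑ S_{ij} dμ^i dμ^j + (D/E) ∑ S^{ij}
dt^i dt^j`.

Chern–Ricci form. For `I = J` or `I = J^{*ω}` the fields `K_j = ∂/∂t^j` are a holomorphic frame of
`(TM, I)` (`IsChernConnection.holomorphic`), and `g(IK_i, K_j) = 0`, so the Hermitian Gram matrix of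
the frame is the real matrix `G = (g(K_i, K_j))`, of determinant `D/E²`. The trace of the Chern
connection form is `∂ log det G`, with imaginary part `½ d^c log det G`
(`IsChernConnection.trace_im`). Its differential, with the chosen sign of the curvature, gives `ρ =
-½ dd^c log det G` (`IsChernRicciForm.eq_ddc`), which is the asserted expression.

Scalar curvature. Put `W = D S⁻¹∇D`. The cofactor matrix of a closed `S` is divergence free, so `div
W = L`, the trace of `D S⁻¹` against the Hessian of `D`; put `N = ⟨∇D, W⟩`. The quotient of `ρ ∧ F`
by `F ∧ F` is `toricScal`, an expression in `D`, `E`, `L`, `N`. Passing from `J` to `J^{*ω}`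
replaces `c` by `-c` and changes the sign of the matrix; neither affects these quantities, so the
two curvatures agree.

Final formula. Solving `dF = θ ∧ F` gives `θ = c(W₀ dμ¹ - W₁ dμ⁰)/(DE)`. Moreover `1 - p = 2D/E`,
the commutator form has momentum part `(4cD/E) dμ⁰ ∧ dμ¹`, and `-∑ ∂_i∂_j S^{ij} = L/D² - 2N/D³`.
The formula then is an identity of rational functions modulo `c² = E - D` (`toricScal_eq`). -/

theorem two_le_infty : (2 : ℕ∞ω) ≤ ∞ := WithTop.coe_le_coe.2 (le_top : (2 : ℕ∞) ≤ ⊤)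

/-- The standard constant vector fields on the model space. -/
def stdField (k : Fin 4) : VField E4 := fun _ ↦ (EuclideanSpace.single k (1 : ℝ) : E4)

/-- The coordinate vector field `∂/∂x^k` of the chart `e`. -/
def coordField (e : OpenPartialHomeomorph M E4) (k : Fin 4) : VField M :=
  mpullback (𝓡 4) (𝓡 4) e (stdField k)

section Chart

variable {e : OpenPartialHomeomorph M E4} (he : e ∈ IsManifold.maximalAtlas (𝓡 4) ∞ M)
include he

theorem chart_contMDiffAt {x : M} (hx : x ∈ e.source) : ContMDiffAt (𝓡 4) (𝓡 4) ∞ e x :=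
  contMDiffAt_of_mem_maximalAtlas he hx

theorem chart_symm_contMDiffAt {z : E4} (hz : z ∈ e.target) :
    ContMDiffAt (𝓡 4) (𝓡 4) ∞ e.symm z :=
  contMDiffAt_symm_of_mem_maximalAtlas he hz

theorem chart_mdifferentiable : e.MDifferentiable (𝓡 4) (𝓡 4) :=
  ⟨fun _ hx ↦ ((chart_contMDiffAt he hx).mdifferentiableAt (by simp)).mdifferentiableWithinAt,
    fun _ hz ↦ ((chart_symm_contMDiffAt he hz).mdifferentiableAt
      (by simp)).mdifferentiableWithinAt⟩

theorem chart_mfderiv_isInvertible {x : M} (hx : x ∈ e.source) :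
    (mfderiv (𝓡 4) (𝓡 4) e x).IsInvertible :=
  ⟨(chart_mdifferentiable he).mfderiv hx, rfl⟩

theorem chart_symm_mfderiv_isInvertible {x : M} (hx : x ∈ e.source) :
    (mfderiv (𝓡 4) (𝓡 4) e.symm (e x)).IsInvertible :=
  ⟨(chart_mdifferentiable he).symm.mfderiv (e.map_source hx), rfl⟩

theorem mfderiv_coordField {x : M} (hx : x ∈ e.source) (k : Fin 4) :
    mfderiv (𝓡 4) (𝓡 4) e x (coordField e k x) = stdField k (e x) := by
  obtain ⟨L, hL⟩ := chart_mfderiv_isInvertible he hx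
  rw [coordField, mpullback_apply, ← hL, ContinuousLinearMap.inverse_equiv]
  exact L.apply_symm_apply _

theorem dCoord_coordField {x : M} (hx : x ∈ e.source) (k l : Fin 4) :
    dCoord e k x (coordField e l x) = if k = l then 1 else 0 := by
  unfold dCoord
  rw [mfderiv_coordField he hx]
  simp [stdField]

omit he in
/-- The differential of a coordinate function as a linear form. -/
def dCoordL (e : OpenPartialHomeomorph M E4) (k : Fin 4) : OneForm M := fun x ↦
  (EuclideanSpace.proj k : E4 →L[ℝ] ℝ).comp
    (show TangentSpace (𝓡 4) x →L[ℝ] E4 from mfderiv (𝓡 4) (𝓡 4) e x)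

omit he in
omit [IsManifold (𝓡 4) ∞ M] in
theorem dCoordL_apply (k : Fin 4) (x : M) (v : TangentSpace (𝓡 4) x) :
    dCoordL e k x v = dCoord e k x v := rfl

theorem eq_of_dCoord_eq {x : M} (hx : x ∈ e.source) {v w : TangentSpace (𝓡 4) x}
    (h : ∀ k, dCoord e k x v = dCoord e k x w) : v = w := by
  apply (chart_mdifferentiable he).mfderiv_injective hx
  exact PiLp.ext h

theorem eq_sum_coordField {x : M} (hx : x ∈ e.source) (v : TangentSpace (𝓡 4) x) :
    v = ∑ k, dCoord e k x v • coordField e k x := by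
  refine eq_of_dCoord_eq he hx fun l ↦ ?_
  rw [← dCoordL_apply l x (∑ k, _), map_sum]
  simp [dCoordL_apply, dCoord_coordField he hx]

omit he in
/-- The basis of coordinate vectors at a point of the chart domain. -/
def coordBasis (he : e ∈ IsManifold.maximalAtlas (𝓡 4) ∞ M) {x : M} (hx : x ∈ e.source) :
    Module.Basis (Fin 4) ℝ (TangentSpace (𝓡 4) x) :=
  (EuclideanSpace.basisFun (Fin 4) ℝ).toBasis.map
    ((chart_mdifferentiable he).mfderiv hx).toLinearEquiv.symm

omit he in
theorem coordBasis_repr (he : e ∈ IsManifold.maximalAtlas (𝓡 4) ∞ M) {x : M} (hx : x ∈ e.source)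
    (v : TangentSpace (𝓡 4) x) (k : Fin 4) :
    (coordBasis he hx).repr v k = dCoord e k x v := by
  rfl

omit he in
theorem coordBasis_apply (he : e ∈ IsManifold.maximalAtlas (𝓡 4) ∞ M) {x : M} (hx : x ∈ e.source)
    (k : Fin 4) : coordBasis he hx k = coordField e k x := by
  refine eq_of_dCoord_eq he hx fun l ↦ ?_
  rw [← coordBasis_repr he hx, Module.Basis.repr_self, dCoord_coordField he hx,
    Finsupp.single_apply]
  simp [eq_comm]

theorem coordField_smoothAt {x : M} (hx : x ∈ e.source) (k : Fin 4) :
    VFieldSmoothAt (coordField e k) x := by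
  refine ContMDiffAt.mpullback_vectorField_preimage (n := ∞) ?_ (chart_contMDiffAt he hx)
    (chart_mfderiv_isInvertible he hx) (by simp)
  exact contMDiffAt_vectorSpace_iff_contDiffAt.2 contDiffAt_const

omit he in
theorem VFieldSmoothAt.diffAt {X : VField M} {x : M} (h : VFieldSmoothAt X x) :
    VFieldDiffAt X x :=
  ContMDiffAt.mdifferentiableAt h (by simp)

theorem coordField_diffAt {x : M} (hx : x ∈ e.source) (k : Fin 4) :
    VFieldDiffAt (coordField e k) x :=
  (coordField_smoothAt he hx k).diffAt

omit he in
theorem stdField_diffAt (k : Fin 4) (z : E4) : VFieldDiffAt (stdField k) z :=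
  (contMDiffAt_vectorSpace_iff_contDiffAt (n := 1).2 contDiffAt_const).mdifferentiableAt
    one_ne_zero

omit he in
theorem mlieBracket_stdField (k l : Fin 4) (z : E4) :
    mlieBracket (𝓡 4) (stdField k) (stdField l) z = 0 := by
  rw [← mlieBracketWithin_univ, mlieBracketWithin_eq_lieBracketWithin]
  have h (k : Fin 4) : (stdField k : E4 → E4) = fun _ ↦ EuclideanSpace.single k (1 : ℝ) := rfl
  rw [h k, h l]
  change fderivWithin ℝ (fun _ : E4 ↦ (EuclideanSpace.single l (1 : ℝ) : E4)) _ z _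
    - fderivWithin ℝ (fun _ : E4 ↦ (EuclideanSpace.single k (1 : ℝ) : E4)) _ z _ = (0 : E4)
  simp

theorem mlieBracket_coordField {x : M} (hx : x ∈ e.source) (k l : Fin 4) :
    mlieBracket (𝓡 4) (coordField e k) (coordField e l) x = 0 := by
  have : IsManifold (𝓡 4) (minSmoothness ℝ 2) M := by
    rw [minSmoothness_of_isRCLikeNormedField]; infer_instance
  have : IsManifold (𝓡 4) (minSmoothness ℝ 2) E4 := by
    rw [minSmoothness_of_isRCLikeNormedField]; infer_instance
  unfold coordField
  rw [← mpullback_mlieBracket (n := ∞) (stdField_diffAt k _) (stdField_diffAt l _)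
    (chart_contMDiffAt he hx) (by rw [minSmoothness_of_isRCLikeNormedField]; exact two_le_infty),
    mpullback_apply, mlieBracket_stdField, map_zero]

theorem mvfderiv_coordField {x : M} (hx : x ∈ e.source) (k : Fin 4) {f : M → ℝ}
    (hf : MDifferentiableAt (𝓡 4) 𝓘(ℝ, ℝ) f x) :
    mvfderiv (𝓡 4) f x (coordField e k x) = partialD e k f x := by
  have hf' : MDifferentiableAt (𝓡 4) 𝓘(ℝ, ℝ) (f ∘ e.symm) (e x) := by
    refine MDifferentiableAt.comp (e x) ?_
      ((chart_mdifferentiable he).mdifferentiableAt_symm (e.map_source hx))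
    rwa [e.left_inv hx]
  have h0 : mvfderiv (𝓡 4) f x = mvfderiv (𝓡 4) ((f ∘ e.symm) ∘ e) x := by
    have : mfderiv (𝓡 4) 𝓘(ℝ, ℝ) f x = mfderiv (𝓡 4) 𝓘(ℝ, ℝ) ((f ∘ e.symm) ∘ e) x := by
      refine Filter.EventuallyEq.mfderiv_eq ?_
      filter_upwards [e.open_source.mem_nhds hx] with y hy
      simp [e.left_inv hy]
    exact this
  rw [h0, mvfderiv_comp_apply x hf' ((chart_mdifferentiable he).mdifferentiableAt hx),
    mfderiv_coordField he hx]
  unfold partialD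
  rw [← mfderiv_eq_fderiv]
  rfl

/-- Pulling back along `e.symm` is pushing forward along `e`, so the components of a field on `M`
are those of a field on the model space. This transfers regularity from vector fields to their
components. -/
theorem pushforward_apply {x : M} (hx : x ∈ e.source) (X : VField M) :
    mpullback (𝓡 4) (𝓡 4) e.symm X (e x)
      = mfderiv (𝓡 4) (𝓡 4) e x (show TangentSpace (𝓡 4) x from X x) := by
  obtain ⟨L, hL⟩ := chart_symm_mfderiv_isInvertible he hx
  have h := (chart_mdifferentiable he).symm_comp_deriv hx
  rw [mpullback_apply, ← hL, ContinuousLinearMap.inverse_equiv]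
  refine L.injective ((L.apply_symm_apply _).trans ?_)
  have h2 := congrArg (fun A ↦ A (X x)) h
  rw [← hL] at h2
  refine Eq.trans ?_ h2.symm
  exact congrArg (fun y ↦ (X y : E4)) (e.left_inv hx)

theorem dCoord_smoothAt {x : M} (hx : x ∈ e.source) (k : Fin 4) {X : VField M}
    (hX : VFieldSmoothAt X x) :
    ContMDiffAt (𝓡 4) 𝓘(ℝ, ℝ) ∞ (fun y ↦ dCoord e k y (X y)) x := by
  have hX' : VFieldSmoothAt X (e.symm (e x)) := by rwa [e.left_inv hx]
  have h : VFieldSmoothAt (mpullback (𝓡 4) (𝓡 4) e.symm X) (e x) :=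
    ContMDiffAt.mpullback_vectorField_preimage (n := ∞) hX'
      (chart_symm_contMDiffAt he (e.map_source hx)) (chart_symm_mfderiv_isInvertible he hx)
      (by simp)
  let X' : E4 → E4 := mpullback (𝓡 4) (𝓡 4) e.symm X
  have h1 : ContDiffAt ℝ ∞ X' (e x) :=
    contMDiffAt_vectorSpace_iff_contDiffAt.1 h
  have h2 : ContDiffAt ℝ ∞ (fun z ↦ X' z k) (e x) :=
    (EuclideanSpace.proj k : E4 →L[ℝ] ℝ).contDiff.contDiffAt.comp (e x) h1
  refine (h2.contMDiffAt.comp x (chart_contMDiffAt he hx)).congr_of_eventuallyEq ?_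
  filter_upwards [e.open_source.mem_nhds hx] with y hy
  exact congrArg (fun v : E4 ↦ v k) (pushforward_apply he hy X).symm

theorem dCoord_mdifferentiableAt {x : M} (hx : x ∈ e.source) (k : Fin 4) {X : VField M}
    (hX : VFieldDiffAt X x) :
    MDifferentiableAt (𝓡 4) 𝓘(ℝ, ℝ) (fun y ↦ dCoord e k y (X y)) x := by
  have hX' : VFieldDiffAt X (e.symm (e x)) := by rwa [e.left_inv hx]
  have h : VFieldDiffAt (mpullback (𝓡 4) (𝓡 4) e.symm X) (e x) :=
    MDifferentiableAt.mpullback_vectorField (n := ∞) hX'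
      (chart_symm_contMDiffAt he (e.map_source hx)) (chart_symm_mfderiv_isInvertible he hx)
      two_le_infty
  let X' : E4 → E4 := mpullback (𝓡 4) (𝓡 4) e.symm X
  have h1 : MDifferentiableAt (𝓡 4) (𝓡 4) X' (e x) := by
    have := (mdifferentiableAt_section (𝓡 4) _).1 h
    simpa using this
  have h2 : MDifferentiableAt (𝓡 4) 𝓘(ℝ, ℝ) (fun z ↦ X' z k) (e x) :=
    (EuclideanSpace.proj k : E4 →L[ℝ] ℝ).differentiableAt.mdifferentiableAt.comp (e x) h1
  refine (h2.comp x ((chart_mdifferentiable he).mdifferentiableAt hx)).congr_of_eventuallyEq ?_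
  filter_upwards [e.open_source.mem_nhds hx] with y hy
  exact congrArg (fun v : E4 ↦ v k) (pushforward_apply he hy X).symm

end Chart

/-! ### Calculus in a chart -/

/-- `f` is smooth on the domain of the chart `e`. -/
def SmoothIn (e : OpenPartialHomeomorph M E4) (f : M → ℝ) : Prop :=
  ContDiffOn ℝ ∞ (f ∘ e.symm) e.target

section Partial

variable {e : OpenPartialHomeomorph M E4} {f g : M → ℝ} {x : M}

theorem SmoothIn.differentiableAt (hf : SmoothIn e f) (hx : x ∈ e.source) :
    DifferentiableAt ℝ (f ∘ e.symm) (e x) :=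
  (hf.contDiffAt (e.open_target.mem_nhds (e.map_source hx))).differentiableAt (by simp)

theorem SmoothIn.congr (hf : SmoothIn e f) (h : ∀ y ∈ e.source, g y = f y) : SmoothIn e g :=
  ContDiffOn.congr hf fun _ hz ↦ h _ (e.map_target hz)

theorem SmoothIn.add (hf : SmoothIn e f) (hg : SmoothIn e g) : SmoothIn e (fun y ↦ f y + g y) :=
  ContDiffOn.add hf hg

theorem SmoothIn.sub (hf : SmoothIn e f) (hg : SmoothIn e g) : SmoothIn e (fun y ↦ f y - g y) :=
  ContDiffOn.sub hf hg

theorem SmoothIn.neg (hf : SmoothIn e f) : SmoothIn e (fun y ↦ -f y) :=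
  ContDiffOn.neg hf

theorem SmoothIn.mul (hf : SmoothIn e f) (hg : SmoothIn e g) : SmoothIn e (fun y ↦ f y * g y) :=
  ContDiffOn.mul hf hg

theorem SmoothIn.const (c : ℝ) : SmoothIn e (fun _ ↦ c) := contDiffOn_const

theorem SmoothIn.div (hf : SmoothIn e f) (hg : SmoothIn e g) (h0 : ∀ y ∈ e.source, g y ≠ 0) :
    SmoothIn e (fun y ↦ f y / g y) :=
  ContDiffOn.div hf hg fun _ hz ↦ h0 _ (e.map_target hz)

theorem SmoothIn.log (hf : SmoothIn e f) (h0 : ∀ y ∈ e.source, f y ≠ 0) :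
    SmoothIn e (fun y ↦ Real.log (f y)) :=
  ContDiffOn.log hf fun _ hz ↦ h0 _ (e.map_target hz)

theorem SmoothIn.sum {ι : Type*} {s : Finset ι} {F : ι → M → ℝ} (h : ∀ i ∈ s, SmoothIn e (F i)) :
    SmoothIn e (fun y ↦ ∑ i ∈ s, F i y) := by
  have := ContDiffOn.sum (s := s) (t := e.target) (f := fun i ↦ F i ∘ e.symm) (n := ∞) (𝕜 := ℝ) h
  exact this

theorem SmoothIn.partialD (hf : SmoothIn e f) (k : Fin 4) : SmoothIn e (partialD e k f) := by
  have h1 : ContDiffOn ℝ ∞ (fun z ↦ fderiv ℝ (f ∘ e.symm) z (EuclideanSpace.single k (1 : ℝ)))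
      e.target :=
    (ContDiffOn.fderiv_of_isOpen hf e.open_target (by simp)).clm_apply contDiffOn_const
  refine h1.congr fun z hz ↦ ?_
  simp only [Function.comp_apply, ToricGK.partialD]
  rw [e.right_inv hz]

theorem partialD_congr (k : Fin 4) (h : ∀ y ∈ e.source, g y = f y) (hx : x ∈ e.source) :
    partialD e k g x = partialD e k f x := by
  unfold partialD
  rw [Filter.EventuallyEq.fderiv_eq]
  filter_upwards [e.open_target.mem_nhds (e.map_source hx)] with z hz
  exact h _ (e.map_target hz)

theorem partialD_const (k : Fin 4) (c : ℝ) : partialD e k (fun _ ↦ c) x = 0 := by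
  have : ((fun _ ↦ c : M → ℝ) ∘ e.symm) = fun _ ↦ c := rfl
  simp [partialD, this]

theorem partialD_add (k : Fin 4) (hf : SmoothIn e f) (hg : SmoothIn e g) (hx : x ∈ e.source) :
    partialD e k (fun y ↦ f y + g y) x = partialD e k f x + partialD e k g x := by
  unfold partialD
  rw [← add_apply, ← fderiv_add (hf.differentiableAt hx)
    (hg.differentiableAt hx)]
  rfl

theorem partialD_sub (k : Fin 4) (hf : SmoothIn e f) (hg : SmoothIn e g) (hx : x ∈ e.source) :
    partialD e k (fun y ↦ f y - g y) x = partialD e k f x - partialD e k g x := by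
  unfold partialD
  rw [← sub_apply, ← fderiv_sub (hf.differentiableAt hx)
    (hg.differentiableAt hx)]
  rfl

theorem partialD_neg (k : Fin 4) :
    partialD e k (fun y ↦ -f y) x = -partialD e k f x := by
  unfold partialD
  rw [← neg_apply, ← fderiv_neg]
  rfl

theorem partialD_mul (k : Fin 4) (hf : SmoothIn e f) (hg : SmoothIn e g) (hx : x ∈ e.source) :
    partialD e k (fun y ↦ f y * g y) x = partialD e k f x * g x + f x * partialD e k g x := by
  have h := fderiv_mul (hf.differentiableAt hx) (hg.differentiableAt hx)
  have h' := congrArg (fun L ↦ L (EuclideanSpace.single k (1 : ℝ))) h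
  refine Eq.trans h' ?_
  simp [partialD, e.left_inv hx]
  ring

theorem partialD_div (k : Fin 4) (hf : SmoothIn e f) (hg : SmoothIn e g) (hx : x ∈ e.source)
    (h0 : ∀ y ∈ e.source, g y ≠ 0) :
    partialD e k (fun y ↦ f y / g y) x
      = (partialD e k f x * g x - f x * partialD e k g x) / (g x) ^ 2 := by
  -- The quotient rule is the product rule for `f = (f / g) * g`, solved for the derivative of `f /
  -- g`.
  have h1 := partialD_mul k (hf.div hg h0) hg hx
  rw [partialD_congr (f := f) k (fun y hy ↦ div_mul_cancel₀ _ (h0 y hy)) hx] at h1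
  have := h0 x hx
  rw [h1]
  field_simp
  ring

theorem partialD_log (k : Fin 4) (hf : SmoothIn e f) (hx : x ∈ e.source) (h0 : f x ≠ 0) :
    partialD e k (fun y ↦ Real.log (f y)) x = partialD e k f x / f x := by
  have h := fderiv.log (hf.differentiableAt hx) (by simpa [e.left_inv hx])
  have h' := congrArg (fun L ↦ L (EuclideanSpace.single k (1 : ℝ))) h
  refine Eq.trans h' ?_
  simp [partialD, e.left_inv hx]
  ring

theorem partialD_comm (k l : Fin 4) (hf : SmoothIn e f) (hx : x ∈ e.source) :
    partialD e k (partialD e l f) x = partialD e l (partialD e k f) x := by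
  have hz := e.map_source hx
  have hc : ContDiffAt ℝ ∞ (f ∘ e.symm) (e x) := hf.contDiffAt (e.open_target.mem_nhds hz)
  have key (k l : Fin 4) : partialD e k (partialD e l f) x
      = fderiv ℝ (fderiv ℝ (f ∘ e.symm)) (e x) (EuclideanSpace.single k (1 : ℝ))
        (EuclideanSpace.single l (1 : ℝ)) := by
    have h2 : DifferentiableAt ℝ (fderiv ℝ (f ∘ e.symm)) (e x) :=
      (hc.fderiv_right (m := 1) two_le_infty).differentiableAt
        one_ne_zero
    have h3 : fderiv ℝ (partialD e l f ∘ e.symm) (e x)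
        = fderiv ℝ (fun z ↦ fderiv ℝ (f ∘ e.symm) z (EuclideanSpace.single l (1 : ℝ))) (e x) := by
      apply Filter.EventuallyEq.fderiv_eq
      filter_upwards [e.open_target.mem_nhds hz] with z hz
      simp only [Function.comp_apply, partialD]
      rw [e.right_inv hz]
    rw [partialD, h3, fderiv_clm_apply h2 (differentiableAt_const _)]
    simp
  rw [key, key]
  exact (hc.isSymmSndFDerivAt (by simpa using two_le_infty)).eq _ _

end Partial

/-! ### Exterior derivatives in a chart -/

section Forms

variable {e : OpenPartialHomeomorph M E4} (he : e ∈ IsManifold.maximalAtlas (𝓡 4) ∞ M)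
include he

theorem smoothIn_of_contMDiffAt {f : M → ℝ}
    (h : ∀ y ∈ e.source, ContMDiffAt (𝓡 4) 𝓘(ℝ, ℝ) ∞ f y) : SmoothIn e f := by
  intro z hz
  refine ContDiffAt.contDiffWithinAt ?_
  exact ((h _ (e.map_target hz)).comp z (chart_symm_contMDiffAt he hz)).contDiffAt

theorem SmoothIn.contMDiffAt {f : M → ℝ} (h : SmoothIn e f) {x : M} (hx : x ∈ e.source) :
    ContMDiffAt (𝓡 4) 𝓘(ℝ, ℝ) ∞ f x := by
  have h1 : ContDiffAt ℝ ∞ (f ∘ e.symm) (e x) :=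
    ContDiffOn.contDiffAt h (e.open_target.mem_nhds (e.map_source hx))
  refine (h1.contMDiffAt.comp x (chart_contMDiffAt he hx)).congr_of_eventuallyEq ?_
  filter_upwards [e.open_source.mem_nhds hx] with y hy
  simp [e.left_inv hy]

theorem SmoothIn.mdifferentiableAt {f : M → ℝ} (h : SmoothIn e f) {x : M} (hx : x ∈ e.source) :
    MDifferentiableAt (𝓡 4) 𝓘(ℝ, ℝ) f x :=
  (h.contMDiffAt he hx).mdifferentiableAt (by simp)

theorem oneForm_apply_eq_sum {y : M} (hy : y ∈ e.source) (α : TangentSpace (𝓡 4) y →L[ℝ] ℝ)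
    (v : TangentSpace (𝓡 4) y) :
    α v = ∑ k, dCoord e k y v * α (coordField e k y) := by
  conv_lhs => rw [eq_sum_coordField he hy v, map_sum]
  simp

theorem bilForm_apply_eq_sum {y : M} (hy : y ∈ e.source)
    (β : TangentSpace (𝓡 4) y →L[ℝ] TangentSpace (𝓡 4) y →L[ℝ] ℝ) (v w : TangentSpace (𝓡 4) y) :
    β v w = ∑ k, ∑ l, dCoord e k y v * dCoord e l y w
      * β (coordField e k y) (coordField e l y) := by
  have h : β v w = ∑ k, dCoord e k y v * β (coordField e k y) w := by
    conv_lhs => rw [eq_sum_coordField he hy v, map_sum]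
    simp
  rw [h]
  refine Finset.sum_congr rfl fun k _ ↦ ?_
  rw [oneForm_apply_eq_sum he hy (β (coordField e k y)) w, Finset.mul_sum]
  exact Finset.sum_congr rfl fun l _ ↦ by ring

/-- Only the components in the coordinate frame are assumed smooth. Forms such as `d^c log det S`
are controlled on the chart domain alone. -/
theorem oneForm_mdifferentiableAt {α : OneForm M}
    (hα : ∀ k, SmoothIn e (fun y ↦ α y (coordField e k y))) {x : M} (hx : x ∈ e.source)
    {X : VField M} (hX : VFieldDiffAt X x) :
    MDifferentiableAt (𝓡 4) 𝓘(ℝ, ℝ) (fun y ↦ α y (X y)) x := by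
  have h : MDifferentiableAt (𝓡 4) 𝓘(ℝ, ℝ)
      (fun y ↦ ∑ k, dCoord e k y (X y) * α y (coordField e k y)) x := by
    have h' (k : Fin 4) : MDifferentiableAt (𝓡 4) 𝓘(ℝ, ℝ)
        (fun y ↦ dCoord e k y (X y) * α y (coordField e k y)) x :=
      (dCoord_mdifferentiableAt he hx k hX).mul ((hα k).mdifferentiableAt he hx)
    simp only [Fin.sum_univ_four]
    exact (((h' 0).add (h' 1)).add (h' 2)).add (h' 3)
  refine h.congr_of_eventuallyEq ?_
  filter_upwards [e.open_source.mem_nhds hx] with y hy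
  exact oneForm_apply_eq_sum he hy (α y) (X y)

theorem bilForm_mdifferentiableAt {β : BilField M}
    (hβ : ∀ k l, SmoothIn e (fun y ↦ β y (coordField e k y) (coordField e l y))) {x : M}
    (hx : x ∈ e.source) {X Y : VField M} (hX : VFieldDiffAt X x) (hY : VFieldDiffAt Y x) :
    MDifferentiableAt (𝓡 4) 𝓘(ℝ, ℝ) (fun y ↦ β y (X y) (Y y)) x := by
  have h : MDifferentiableAt (𝓡 4) 𝓘(ℝ, ℝ)
      (fun y ↦ ∑ k, ∑ l, dCoord e k y (X y) * dCoord e l y (Y y)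
        * β y (coordField e k y) (coordField e l y)) x := by
    have h' (k l : Fin 4) : MDifferentiableAt (𝓡 4) 𝓘(ℝ, ℝ)
        (fun y ↦ dCoord e k y (X y) * dCoord e l y (Y y)
          * β y (coordField e k y) (coordField e l y)) x :=
      ((dCoord_mdifferentiableAt he hx k hX).mul
        (dCoord_mdifferentiableAt he hx l hY)).mul ((hβ k l).mdifferentiableAt he hx)
    simp only [Fin.sum_univ_four]
    have h'' (k : Fin 4) := (((h' k 0).add (h' k 1)).add (h' k 2)).add (h' k 3)
    exact (((h'' 0).add (h'' 1)).add (h'' 2)).add (h'' 3)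
  refine h.congr_of_eventuallyEq ?_
  filter_upwards [e.open_source.mem_nhds hx] with y hy
  exact bilForm_apply_eq_sum he hy (β y) (X y) (Y y)

omit he

/-- The defining expression of the exterior derivative of a `1`-form. -/
def dOneExpr (α : OneForm M) (x : M) (X Y : VField M) : ℝ :=
  mvfderiv (𝓡 4) (fun y ↦ α y (Y y)) x (X x) - mvfderiv (𝓡 4) (fun y ↦ α y (X y)) x (Y x)
    - α x (mlieBracket (𝓡 4) X Y x)

theorem dOneExpr_swap (α : OneForm M) (x : M) (X Y : VField M) :
    dOneExpr α x X Y = -dOneExpr α x Y X := by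
  unfold dOneExpr
  rw [mlieBracket_swap_apply, map_neg]
  ring

/-- The term with the derivative of `f` from the product rule cancels the one from the bracket `[fX,
Y]`. -/
theorem dOneExpr_tensorial_left {α : OneForm M} {x : M}
    (hα : ∀ X, VFieldDiffAt X x → MDifferentiableAt (𝓡 4) 𝓘(ℝ, ℝ) (fun y ↦ α y (X y)) x)
    (Y : VField M) : TensorialAt (𝓡 4) E4 (dOneExpr α x · Y) x where
  smul {f X} hf hX := by
    have h : (fun y ↦ α y ((f • X) y)) = f * fun y ↦ α y (X y) := by
      ext y; simp
    simp only [dOneExpr]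
    rw [h, mvfderiv_mul hf (hα X hX), mlieBracket_smul_left hf hX]
    simp
    ring
  add {X X'} hX hX' := by
    have h : (fun y ↦ α y ((X + X') y)) = (fun y ↦ α y (X y)) + fun y ↦ α y (X' y) := by
      ext y; simp
    simp only [dOneExpr]
    rw [h, mvfderiv_add (hα X hX) (hα X' hX'), mlieBracket_add_left hX hX']
    simp
    ring

theorem dOneExpr_tensorial_right {α : OneForm M} {x : M}
    (hα : ∀ X, VFieldDiffAt X x → MDifferentiableAt (𝓡 4) 𝓘(ℝ, ℝ) (fun y ↦ α y (X y)) x)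
    (X : VField M) : TensorialAt (𝓡 4) E4 (dOneExpr α x X ·) x where
  smul hf hY := by
    rw [dOneExpr_swap, (dOneExpr_tensorial_left hα X).smul hf hY, dOneExpr_swap α x X]
    simp
  add hY hY' := by
    rw [dOneExpr_swap, (dOneExpr_tensorial_left hα X).add hY hY', dOneExpr_swap α x X,
      dOneExpr_swap α x X]
    ring

/-- By tensoriality the arbitrary extensions in the definition of `dOne` may be replaced by any
differentiable fields, in particular by commuting coordinate fields. -/
theorem dOne_eq_expr {α : OneForm M} {x : M}
    (hα : ∀ X, VFieldDiffAt X x → MDifferentiableAt (𝓡 4) 𝓘(ℝ, ℝ) (fun y ↦ α y (X y)) x)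
    {X Y : VField M} (hX : VFieldDiffAt X x) (hY : VFieldDiffAt Y x) :
    dOne α x (X x) (Y x) = dOneExpr α x X Y := by
  have h := TensorialAt.pointwise₂ (I := 𝓡 4) (F := E4) (F' := E4) (Φ := dOneExpr α x)
    (fun Z _ ↦ dOneExpr_tensorial_left hα Z) (fun Z _ ↦ dOneExpr_tensorial_right hα Z)
    (σ := extend E4 (X x)) (σ' := X) (τ := extend E4 (Y x)) (τ' := Y)
    (mdifferentiableAt_extend ..) hX (mdifferentiableAt_extend ..) hY (by simp) (by simp)
  rw [← h]
  simp [dOne, dOneExpr]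

include he

theorem dOne_coordField {α : OneForm M}
    (hα : ∀ k, SmoothIn e (fun y ↦ α y (coordField e k y))) {x : M} (hx : x ∈ e.source)
    (k l : Fin 4) :
    dOne α x (coordField e k x) (coordField e l x)
      = partialD e k (fun y ↦ α y (coordField e l y)) x
        - partialD e l (fun y ↦ α y (coordField e k y)) x := by
  rw [dOne_eq_expr (fun X hX ↦ oneForm_mdifferentiableAt he hα hx hX)
    (coordField_diffAt he hx k) (coordField_diffAt he hx l), dOneExpr,
    mlieBracket_coordField he hx, mvfderiv_coordField he hx k ((hα l).mdifferentiableAt he hx),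
    mvfderiv_coordField he hx l ((hα k).mdifferentiableAt he hx)]
  simp

/-- `dOne` is not bilinear by definition; tensoriality produces the bilinear map that it is. -/
theorem dOne_eq_sum {α : OneForm M}
    (hα : ∀ k, SmoothIn e (fun y ↦ α y (coordField e k y))) {x : M} (hx : x ∈ e.source)
    (v w : TangentSpace (𝓡 4) x) :
    dOne α x v w = ∑ k, ∑ l, dCoord e k x v * dCoord e l x w
      * dOne α x (coordField e k x) (coordField e l x) := by
  have hα' := fun X hX ↦ oneForm_mdifferentiableAt (X := X) he hα hx hX
  let B := TensorialAt.mkHom₂ (I := 𝓡 4) (F := E4) (F' := E4) (dOneExpr α x) x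
    (fun Z _ ↦ dOneExpr_tensorial_left hα' Z) (fun Z _ ↦ dOneExpr_tensorial_right hα' Z)
  have hB (v w : TangentSpace (𝓡 4) x) : dOne α x v w = B v w := by
    rw [TensorialAt.mkHom₂_apply_eq_extend]
    simp [dOne, dOneExpr]
  simp only [hB]
  exact bilForm_apply_eq_sum he hx B v w

omit he

/-- The defining expression of the exterior derivative of a `2`-form. -/
def dTwoExpr (β : BilField M) (x : M) (X Y Z : VField M) : ℝ :=
  mvfderiv (𝓡 4) (fun y ↦ β y (Y y) (Z y)) x (X x)
    + mvfderiv (𝓡 4) (fun y ↦ β y (Z y) (X y)) x (Y x)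
    + mvfderiv (𝓡 4) (fun y ↦ β y (X y) (Y y)) x (Z x)
    - β x (mlieBracket (𝓡 4) X Y x) (Z x)
    - β x (mlieBracket (𝓡 4) Y Z x) (X x)
    - β x (mlieBracket (𝓡 4) Z X x) (Y x)

theorem dTwoExpr_cycle (β : BilField M) (x : M) (X Y Z : VField M) :
    dTwoExpr β x X Y Z = dTwoExpr β x Y Z X := by
  unfold dTwoExpr
  ring

/-- As for `1`-forms, the derivatives of `f` cancel; here this uses the antisymmetry of `β` at the
point. -/
theorem dTwoExpr_tensorial {β : BilField M} {x : M}
    (hβ : ∀ X Y, VFieldDiffAt X x → VFieldDiffAt Y x →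
      MDifferentiableAt (𝓡 4) 𝓘(ℝ, ℝ) (fun y ↦ β y (X y) (Y y)) x)
    (halt : ∀ v w : TangentSpace (𝓡 4) x, β x v w = -β x w v)
    {Y Z : VField M} (hY : VFieldDiffAt Y x) (hZ : VFieldDiffAt Z x) :
    TensorialAt (𝓡 4) E4 (dTwoExpr β x · Y Z) x where
  smul {f X} hf hX := by
    have h1 : (fun y ↦ β y (Z y) ((f • X) y)) = f * fun y ↦ β y (Z y) (X y) := by
      ext y; simp
    have h2 : (fun y ↦ β y ((f • X) y) (Y y)) = f * fun y ↦ β y (X y) (Y y) := by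
      ext y; simp
    simp only [dTwoExpr]
    rw [h1, h2, mvfderiv_mul hf (hβ Z X hZ hX), mvfderiv_mul hf (hβ X Y hX hY),
      mlieBracket_smul_left hf hX, mlieBracket_smul_right hf hX]
    simp
    rw [halt (X x) (Z x)]
    ring
  add {X X'} hX hX' := by
    have h1 : (fun y ↦ β y (Z y) ((X + X') y))
        = (fun y ↦ β y (Z y) (X y)) + fun y ↦ β y (Z y) (X' y) := by
      ext y; simp
    have h2 : (fun y ↦ β y ((X + X') y) (Y y))
        = (fun y ↦ β y (X y) (Y y)) + fun y ↦ β y (X' y) (Y y) := by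
      ext y; simp
    simp only [dTwoExpr]
    rw [h1, h2, mvfderiv_add (hβ Z X hZ hX) (hβ Z X' hZ hX'),
      mvfderiv_add (hβ X Y hX hY) (hβ X' Y hX' hY),
      mlieBracket_add_left hX hX', mlieBracket_add_right hX hX']
    simp
    ring

theorem dTwo_eq_expr {β : BilField M} {x : M}
    (hβ : ∀ X Y, VFieldDiffAt X x → VFieldDiffAt Y x →
      MDifferentiableAt (𝓡 4) 𝓘(ℝ, ℝ) (fun y ↦ β y (X y) (Y y)) x)
    (halt : ∀ v w : TangentSpace (𝓡 4) x, β x v w = -β x w v)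
    {X Y Z : VField M} (hX : VFieldDiffAt X x) (hY : VFieldDiffAt Y x) (hZ : VFieldDiffAt Z x) :
    dTwo β x (X x) (Y x) (Z x) = dTwoExpr β x X Y Z := by
  have hext (v : TangentSpace (𝓡 4) x) : VFieldDiffAt (extend E4 v) x :=
    mdifferentiableAt_extend ..
  have h0 : dTwo β x (X x) (Y x) (Z x)
      = dTwoExpr β x (extend E4 (X x)) (extend E4 (Y x)) (extend E4 (Z x)) := by
    simp [dTwo, dTwoExpr]
  -- Tensoriality is available in the first slot; cyclic symmetry brings each argument there in
  -- turn, and the third rotation restores the order.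
  rw [h0, (dTwoExpr_tensorial hβ halt (hext (Y x)) (hext (Z x))).pointwise (hext (X x)) hX
    (by simp), dTwoExpr_cycle,
    (dTwoExpr_tensorial hβ halt (hext (Z x)) hX).pointwise (hext (Y x)) hY (by simp),
    dTwoExpr_cycle,
    (dTwoExpr_tensorial hβ halt hX hY).pointwise (hext (Z x)) hZ (by simp), dTwoExpr_cycle]

include he

theorem dTwo_coordField {β : BilField M}
    (hβ : ∀ k l, SmoothIn e (fun y ↦ β y (coordField e k y) (coordField e l y))) {x : M}
    (hx : x ∈ e.source) (halt : ∀ v w : TangentSpace (𝓡 4) x, β x v w = -β x w v)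
    (i j k : Fin 4) :
    dTwo β x (coordField e i x) (coordField e j x) (coordField e k x)
      = partialD e i (fun y ↦ β y (coordField e j y) (coordField e k y)) x
        + partialD e j (fun y ↦ β y (coordField e k y) (coordField e i y)) x
        + partialD e k (fun y ↦ β y (coordField e i y) (coordField e j y)) x := by
  rw [dTwo_eq_expr (fun X Y hX hY ↦ bilForm_mdifferentiableAt he hβ hx hX hY) halt
    (coordField_diffAt he hx i) (coordField_diffAt he hx j) (coordField_diffAt he hx k), dTwoExpr,
    mlieBracket_coordField he hx, mlieBracket_coordField he hx, mlieBracket_coordField he hx,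
    mvfderiv_coordField he hx _ ((hβ _ _).mdifferentiableAt he hx),
    mvfderiv_coordField he hx _ ((hβ _ _).mdifferentiableAt he hx),
    mvfderiv_coordField he hx _ ((hβ _ _).mdifferentiableAt he hx)]
  simp

end Forms

/-! ### Lie brackets and antidiagonal complex structures in a chart -/

section Antidiagonal

variable {e : OpenPartialHomeomorph M E4} (he : e ∈ IsManifold.maximalAtlas (𝓡 4) ∞ M)
include he

/-- This is `d(dx^m) = 0`, evaluated on `X` and `Y`. -/
theorem dCoord_mlieBracket {x : M} (hx : x ∈ e.source) {X Y : VField M} (hX : VFieldDiffAt X x)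
    (hY : VFieldDiffAt Y x) (m : Fin 4) :
    dCoord e m x (mlieBracket (𝓡 4) X Y x)
      = mvfderiv (𝓡 4) (fun y ↦ dCoord e m y (Y y)) x (X x)
        - mvfderiv (𝓡 4) (fun y ↦ dCoord e m y (X y)) x (Y x) := by
  have hc (k : Fin 4) (y : M) (hy : y ∈ e.source) :
      dCoordL e m y (coordField e k y) = if m = k then 1 else 0 := dCoord_coordField he hy m k
  have hs (k : Fin 4) : SmoothIn e (fun y ↦ dCoordL e m y (coordField e k y)) :=
    (SmoothIn.const (if m = k then 1 else 0)).congr (hc k)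
  have h0 : dOne (dCoordL e m) x (X x) (Y x) = 0 := by
    rw [dOne_eq_sum he hs hx]
    refine Finset.sum_eq_zero fun k _ ↦ Finset.sum_eq_zero fun l _ ↦ ?_
    rw [dOne_coordField he hs hx, partialD_congr k (hc l) hx, partialD_congr l (hc k) hx,
      partialD_const, partialD_const]
    simp
  rw [dOne_eq_expr (fun Z hZ ↦ oneForm_mdifferentiableAt he hs hx hZ) hX hY, dOneExpr,
    sub_eq_zero] at h0
  exact h0.symm

/-- The bracket with a coordinate field differentiates the components. -/
theorem dCoord_mlieBracket_coordField {x : M} (hx : x ∈ e.source) {X : VField M}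
    (hX : VFieldDiffAt X x) (m l : Fin 4) :
    dCoord e m x (mlieBracket (𝓡 4) X (coordField e l) x)
      = -partialD e l (fun y ↦ dCoord e m y (X y)) x := by
  rw [dCoord_mlieBracket he hx hX (coordField_diffAt he hx l),
    mvfderiv_coordField he hx l (dCoord_mdifferentiableAt he hx m hX)]
  have h : mvfderiv (𝓡 4) (fun y ↦ dCoord e m y (coordField e l y)) x = 0 := by
    have h1 : mvfderiv (𝓡 4) (fun y ↦ dCoord e m y (coordField e l y)) x
        = mvfderiv (𝓡 4) (fun _ : M ↦ (if m = l then 1 else 0 : ℝ)) x := by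
      have : mfderiv (𝓡 4) 𝓘(ℝ, ℝ) (fun y ↦ dCoord e m y (coordField e l y)) x
          = mfderiv (𝓡 4) 𝓘(ℝ, ℝ) (fun _ : M ↦ (if m = l then 1 else 0 : ℝ)) x := by
        refine Filter.EventuallyEq.mfderiv_eq ?_
        filter_upwards [e.open_source.mem_nhds hx] with y hy
        exact dCoord_coordField he hy m l
      unfold mvfderiv
      rw [this]
      rfl
    rw [h1, mvfderiv_const]
  rw [h]
  simp

theorem vField_smoothAt_of_components {X : VField M}
    (h : ∀ k, SmoothIn e (fun y ↦ dCoord e k y (X y))) {x : M} (hx : x ∈ e.source) :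
    VFieldSmoothAt X x := by
  have h1 : VFieldSmoothAt (fun y ↦ ∑ k, dCoord e k y (X y) • coordField e k y) x :=
    ContMDiffAt.sum_section fun k _ ↦
      ContMDiffAt.smul_section ((h k).contMDiffAt he hx) (coordField_smoothAt he hx k)
  refine ContMDiffAt.congr_of_eventuallyEq h1 ?_
  filter_upwards [e.open_source.mem_nhds hx] with y hy
  rw [← eq_sum_coordField he hy (X y)]

omit he

theorem fin4_cases (k : Fin 4) : (∃ i, k = muIdx i) ∨ ∃ i, k = tIdx i := by
  fin_cases k
  · exact .inl ⟨0, rfl⟩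
  · exact .inl ⟨1, rfl⟩
  · exact .inr ⟨0, rfl⟩
  · exact .inr ⟨1, rfl⟩

theorem sum_fin4 {A : Type*} [AddCommMonoid A] (f : Fin 4 → A) :
    ∑ k, f k = ∑ i, f (muIdx i) + ∑ i, f (tIdx i) := by
  simp only [Fin.sum_univ_four, Fin.sum_univ_two, muIdx, tIdx]
  exact add_assoc _ _ _

@[simp] theorem muIdx_eq_muIdx (i j : Fin 2) : muIdx i = muIdx j ↔ i = j := by
  revert i j; decide

@[simp] theorem tIdx_eq_tIdx (i j : Fin 2) : tIdx i = tIdx j ↔ i = j := by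
  revert i j; decide

@[simp] theorem muIdx_ne_tIdx (i j : Fin 2) : muIdx i ≠ tIdx j := by
  revert i j; decide

@[simp] theorem tIdx_ne_muIdx (i j : Fin 2) : tIdx i ≠ muIdx j := by
  revert i j; decide

/-- `I` is an antidiagonal almost complex structure whose matrix `Φ` is smooth and depends on the
momentum coordinates only. -/
structure IsToricStructure (e : OpenPartialHomeomorph M E4) (I : EndField M)
    (Φ : M → Matrix (Fin 2) (Fin 2) ℝ) : Prop where
  anti : IsAntidiagonal e I Φ
  smooth : ∀ i j, SmoothIn e (fun y ↦ Φ y i j)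
  invariant : ∀ y ∈ e.source, ∀ i j l, partialD e (tIdx l) (fun y ↦ Φ y i j) y = 0

theorem smoothIn_inv {Φ : M → Matrix (Fin 2) (Fin 2) ℝ} (hΦ : ∀ i j, SmoothIn e (fun y ↦ Φ y i j))
    (hu : ∀ y ∈ e.source, IsUnit (Φ y)) (i j : Fin 2) : SmoothIn e (fun y ↦ (Φ y)⁻¹ i j) := by
  have hdet : SmoothIn e (fun y ↦ (Φ y).det) :=
    (((hΦ 0 0).mul (hΦ 1 1)).sub ((hΦ 0 1).mul (hΦ 1 0))).congr
      fun y _ ↦ Matrix.det_fin_two _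
  have h0 (y : M) (hy : y ∈ e.source) : (Φ y).det ≠ 0 :=
    ((Matrix.isUnit_iff_isUnit_det _).1 (hu y hy)).ne_zero
  have hadj : SmoothIn e (fun y ↦ (Φ y).adjugate i j) := by
    simp only [Matrix.adjugate_fin_two]
    fin_cases i <;> fin_cases j
    · exact hΦ 1 1
    · exact (hΦ 0 1).neg
    · exact (hΦ 1 0).neg
    · exact hΦ 0 0
  refine (hadj.div hdet h0).congr fun y hy ↦ ?_
  rw [Matrix.inv_def, Matrix.smul_apply, Ring.inverse_eq_inv', smul_eq_mul, div_eq_inv_mul]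

namespace IsToricStructure

variable {I : EndField M} {Φ : M → Matrix (Fin 2) (Fin 2) ℝ} (h : IsToricStructure e I Φ)
include h

theorem smooth_inv (i j : Fin 2) : SmoothIn e (fun y ↦ (Φ y)⁻¹ i j) :=
  smoothIn_inv h.smooth h.anti.isUnit i j

include he

theorem apply_mu {y : M} (hy : y ∈ e.source) (j : Fin 2) :
    I y (coordField e (muIdx j) y) = ∑ i, Φ y i j • coordField e (tIdx i) y := by
  rw [eq_sum_coordField he hy (I y _), sum_fin4]
  simp [h.anti.mu_part y hy, h.anti.t_part y hy, dCoord_coordField he hy]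

theorem apply_t {y : M} (hy : y ∈ e.source) (j : Fin 2) :
    I y (coordField e (tIdx j) y) = -∑ i, (Φ y)⁻¹ i j • coordField e (muIdx i) y := by
  rw [eq_sum_coordField he hy (I y _), sum_fin4]
  simp [h.anti.mu_part y hy, h.anti.t_part y hy, dCoord_coordField he hy]

/-- The antidiagonal form alone forces `I² = -1` over the chart, so the symplectic adjoint needs no
separate argument. -/
theorem sq {y : M} (hy : y ∈ e.source) (v : TangentSpace (𝓡 4) y) : I y (I y v) = -v := by
  have hdet : IsUnit (Φ y).det := (Matrix.isUnit_iff_isUnit_det _).1 (h.anti.isUnit y hy)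
  have h1 : ∀ i k, ∑ j, Φ y i j * (Φ y)⁻¹ j k = if i = k then 1 else 0 := fun i k ↦ by
    rw [← Matrix.mul_apply, Matrix.mul_nonsing_inv _ hdet, Matrix.one_apply]
  have h2 : ∀ i k, ∑ j, (Φ y)⁻¹ i j * Φ y j k = if i = k then 1 else 0 := fun i k ↦ by
    rw [← Matrix.mul_apply, Matrix.nonsing_inv_mul _ hdet, Matrix.one_apply]
  refine eq_of_dCoord_eq he hy fun k ↦ ?_
  rw [← dCoordL_apply k y (-v), map_neg, dCoordL_apply]
  obtain ⟨i, rfl⟩ | ⟨i, rfl⟩ := fin4_cases k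
  · rw [h.anti.mu_part y hy]
    simp only [h.anti.t_part y hy, Finset.mul_sum]
    rw [Finset.sum_comm]
    simp only [← mul_assoc, ← Finset.sum_mul, h2]
    simp
  · rw [h.anti.t_part y hy]
    simp only [h.anti.mu_part y hy, Finset.mul_sum, mul_neg, Finset.sum_neg_distrib]
    rw [Finset.sum_comm]
    simp only [← mul_assoc, ← Finset.sum_mul, h1]
    simp

/-- The components of the fields `I ∂_k` are smooth and depend on the momenta only. -/
theorem components_smooth (k m : Fin 4) :
    SmoothIn e (fun y ↦ dCoord e m y (I y (coordField e k y))) := by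
  obtain ⟨j, rfl⟩ | ⟨j, rfl⟩ := fin4_cases k <;> obtain ⟨i, rfl⟩ | ⟨i, rfl⟩ := fin4_cases m
  · refine (SmoothIn.const 0).congr fun y hy ↦ ?_
    simp [h.anti.mu_part y hy, dCoord_coordField he hy]
  · refine (h.smooth i j).congr fun y hy ↦ ?_
    simp [h.anti.t_part y hy, dCoord_coordField he hy]
  · refine (h.smooth_inv i j).neg.congr fun y hy ↦ ?_
    simp [h.anti.mu_part y hy, dCoord_coordField he hy]
  · refine (SmoothIn.const 0).congr fun y hy ↦ ?_
    simp [h.anti.t_part y hy, dCoord_coordField he hy]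

theorem apply_smoothAt {y : M} (hy : y ∈ e.source) (k : Fin 4) :
    VFieldSmoothAt (fun y ↦ I y (coordField e k y)) y :=
  vField_smoothAt_of_components he (h.components_smooth he k) hy

/-- Differentiating `Φ⁻¹Φ = 1` along an angle gives `(∂Φ⁻¹)Φ = 0`, and `Φ` is invertible. -/
theorem inv_invariant {y : M} (hy : y ∈ e.source) (i j l : Fin 2) :
    partialD e (tIdx l) (fun y ↦ (Φ y)⁻¹ i j) y = 0 := by
  have hdet (z : M) (hz : z ∈ e.source) : IsUnit (Φ z).det :=
    (Matrix.isUnit_iff_isUnit_det _).1 (h.anti.isUnit z hz)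
  have key (i k : Fin 2) : ∑ j, partialD e (tIdx l) (fun y ↦ (Φ y)⁻¹ i j) y * Φ y j k = 0 := by
    have h1 : ∀ z ∈ e.source, ∑ j, (Φ z)⁻¹ i j * Φ z j k = if i = k then 1 else 0 := fun z hz ↦ by
      rw [← Matrix.mul_apply, Matrix.nonsing_inv_mul _ (hdet z hz), Matrix.one_apply]
    have h2 := partialD_congr (tIdx l) h1 hy
    rw [partialD_const] at h2
    simp only [Fin.sum_univ_two] at h2 ⊢
    rw [partialD_add _ ((h.smooth_inv _ _).mul (h.smooth _ _))
      ((h.smooth_inv _ _).mul (h.smooth _ _)) hy,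
      partialD_mul _ (h.smooth_inv _ _) (h.smooth _ _) hy,
      partialD_mul _ (h.smooth_inv _ _) (h.smooth _ _) hy, h.invariant y hy,
      h.invariant y hy] at h2
    linarith
  let N : Matrix (Fin 2) (Fin 2) ℝ :=
    fun i j ↦ partialD e (tIdx l) (fun y ↦ (Φ y)⁻¹ i j) y
  have hN : N * Φ y = 0 := by
    ext i k
    rw [Matrix.mul_apply]
    exact key i k
  have hN' : N = 0 := by
    have := congrArg (· * (Φ y)⁻¹) hN
    simpa [Matrix.mul_assoc, Matrix.mul_nonsing_inv _ (hdet y hy)] using this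
  exact congrFun (congrFun hN' i) j

theorem components_invariant {y : M} (hy : y ∈ e.source) (k m : Fin 4) (l : Fin 2) :
    partialD e (tIdx l) (fun y ↦ dCoord e m y (I y (coordField e k y))) y = 0 := by
  obtain ⟨j, rfl⟩ | ⟨j, rfl⟩ := fin4_cases k <;> obtain ⟨i, rfl⟩ | ⟨i, rfl⟩ := fin4_cases m
  · rw [partialD_congr (f := fun _ ↦ 0) _ (fun y hy ↦ ?_) hy, partialD_const]
    simp [h.anti.mu_part y hy, dCoord_coordField he hy]
  · rw [partialD_congr (f := fun y ↦ Φ y i j) _ (fun y hy ↦ ?_) hy, h.invariant y hy]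
    simp [h.anti.t_part y hy, dCoord_coordField he hy]
  · rw [partialD_congr (f := fun y ↦ -(Φ y)⁻¹ i j) _ (fun y hy ↦ ?_) hy, partialD_neg,
      h.inv_invariant he hy, neg_zero]
    simp [h.anti.mu_part y hy, dCoord_coordField he hy]
  · rw [partialD_congr (f := fun _ ↦ 0) _ (fun y hy ↦ ?_) hy, partialD_const]
    simp [h.anti.t_part y hy, dCoord_coordField he hy]

/-- The components of `I∂_k` do not depend on the angles; equivalently, the fields `K_l` preserve
`I`. -/
theorem mlieBracket_apply_coordField_t {y : M} (hy : y ∈ e.source) (k : Fin 4) (l : Fin 2) :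
    mlieBracket (𝓡 4) (fun y ↦ I y (coordField e k y)) (coordField e (tIdx l)) y = 0 := by
  refine eq_of_dCoord_eq he hy fun m ↦ ?_
  rw [dCoord_mlieBracket_coordField he hy (h.apply_smoothAt he hy k).diffAt,
    h.components_invariant he hy, ← dCoordL_apply, map_zero, neg_zero]

/-- Integrability means that the rows of `Φ` are closed. -/
theorem closed (hI : Integrable I) {y : M} (hy : y ∈ e.source) (i : Fin 2) :
    partialD e (muIdx 0) (fun y ↦ Φ y i 1) y = partialD e (muIdx 1) (fun y ↦ Φ y i 0) y := by
  have hd (j : Fin 2) := (h.apply_smoothAt he hy (muIdx j)).diffAt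
  have hN := hI y (coordField e (muIdx 0)) (coordField e (muIdx 1))
    (coordField_diffAt he hy _) (coordField_diffAt he hy _)
  -- `I∂/∂μ^l` is tangent to the angular directions, along which all components are constant. Hence
  -- `[I∂/∂μ^0, I∂/∂μ^1] = 0`, and the Nijenhuis tensor reduces to the two mixed brackets, which
  -- differentiate `Φ` in the momenta.
  have hcomp (j : Fin 2) (m : Fin 4) (l : Fin 2) :
      mvfderiv (𝓡 4) (fun y ↦ dCoord e m y (I y (coordField e (muIdx j) y))) y
        (I y (coordField e (muIdx l) y)) = 0 := by
    rw [h.apply_mu he hy, map_sum]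
    refine Finset.sum_eq_zero fun i _ ↦ ?_
    rw [map_smul, mvfderiv_coordField he hy _
      ((h.components_smooth he _ _).mdifferentiableAt he hy), h.components_invariant he hy,
      smul_zero]
  have h0 : mlieBracket (𝓡 4) (fun y ↦ I y (coordField e (muIdx 0) y))
      (fun y ↦ I y (coordField e (muIdx 1) y)) y = 0 := by
    refine eq_of_dCoord_eq he hy fun m ↦ ?_
    rw [dCoord_mlieBracket he hy (hd 0) (hd 1), hcomp, hcomp, ← dCoordL_apply, map_zero, sub_zero]
  rw [h0, mlieBracket_coordField he hy, zero_sub, sub_zero, sub_eq_zero, ← map_neg] at hN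
  have hN' := congrArg (I y) hN
  rw [h.sq he hy, h.sq he hy, neg_inj] at hN'
  have h3 := congrArg (fun v ↦ dCoordL e (tIdx i) y v) hN'
  have hΦ (k : Fin 4) (j : Fin 2) :
      partialD e k (fun y ↦ dCoord e (tIdx i) y (I y (coordField e (muIdx j) y))) y
        = partialD e k (fun y ↦ Φ y i j) y := by
    refine partialD_congr _ (fun z hz ↦ ?_) hy
    simp [h.anti.t_part z hz, dCoord_coordField he hz]
  simp only [map_neg, dCoordL_apply] at h3
  rw [mlieBracket_swap_apply (V := coordField e (muIdx 0)), ← dCoordL_apply (v := - _), map_neg,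
    dCoordL_apply, dCoord_mlieBracket_coordField he hy (hd 0),
    dCoord_mlieBracket_coordField he hy (hd 1),
    hΦ, hΦ] at h3
  linarith

end IsToricStructure

end Antidiagonal

/-! ### The Chern connection in a chart -/

/-- Smoothness of the connection concerns globally smooth fields, whereas coordinate fields are
smooth only on `U`. Multiplication by a bump function equal to one near `x` makes `X` global, and
locality of the connection identifies the derivatives near `x`. -/
theorem Connection.diffAt_apply [T2Space M] {cov : Connection M}
    (hcov : ContMDiffCovariantDerivativeOn E4 ∞ cov.toFun Set.univ) {U : Set M} (hU : IsOpen U)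
    {X Y : VField M} {x : M} (hx : x ∈ U) (hX : ∀ y ∈ U, VFieldSmoothAt X y)
    (hY : VFieldSmoothAt Y x) :
    VFieldDiffAt (fun y ↦ cov X y (Y y)) x := by
  obtain ⟨f, -, hf⟩ :=
    (SmoothBumpFunction.nhds_basis_tsupport (I := 𝓡 4) x).mem_iff.1 (hU.mem_nhds hx)
  let X' : VField M := (f : M → ℝ) • X
  have hX' : ContMDiff (𝓡 4) ((𝓡 4).prod 𝓘(ℝ, E4)) ∞
      (fun y ↦ (TotalSpace.mk' E4 y (X' y) : TangentBundle (𝓡 4) M)) :=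
    ContMDiffOn.smul_section_of_tsupport (u := U) f.contMDiff.contMDiffOn hU hf
      fun y hy ↦ (hX y hy).contMDiffWithinAt
  have h1 := hcov.contMDiff (σ := X') (by simpa using hX'.contMDiffOn)
  have h2 : ContMDiffAt (𝓡 4) ((𝓡 4).prod 𝓘(ℝ, E4)) ∞
      (fun y ↦ (TotalSpace.mk' E4 y (cov X' y (Y y)) : TangentBundle (𝓡 4) M)) x :=
    (h1.contMDiffAt Filter.univ_mem).clm_bundle_apply hY
  refine (h2.mdifferentiableAt (by simp)).congr_of_eventuallyEq ?_
  have h3 : ∀ᶠ y in 𝓝 x, ∀ᶠ z in 𝓝 y, f z = 1 := f.eventuallyEq_one.eventually_nhds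
  filter_upwards [h3, hU.mem_nhds hx] with y hy hyU
  have : cov X y = cov X' y := by
    refine cov.isCovariantDerivativeOn.congr_of_eventuallyEq (hX y hyU).diffAt
      (hX'.contMDiffAt.mdifferentiableAt (by simp)) (s := Set.univ) Filter.univ_mem ?_
    filter_upwards [hy] with z hz
    simp [X', hz]
  rw [this]

/-! ### The holomorphic frame of angular fields -/

section Chern

variable {e : OpenPartialHomeomorph M E4} (he : e ∈ IsManifold.maximalAtlas (𝓡 4) ∞ M)
  {I : EndField M} {Φ : M → Matrix (Fin 2) (Fin 2) ℝ} (h : IsToricStructure e I Φ)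
include he h

/-- The field `I Z` is differentiable if `Z` is. -/
theorem IsToricStructure.apply_diffAt {x : M} (hx : x ∈ e.source) {Z : VField M}
    (hZ : VFieldDiffAt Z x) : VFieldDiffAt (fun y ↦ I y (Z y)) x := by
  have h1 : VFieldDiffAt (fun y ↦ ∑ k, dCoord e k y (Z y) • I y (coordField e k y)) x :=
    MDifferentiableAt.sum_section fun k _ ↦ MDifferentiableAt.smul_section
      (dCoord_mdifferentiableAt he hx k hZ) (h.apply_smoothAt he hx k).diffAt
  refine MDifferentiableAt.congr_of_eventuallyEq h1 ?_
  filter_upwards [e.open_source.mem_nhds hx] with y hy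
  have : I y (Z y) = ∑ k, dCoord e k y (Z y) • I y (coordField e k y) := by
    conv_lhs => rw [eq_sum_coordField he hy (Z y), map_sum]
    simp
  rw [this]

/-- The expansion of a vector in the complex frame `K_1, K_2` of `(TM, I)`. -/
theorem IsToricStructure.eq_frame_sum {y : M} (hy : y ∈ e.source) (v : TangentSpace (𝓡 4) y) :
    v = ∑ i, (dCoord e (tIdx i) y v • coordField e (tIdx i) y
      + -dCoord e (tIdx i) y (I y v) • I y (coordField e (tIdx i) y)) := by
  have h0 (m : Fin 2) : dCoord e (muIdx m) y v
      = ∑ j, (Φ y)⁻¹ m j * dCoord e (tIdx j) y (I y v) := by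
    have h1 := h.anti.mu_part y hy (I y v) m
    rw [h.sq he hy, ← dCoordL_apply, map_neg, dCoordL_apply, neg_inj] at h1
    exact h1
  refine eq_of_dCoord_eq he hy fun k ↦ ?_
  rw [← dCoordL_apply k y (∑ i, _)]
  simp only [map_sum, map_add, map_smul, dCoordL_apply, smul_eq_mul]
  obtain ⟨m, rfl⟩ | ⟨m, rfl⟩ := fin4_cases k
  · simp [dCoord_coordField he hy, h.anti.mu_part y hy (coordField e _ y), h0, mul_comm]
  · simp [dCoord_coordField he hy, h.anti.t_part y hy (coordField e _ y)]

variable {g : BilField M} {cov : Connection M} (hI : Integrable I)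
  (hcov : IsChernConnection g I cov)
include hcov

include hI in
/-- The coordinate fields `K_j = ∂/∂t^j` are holomorphic. -/
theorem IsChernConnection.holomorphic {x : M} (hx : x ∈ e.source) (j : Fin 2)
    (v : TangentSpace (𝓡 4) x) :
    cov (coordField e (tIdx j)) x (I x v) = I x (cov (coordField e (tIdx j)) x v) := by
  have key (k : Fin 4) : cov (coordField e (tIdx j)) x (I x (coordField e k x))
      = I x (cov (coordField e (tIdx j)) x (coordField e k x)) := by
    set X := coordField e k with hX
    set Y := coordField e (tIdx j) with hY
    have dX : VFieldDiffAt X x := coordField_diffAt he hx _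
    have dY : VFieldDiffAt Y x := coordField_diffAt he hx _
    have dIX : VFieldDiffAt (fun y ↦ I y (X y)) x := (h.apply_smoothAt he hx _).diffAt
    have dIY : VFieldDiffAt (fun y ↦ I y (Y y)) x := (h.apply_smoothAt he hx _).diffAt
    have b0 : mlieBracket (𝓡 4) X Y x = 0 := mlieBracket_coordField he hx _ _
    have b1 : mlieBracket (𝓡 4) (fun y ↦ I y (X y)) Y x = 0 :=
      h.mlieBracket_apply_coordField_t he hx _ _
    have b2 := hI x X Y dX dY
    rw [b0, b1, map_zero, sub_zero, sub_zero, sub_eq_zero] at b2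
    have t1 := hcov.torsion x (X x) (Y x)
    have t2 := hcov.torsion x (I x (X x)) (Y x)
    rw [h.sq he hx, map_neg, neg_apply, neg_inj] at t2
    have e1 := cov.torsion_apply dX dY
    have e2 := cov.torsion_apply dIX dIY
    have e3 := cov.torsion_apply dIX dY
    have e4 := cov.torsion_apply dX dIY
    rw [hcov.complex x Y dY] at e2 e4
    rw [hcov.complex x X dX] at e2 e3
    rw [b0] at e1
    rw [b1] at e3
    rw [b2] at e2
    rw [e1, e2] at t1
    rw [e3, e4] at t2
    have t3 := congrArg (I x) t2
    simp only [map_sub, h.sq he hx, sub_zero] at t1 t3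
    have hneg : I x (cov Y x (I x (X x))) = -cov Y x (X x) := by
      -- With `[X, Y] = [IX, Y] = 0` and `[IX, IY] = I[X, IY]`, the torsion identities for `(X, Y)`
      -- and `(IX, Y)` both contain `I∇_{IY}X`, `I[X, IY]` and `∇_Y X`. These cancel in the
      -- difference, leaving `2I∇_{IX}Y = -2∇_X Y`.
      have h2 : (2 : ℝ) • I x (cov Y x (I x (X x))) = (2 : ℝ) • -cov Y x (X x) := by
        linear_combination (norm := module) t1 - t3
      exact smul_right_injective _ two_ne_zero h2
    have := congrArg (I x) hneg
    rwa [h.sq he hx, map_neg, neg_inj] at this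
  have := eq_sum_coordField he hx v
  rw [this]
  simp [key]

end Chern

/-! ### The Chern–Ricci form in a chart -/

theorem Connection.apply_sum_smul (cov : Connection M) {x : M} {σ τ : Fin 2 → VField M}
    {a b : Fin 2 → M → ℝ} (hσ : ∀ i, VFieldDiffAt (σ i) x) (hτ : ∀ i, VFieldDiffAt (τ i) x)
    (ha : ∀ i, MDifferentiableAt (𝓡 4) 𝓘(ℝ, ℝ) (a i) x)
    (hb : ∀ i, MDifferentiableAt (𝓡 4) 𝓘(ℝ, ℝ) (b i) x) (v : TangentSpace (𝓡 4) x) :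
    cov (fun y ↦ ∑ i, (a i y • σ i y + b i y • τ i y)) x v
      = ∑ i, (a i x • cov (σ i) x v + mvfderiv (𝓡 4) (a i) x v • σ i x
        + (b i x • cov (τ i) x v + mvfderiv (𝓡 4) (b i) x v • τ i x)) := by
  have hc := cov.isCovariantDerivativeOnUniv
  have h1 : (fun y ↦ ∑ i, (a i y • σ i y + b i y • τ i y) : VField M)
      = (a 0 • σ 0 + b 0 • τ 0) + (a 1 • σ 1 + b 1 • τ 1) := by
    funext y
    simp [Fin.sum_univ_two]
  have hA (i : Fin 2) : VFieldDiffAt (a i • σ i) x := MDifferentiableAt.smul_section (ha i) (hσ i)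
  have hB (i : Fin 2) : VFieldDiffAt (b i • τ i) x := MDifferentiableAt.smul_section (hb i) (hτ i)
  have hAB (i : Fin 2) : VFieldDiffAt (a i • σ i + b i • τ i) x :=
    mdifferentiableAt_add_section (hA i) (hB i)
  rw [h1, hc.add (hAB 0) (hAB 1), hc.add (hA 0) (hB 0), hc.add (hA 1) (hB 1),
    hc.leibniz (hσ 0) (ha 0), hc.leibniz (hσ 1) (ha 1), hc.leibniz (hτ 0) (hb 0),
    hc.leibniz (hτ 1) (hb 1)]
  simp [Fin.sum_univ_two]

/-- The Gram matrix of the coordinate fields `∂/∂t^i`. -/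
def tGram (e : OpenPartialHomeomorph M E4) (g : BilField M) (y : M) : Matrix (Fin 2) (Fin 2) ℝ :=
  fun i j ↦ g y (coordField e (tIdx i) y) (coordField e (tIdx j) y)

/-- The metric `g` is smooth and nondegenerate on the orbits of the torus, and `I` maps the tangent
spaces of the orbits to their orthogonal complements. -/
structure IsToricMetric (e : OpenPartialHomeomorph M E4) (I : EndField M) (g : BilField M) :
    Prop where
  smooth : ∀ i j, SmoothIn e (fun y ↦ tGram e g y i j)
  symm : ∀ y ∈ e.source, ∀ v w : TangentSpace (𝓡 4) y, g y v w = g y w v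
  orth : ∀ y ∈ e.source, ∀ i j,
    g y (I y (coordField e (tIdx i) y)) (coordField e (tIdx j) y) = 0
  det_ne_zero : ∀ y ∈ e.source, (tGram e g y).det ≠ 0

theorem IsToricMetric.smooth_det {e : OpenPartialHomeomorph M E4} {I : EndField M} {g : BilField M}
    (hg : IsToricMetric e I g) : SmoothIn e (fun y ↦ (tGram e g y).det) :=
  (((hg.smooth 0 0).mul (hg.smooth 1 1)).sub ((hg.smooth 0 1).mul (hg.smooth 1 0))).congr
    fun _ _ ↦ Matrix.det_fin_two _

/-! ### The trace of the connection form -/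

section ChernRicci

variable {e : OpenPartialHomeomorph M E4} (he : e ∈ IsManifold.maximalAtlas (𝓡 4) ∞ M)
  {I : EndField M} {Φ : M → Matrix (Fin 2) (Fin 2) ℝ} (h : IsToricStructure e I Φ)
  {g : BilField M} (hg : IsToricMetric e I g) {cov : Connection M} (hI : Integrable I)
  (hcov : IsChernConnection g I cov)
include he h hg hcov

/-- Metric compatibility applied to the frame. Since `g(IK_m, K_j) = 0`, the components along `IK_m`
drop out, and only the real parts `dt^m(∇K_i)` of the connection form enter. -/
theorem IsChernConnection.partialD_tGram {x : M} (hx : x ∈ e.source) (k : Fin 4) (i j : Fin 2) :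
    partialD e k (fun y ↦ tGram e g y i j) x
      = ∑ m, (dCoord e (tIdx m) x (cov (coordField e (tIdx i)) x (coordField e k x))
            * tGram e g x m j
          + dCoord e (tIdx m) x (cov (coordField e (tIdx j)) x (coordField e k x))
            * tGram e g x i m) := by
  have h1 : mvfderiv (𝓡 4) (fun y ↦ tGram e g y i j) x (coordField e k x) = _ :=
    hcov.metric x _ _ (coordField_diffAt he hx (tIdx i))
      (coordField_diffAt he hx (tIdx j)) (coordField e k x)
  rw [mvfderiv_coordField he hx k ((hg.smooth i j).mdifferentiableAt he hx)] at h1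
  refine h1.trans ?_
  have h2 (v : TangentSpace (𝓡 4) x) (j : Fin 2) : g x v (coordField e (tIdx j) x)
      = ∑ m, dCoord e (tIdx m) x v * tGram e g x m j := by
    conv_lhs => rw [h.eq_frame_sum he hx v]
    simp [hg.orth x hx, tGram]
  rw [h2, hg.symm x hx (coordField e (tIdx i) x), h2, ← Finset.sum_add_distrib]
  refine Finset.sum_congr rfl fun m _ ↦ ?_
  rw [show tGram e g x m i = tGram e g x i m from hg.symm x hx _ _]

/-- The real part of the trace of the connection form in the frame `K_1, K_2`. -/
theorem IsChernConnection.two_mul_trace {x : M} (hx : x ∈ e.source) (v : TangentSpace (𝓡 4) x) :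
    2 * ∑ i, dCoord e (tIdx i) x (cov (coordField e (tIdx i)) x v)
      = mvfderiv (𝓡 4) (fun y ↦ Real.log (tGram e g y).det) x v := by
  have hlog : SmoothIn e (fun y ↦ Real.log (tGram e g y).det) := hg.smooth_det.log hg.det_ne_zero
  have key (k : Fin 4) :
      2 * ∑ i, dCoord e (tIdx i) x (cov (coordField e (tIdx i)) x (coordField e k x))
        = mvfderiv (𝓡 4) (fun y ↦ Real.log (tGram e g y).det) x (coordField e k x) := by
    have hd := hg.det_ne_zero x hx
    -- What follows is Jacobi's formula for the derivative of a determinant, written out for a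
    -- symmetric matrix of order two.
    rw [mvfderiv_coordField he hx k (hlog.mdifferentiableAt he hx),
      partialD_log k hg.smooth_det hx hd, eq_div_iff hd,
      partialD_congr k (fun y _ ↦ Matrix.det_fin_two (tGram e g y)) hx,
      partialD_sub k ((hg.smooth 0 0).mul (hg.smooth 1 1)) ((hg.smooth 0 1).mul (hg.smooth 1 0)) hx,
      partialD_mul k (hg.smooth 0 0) (hg.smooth 1 1) hx,
      partialD_mul k (hg.smooth 0 1) (hg.smooth 1 0) hx, Matrix.det_fin_two]
    simp only [hcov.partialD_tGram he h hg hx, Fin.sum_univ_two]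
    have hs : tGram e g x 1 0 = tGram e g x 0 1 := hg.symm x hx _ _
    rw [hs]
    ring
  have h1 := oneForm_apply_eq_sum he hx
    ((2 : ℝ) • ∑ i, (dCoordL e (tIdx i) x).comp (cov (coordField e (tIdx i)) x)) v
  rw [oneForm_apply_eq_sum he hx]
  simp only [← key]
  simpa [dCoordL_apply, mul_add] using h1

include hI

/-- The imaginary part of the trace of the connection form in the frame `K_1, K_2`. -/
theorem IsChernConnection.trace_im {x : M} (hx : x ∈ e.source) (v : TangentSpace (𝓡 4) x) :
    ∑ i, -dCoord e (tIdx i) x (I x (cov (coordField e (tIdx i)) x v))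
      = (1 / 2 : ℝ) * dc I (fun y ↦ Real.log (tGram e g y).det) x v := by
  have h1 := hcov.two_mul_trace he h hg hx (I x v)
  -- Holomorphy of the frame turns the real part evaluated at `Iv` into minus the imaginary part at
  -- `v`.
  simp only [hcov.holomorphic he h hI hx] at h1
  have h2 : dc I (fun y ↦ Real.log (tGram e g y).det) x v
      = -mvfderiv (𝓡 4) (fun y ↦ Real.log (tGram e g y).det) x (I x v) := rfl
  rw [h2, ← h1, Finset.sum_neg_distrib]
  ring

omit hI hg

theorem IsChernConnection.diffAt_apply [T2Space M] {x : M} (hx : x ∈ e.source) (j : Fin 2)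
    (l : Fin 4) :
    VFieldDiffAt (fun y ↦ cov (coordField e (tIdx j)) y (coordField e l y)) x :=
  Connection.diffAt_apply hcov.smooth e.open_source hx
    (fun _ hy ↦ coordField_smoothAt he hy _) (coordField_smoothAt he hx l)

/-- The second covariant derivatives of the frame `K_1, K_2`. -/
theorem IsChernConnection.second_derivative [T2Space M] {x : M} (hx : x ∈ e.source) (i j : Fin 2)
    (l : Fin 4) (v : TangentSpace (𝓡 4) x) :
    -dCoord e (tIdx i) x
        (I x (cov (fun y ↦ cov (coordField e (tIdx j)) y (coordField e l y)) x v))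
      = ∑ m, (dCoord e (tIdx m) x (cov (coordField e (tIdx j)) x (coordField e l x))
            * -dCoord e (tIdx i) x (I x (cov (coordField e (tIdx m)) x v))
          + -dCoord e (tIdx m) x (I x (cov (coordField e (tIdx j)) x (coordField e l x)))
            * dCoord e (tIdx i) x (cov (coordField e (tIdx m)) x v))
        + mvfderiv (𝓡 4) (fun y ↦ -dCoord e (tIdx i) y
          (I y (cov (coordField e (tIdx j)) y (coordField e l y)))) x v := by
  have hZ := hcov.diffAt_apply he h hx j l
  have hIZ := h.apply_diffAt he hx hZ
  have hK (m : Fin 2) := coordField_diffAt he hx (tIdx m)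
  have hIK (m : Fin 2) := (h.apply_smoothAt he hx (tIdx m)).diffAt
  have hα (m : Fin 2) := dCoord_mdifferentiableAt he hx (tIdx m) hZ
  have hβ (m : Fin 2) : MDifferentiableAt (𝓡 4) 𝓘(ℝ, ℝ) (fun y ↦ -dCoord e (tIdx m) y
      (I y (cov (coordField e (tIdx j)) y (coordField e l y)))) x :=
    (dCoord_mdifferentiableAt he hx (tIdx m) hIZ).neg
  have h1 := Connection.apply_sum_smul cov hK hIK hα hβ v
  have h2 : cov (fun y ↦ cov (coordField e (tIdx j)) y (coordField e l y)) x
      = cov (fun y ↦ ∑ m, (dCoord e (tIdx m) y (cov (coordField e (tIdx j)) y (coordField e l y))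
            • coordField e (tIdx m) y
          + -dCoord e (tIdx m) y (I y (cov (coordField e (tIdx j)) y (coordField e l y)))
            • I y (coordField e (tIdx m) y))) x := by
    have hev : ∀ᶠ y in 𝓝 x, cov (coordField e (tIdx j)) y (coordField e l y)
        = ∑ m, (dCoord e (tIdx m) y (cov (coordField e (tIdx j)) y (coordField e l y))
            • coordField e (tIdx m) y
          + -dCoord e (tIdx m) y (I y (cov (coordField e (tIdx j)) y (coordField e l y)))
            • I y (coordField e (tIdx m) y)) := by
      filter_upwards [e.open_source.mem_nhds hx] with y hy
      exact h.eq_frame_sum he hy _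
    refine cov.isCovariantDerivativeOn.congr_of_eventuallyEq hZ ?_ (s := Set.univ)
      Filter.univ_mem hev
    refine MDifferentiableAt.congr_of_eventuallyEq hZ ?_
    filter_upwards [hev] with y hy
    rw [← hy]
  rw [h2, h1]
  simp only [hcov.complex x _ (hK _)]
  rw [← dCoordL_apply (tIdx i) x (I x _)]
  simp only [map_sum, map_add, map_smul, h.sq he hx, dCoordL_apply, smul_eq_mul, map_neg]
  simp only [h.anti.t_part x hx (coordField e _ x), dCoord_coordField he hx]
  simp only [Fin.sum_univ_two]
  fin_cases i <;> simp <;> ring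

omit h hcov in
/-- The trace of an endomorphism in the coordinate frame. -/
theorem trace_eq_sum_dCoord {x : M} (hx : x ∈ e.source)
    (L : TangentSpace (𝓡 4) x →ₗ[ℝ] TangentSpace (𝓡 4) x) :
    LinearMap.trace ℝ (TangentSpace (𝓡 4) x) L = ∑ k, dCoord e k x (L (coordField e k x)) := by
  rw [LinearMap.trace_eq_matrix_trace ℝ (coordBasis he hx), Matrix.trace]
  refine Finset.sum_congr rfl fun k _ ↦ ?_
  rw [Matrix.diag_apply, LinearMap.toMatrix_apply, coordBasis_apply, coordBasis_repr]

omit hcov in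
-- An `I`-linear map has the same trace on the span of the `K_j` as on the span of the `IK_j`, which
-- is that of the momentum fields; hence the factor two. `I`-linearity is needed on the frame only.
theorem IsToricStructure.trace_comp {x : M} (hx : x ∈ e.source)
    (L : TangentSpace (𝓡 4) x →L[ℝ] TangentSpace (𝓡 4) x)
    (hL : ∀ j, L (I x (coordField e (tIdx j) x)) = I x (L (coordField e (tIdx j) x))) :
    LinearMap.trace ℝ (TangentSpace (𝓡 4) x) ((I x).toLinearMap ∘ₗ L.toLinearMap)
      = 2 * ∑ i, dCoord e (tIdx i) x (I x (L (coordField e (tIdx i) x))) := by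
  have hdet : IsUnit (Φ x).det := (Matrix.isUnit_iff_isUnit_det _).1 (h.anti.isUnit x hx)
  have h1 : ∀ i k, ∑ j, Φ x i j * (Φ x)⁻¹ j k = if i = k then 1 else 0 := fun i k ↦ by
    rw [← Matrix.mul_apply, Matrix.mul_nonsing_inv _ hdet, Matrix.one_apply]
  have h2 (i : Fin 2) : I x (L (coordField e (muIdx i) x))
      = ∑ j, Φ x j i • L (coordField e (tIdx j) x) := by
    -- `∂/∂μ^i` is written as `I` of an angular vector, where commutation with `I` is known.
    have h3 : coordField e (muIdx i) x = -I x (I x (coordField e (muIdx i) x)) := by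
      rw [h.sq he hx, neg_neg]
    rw [h3, h.apply_mu he hx]
    simp [hL, h.sq he hx, add_comm]
  have h4 (m : Fin 2) (v : TangentSpace (𝓡 4) x) : dCoord e (muIdx m) x v
      = ∑ j, (Φ x)⁻¹ m j * dCoord e (tIdx j) x (I x v) := by
    have h5 := h.anti.mu_part x hx (I x v) m
    rw [h.sq he hx, ← dCoordL_apply, map_neg, dCoordL_apply, neg_inj] at h5
    exact h5
  rw [trace_eq_sum_dCoord he hx, sum_fin4, two_mul]
  congr 1
  simp only [LinearMap.comp_apply, ContinuousLinearMap.coe_coe, h2]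
  have h6 (i : Fin 2) : dCoord e (muIdx i) x (∑ j, Φ x j i • L (coordField e (tIdx j) x))
      = ∑ j, Φ x j i * dCoord e (muIdx i) x (L (coordField e (tIdx j) x)) := by
    rw [← dCoordL_apply, map_sum]
    simp [dCoordL_apply]
  simp only [h6, h4]
  rw [Finset.sum_comm]
  refine Finset.sum_congr rfl fun j _ ↦ ?_
  simp only [Finset.mul_sum]
  rw [Finset.sum_comm]
  simp only [← mul_assoc, ← Finset.sum_mul, h1]
  simp

end ChernRicci

/-! ### Curvature of the anticanonical bundle -/

section ChernRicci

variable {e : OpenPartialHomeomorph M E4} (he : e ∈ IsManifold.maximalAtlas (𝓡 4) ∞ M)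
  {I : EndField M} {Φ : M → Matrix (Fin 2) (Fin 2) ℝ} (h : IsToricStructure e I Φ)
include he

theorem dc_coordField {f : M → ℝ} (hf : SmoothIn e f) {y : M} (hy : y ∈ e.source) (k : Fin 4) :
    dc I f y (coordField e k y)
      = -∑ m, dCoord e m y (I y (coordField e k y)) * partialD e m f y := by
  have h2 : dc I f y (coordField e k y) = -mvfderiv (𝓡 4) f y (I y (coordField e k y)) := rfl
  rw [h2, oneForm_apply_eq_sum he hy]
  simp only [mvfderiv_coordField he hy _ (hf.mdifferentiableAt he hy)]

include h

theorem IsToricStructure.dc_smooth {f : M → ℝ} (hf : SmoothIn e f) (k : Fin 4) :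
    SmoothIn e (fun y ↦ dc I f y (coordField e k y)) := by
  have h1 : SmoothIn e (fun y ↦ -∑ m, dCoord e m y (I y (coordField e k y)) * partialD e m f y) :=
    (SmoothIn.sum fun m _ ↦ (h.components_smooth he k m).mul (hf.partialD m)).neg
  exact h1.congr fun y hy ↦ dc_coordField he hf hy k

/-- The curvature of the Chern connection commutes with the complex structure on the frame
`K_1, K_2`. -/
theorem IsChernConnection.curvature_comm [T2Space M] {g : BilField M} {cov : Connection M}
    (hcov : IsChernConnection g I cov) {R : CurvField M} (hR : IsCurvature cov R) {x : M}
    (hx : x ∈ e.source) (k l : Fin 4) (j : Fin 2) :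
    R x (coordField e k x) (coordField e l x) (I x (coordField e (tIdx j) x))
      = I x (R x (coordField e k x) (coordField e l x) (coordField e (tIdx j) x)) := by
  have hK (m : Fin 4) := coordField_smoothAt he hx m
  have h1 := hR x _ _ _ (hK k) (hK l) (hK (tIdx j))
  have h2 := hR x _ _ _ (hK k) (hK l) (h.apply_smoothAt he hx (tIdx j))
  have h3 (l : Fin 4) (v : TangentSpace (𝓡 4) x) :
      cov (fun y ↦ cov (fun z ↦ I z (coordField e (tIdx j) z)) y (coordField e l y)) x v
        = I x (cov (fun y ↦ cov (coordField e (tIdx j)) y (coordField e l y)) x v) := by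
    have hZ := hcov.diffAt_apply he h hx j l
    have hev : ∀ᶠ y in 𝓝 x, cov (fun z ↦ I z (coordField e (tIdx j) z)) y (coordField e l y)
        = I y (cov (coordField e (tIdx j)) y (coordField e l y)) := by
      filter_upwards [e.open_source.mem_nhds hx] with y hy
      exact hcov.complex y _ (coordField_diffAt he hy _) _
    rw [← hcov.complex x _ hZ]
    refine congrArg
      (fun L : TangentSpace (𝓡 4) x →L[ℝ] TangentSpace (𝓡 4) x ↦ L v) ?_
    refine cov.isCovariantDerivativeOn.congr_of_eventuallyEq ?_ (h.apply_diffAt he hx hZ)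
      (s := Set.univ) Filter.univ_mem hev
    refine MDifferentiableAt.congr_of_eventuallyEq (h.apply_diffAt he hx hZ) ?_
    filter_upwards [hev] with y hy
    rw [hy]
  rw [h1, h2, h3, h3, hcov.complex x _ (hK _).diffAt]
  simp only [map_sub]

/-- The Chern–Ricci form of a toric Hermitian structure. -/
theorem IsChernRicciForm.eq_ddc [T2Space M] {g ρ : BilField M} (hg : IsToricMetric e I g)
    (hI : Integrable I) (hρ : IsChernRicciForm g I ρ) {x : M} (hx : x ∈ e.source)
    (v w : TangentSpace (𝓡 4) x) :
    ρ x v w = -(1 / 2 : ℝ) * ddc I (fun y ↦ Real.log (tGram e g y).det) x v w := by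
  obtain ⟨cov, R, hcov, hR, htr⟩ := hρ
  set f : M → ℝ := fun y ↦ Real.log (tGram e g y).det with hf
  have hfs : SmoothIn e f := hg.smooth_det.log hg.det_ne_zero
  have hdc := h.dc_smooth he hfs
  have key (k l : Fin 4) : ρ x (coordField e k x) (coordField e l x)
      = -(1 / 2 : ℝ) * ddc I f x (coordField e k x) (coordField e l x) := by
    have t1 := congrArg Complex.im (htr x (coordField e k x) (coordField e l x))
    -- The imaginary part of the complex trace is `-½ tr(I ∘ R)`, and `trace_comp` reduces this to
    -- the angular frame.
    have t2 : ρ x (coordField e k x) (coordField e l x)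
        = ∑ i, -dCoord e (tIdx i) x
          (I x (R x (coordField e k x) (coordField e l x) (coordField e (tIdx i) x))) := by
      rw [complexTrace, h.trace_comp he hx _ (hcov.curvature_comm he h hR hx k l)] at t1
      rw [Finset.sum_neg_distrib]
      simp at t1
      rw [← t1]
      simp [Fin.sum_univ_two]
      ring
    have hb (l : Fin 4) : ∀ y ∈ e.source, ∑ i, -dCoord e (tIdx i) y
        (I y (cov (coordField e (tIdx i)) y (coordField e l y)))
          = (1 / 2 : ℝ) * dc I f y (coordField e l y) :=
      fun y hy ↦ hcov.trace_im he h hg hI hy _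
    have hβ (l : Fin 4) (i : Fin 2) : MDifferentiableAt (𝓡 4) 𝓘(ℝ, ℝ) (fun y ↦
        -dCoord e (tIdx i) y (I y (cov (coordField e (tIdx i)) y (coordField e l y)))) x :=
      (dCoord_mdifferentiableAt he hx (tIdx i)
        (h.apply_diffAt he hx (hcov.diffAt_apply he h hx i l))).neg
    have hder (k l : Fin 4) : ∑ i, mvfderiv (𝓡 4) (fun y ↦
        -dCoord e (tIdx i) y (I y (cov (coordField e (tIdx i)) y (coordField e l y)))) x
          (coordField e k x)
        = (1 / 2 : ℝ) * partialD e k (fun y ↦ dc I f y (coordField e l y)) x := by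
      have h1 : partialD e k (fun y ↦ (1 / 2 : ℝ) * dc I f y (coordField e l y)) x
          = (1 / 2 : ℝ) * partialD e k (fun y ↦ dc I f y (coordField e l y)) x := by
        rw [partialD_mul k (SmoothIn.const _) (hdc l) hx, partialD_const]
        ring
      rw [← h1, ← partialD_congr k (hb l) hx]
      have h2 : MDifferentiableAt (𝓡 4) 𝓘(ℝ, ℝ) (fun y ↦ ∑ i, -dCoord e (tIdx i) y
          (I y (cov (coordField e (tIdx i)) y (coordField e l y)))) x := by
        simp only [Fin.sum_univ_two]
        exact (hβ l 0).add (hβ l 1)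
      rw [← mvfderiv_coordField he hx k h2]
      simp only [Fin.sum_univ_two]
      rw [mvfderiv_fun_add (hβ l 0) (hβ l 1)]
      rfl
    have hRK (i : Fin 2) := hR x _ _ _ (coordField_smoothAt he hx k) (coordField_smoothAt he hx l)
      (coordField_smoothAt he hx (tIdx i))
    have hRK' (i : Fin 2) : -dCoord e (tIdx i) x
          (I x (R x (coordField e k x) (coordField e l x) (coordField e (tIdx i) x)))
        = -(-dCoord e (tIdx i) x (I x (cov (fun y ↦ cov (coordField e (tIdx i)) y
              (coordField e l y)) x (coordField e k x)))
          - -dCoord e (tIdx i) x (I x (cov (fun y ↦ cov (coordField e (tIdx i)) y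
              (coordField e k y)) x (coordField e l x)))) := by
      rw [hRK, mlieBracket_coordField he hx]
      simp only [← dCoordL_apply, map_sub, map_zero]
      ring
    have hd : ddc I f x (coordField e k x) (coordField e l x)
        = partialD e k (fun y ↦ dc I f y (coordField e l y)) x
          - partialD e l (fun y ↦ dc I f y (coordField e k y)) x := dOne_coordField he hdc hx k l
    have d1 := hder k l
    have d2 := hder l k
    rw [t2, hd]
    simp only [hRK', hcov.second_derivative he h hx, Fin.sum_univ_two] at d1 d2 ⊢
    -- The products of connection coefficients form the trace of a commutator and cancel. There
    -- remains minus the differential of the trace, whose sign comes from the curvature convention.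
    linear_combination d2 - d1
  rw [bilForm_apply_eq_sum he hx (ρ x) v w, ddc, dOne_eq_sum he hdc hx, Finset.mul_sum]
  refine Finset.sum_congr rfl fun k _ ↦ ?_
  rw [Finset.mul_sum]
  refine Finset.sum_congr rfl fun l _ ↦ ?_
  rw [key, ddc]
  ring

end ChernRicci

/-! ### The torus action in a momentum-angle chart -/

section Action

variable [MulAction Torus M]

theorem torusExp_add (ξ η : LieT) : torusExp (ξ + η) = torusExp ξ * torusExp η := by
  simp [torusExp, Circle.exp_add]

theorem torusExp_zero : torusExp 0 = 1 := by
  simp [torusExp]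

theorem torusExp_zero_smul_smul (ξ : LieT) (x : M) : torusExp ((0 : ℝ) • ξ) • x = x := by
  rw [zero_smul, torusExp_zero, one_smul]

theorem contMDiff_torusExp (ξ : LieT) :
    ContMDiff 𝓘(ℝ, ℝ) ((𝓡 1).prod (𝓡 1)) ∞ (fun s : ℝ ↦ torusExp (s • ξ)) := by
  have h (a : ℝ) : ContMDiff 𝓘(ℝ, ℝ) 𝓘(ℝ, ℝ) ∞ (fun s : ℝ ↦ s * a) :=
    (contDiff_id.mul contDiff_const).contMDiff
  exact (contMDiff_circleExp.comp (h ξ.1)).prodMk (contMDiff_circleExp.comp (h ξ.2))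

variable {Ω : BilField M} {μ : M → (LieT →L[ℝ] ℝ)} (hM : IsSymplecticToric Ω μ)
include hM

theorem IsSymplecticToric.contMDiff_flow (ξ : LieT) :
    ContMDiff (𝓘(ℝ, ℝ).prod (𝓡 4)) (𝓡 4) ∞ (fun q : ℝ × M ↦ torusExp (q.1 • ξ) • q.2) :=
  hM.smooth_action.comp
    (((contMDiff_torusExp ξ).comp contMDiff_fst).prodMk contMDiff_snd)

theorem IsSymplecticToric.contMDiff_orbit (ξ : LieT) (x : M) :
    ContMDiff 𝓘(ℝ, ℝ) (𝓡 4) ∞ (fun s : ℝ ↦ torusExp (s • ξ) • x) :=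
  (hM.contMDiff_flow ξ).comp (contMDiff_id.prodMk contMDiff_const)

theorem IsSymplecticToric.contMDiff_smul (t : Torus) :
    ContMDiff (𝓡 4) (𝓡 4) ∞ (fun y : M ↦ t • y) :=
  hM.smooth_action.comp (contMDiff_const.prodMk contMDiff_id)

variable {e : OpenPartialHomeomorph M E4} (he : e ∈ IsManifold.maximalAtlas (𝓡 4) ∞ M)
include he

/-- The derivative of a chart along an orbit of a one-parameter subgroup. -/
theorem IsSymplecticToric.hasDerivAt_orbit (ξ : LieT) (x : M) (s : ℝ)
    (hs : torusExp (s • ξ) • x ∈ e.source) :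
    HasDerivAt (fun r : ℝ ↦ e (torusExp (r • ξ) • x))
      (show E4 from mfderiv (𝓡 4) (𝓡 4) e (torusExp (s • ξ) • x)
        (fundField ξ (torusExp (s • ξ) • x))) s := by
  have key (y : M) (hy : y ∈ e.source) :
      HasDerivAt (fun r : ℝ ↦ e (torusExp (r • ξ) • y))
        (show E4 from mfderiv (𝓡 4) (𝓡 4) e y (fundField ξ y)) 0 := by
    have h0 := torusExp_zero_smul_smul ξ y
    have hγ : MDifferentiableAt 𝓘(ℝ, ℝ) (𝓡 4) (fun s : ℝ ↦ torusExp (s • ξ) • y) 0 :=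
      ((hM.contMDiff_orbit ξ y) 0).mdifferentiableAt (by simp)
    have he' : MDifferentiableAt (𝓡 4) (𝓡 4) e (torusExp ((0 : ℝ) • ξ) • y) := by
      rw [h0]
      exact (chart_mdifferentiable he).mdifferentiableAt hy
    have hc := he'.comp (0 : ℝ) hγ
    have h1 : DifferentiableAt ℝ (fun r : ℝ ↦ e (torusExp (r • ξ) • y)) 0 :=
      mdifferentiableAt_iff_differentiableAt.1 hc
    have h2 : mfderiv 𝓘(ℝ, ℝ) (𝓡 4) (e ∘ fun s : ℝ ↦ torusExp (s • ξ) • y) 0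
      = (mfderiv (𝓡 4) (𝓡 4) e (torusExp ((0 : ℝ) • ξ) • y)).comp _ := mfderiv_comp (0 : ℝ) he' hγ
    have h3 : fderiv ℝ (fun r : ℝ ↦ e (torusExp (r • ξ) • y)) 0
        = mfderiv 𝓘(ℝ, ℝ) (𝓡 4) (e ∘ fun s : ℝ ↦ torusExp (s • ξ) • y) 0 :=
      mfderiv_eq_fderiv.symm
    have h4 (z : M) (hz : z = y) (v : E4) : (mfderiv (𝓡 4) (𝓡 4) e z v : E4)
        = mfderiv (𝓡 4) (𝓡 4) e y v := by
      subst hz; rfl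
    have h5 := h1.hasFDerivAt.hasDerivAt
    rw [h3, h2] at h5
    have h6 := h4 _ h0 (fundField ξ y)
    exact h6 ▸ h5
  have h1 := key _ hs
  -- The derivative at time `s` is the one at time zero from the point `exp(sξ)·x`, by the
  -- one-parameter group law.
  have h2 : HasDerivAt (fun r : ℝ ↦ e (torusExp ((r - s) • ξ) • torusExp (s • ξ) • x)) _ s :=
    HasDerivAt.comp_sub_const (f := fun r : ℝ ↦ e (torusExp (r • ξ) • torusExp (s • ξ) • x)) s s
      (by simpa using h1)
  refine h2.congr_of_eventuallyEq (Filter.Eventually.of_forall fun r ↦ ?_)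
  simp only
  rw [smul_smul, ← torusExp_add, ← add_smul, sub_add_cancel]

end Action

/-! ### The torus acts by translations of the angles -/

section AngularChart

variable [MulAction Torus M] {Ω : BilField M} {μ : M → (LieT →L[ℝ] ℝ)}
  (hM : IsSymplecticToric Ω μ) {J : EndField M} {ξ : Module.Basis (Fin 2) ℝ LieT}
  {e : OpenPartialHomeomorph M E4} (he : IsAngularChart μ J ξ e)
include hM he

/-- The momentum coordinates are constant along the orbits of the torus. -/
theorem IsAngularChart.dCoord_mu_fundField {x : M} (hx : x ∈ e.source) (i : Fin 2) (η : LieT) :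
    dCoord e (muIdx i) x (fundField η x) = 0 := by
  have h0 := torusExp_zero_smul_smul η x
  have h1 := hM.hasDerivAt_orbit he.mem_atlas η x 0 (by rwa [h0])
  have h2 := (EuclideanSpace.proj (muIdx i) : E4 →L[ℝ] ℝ).hasFDerivAt.comp_hasDerivAt (0 : ℝ) h1
  have hev : ∀ᶠ s : ℝ in 𝓝 0, torusExp (s • η) • x ∈ e.source := by
    refine (hM.contMDiff_orbit η x).continuous.continuousAt.eventually_mem ?_
    rw [h0]
    exact e.open_source.mem_nhds hx
  have h3 : HasDerivAt (fun s : ℝ ↦ (e (torusExp (s • η) • x)) (muIdx i)) 0 0 := by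
    refine (hasDerivAt_const (0 : ℝ) (μ x (ξ i))).congr_of_eventuallyEq ?_
    filter_upwards [hev] with s hs
    rw [he.momentum _ hs, hM.moment_invariant]
  have h4 := h2.unique h3
  have h5 (z : M) (hz : z = x) : dCoord e (muIdx i) z (fundField η z)
      = dCoord e (muIdx i) x (fundField η x) := by
    subst hz; rfl
  rw [← h5 _ h0]
  exact h4

/-- In a momentum-angle chart, the fundamental fields are the angular coordinate fields. -/
theorem IsAngularChart.fundField_eq {x : M} (hx : x ∈ e.source) (j : Fin 2) :
    fundField (ξ j) x = coordField e (tIdx j) x := by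
  refine eq_of_dCoord_eq he.mem_atlas hx fun k ↦ ?_
  rw [dCoord_coordField he.mem_atlas hx]
  obtain ⟨i, rfl⟩ | ⟨i, rfl⟩ := fin4_cases k
  · rw [if_neg (muIdx_ne_tIdx i j), he.dCoord_mu_fundField hM hx]
  · rw [he.angle_fund x hx]
    simp

/-- The torus acts by translations in a momentum-angle chart. -/
theorem IsAngularChart.eventually_translation {x : M} (hx : x ∈ e.source) (j : Fin 2) :
    ∀ᶠ s : ℝ in 𝓝 0, ∀ᶠ y in 𝓝 x, torusExp (s • ξ j) • y ∈ e.source ∧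
      e (torusExp (s • ξ j) • y) = e y + s • (EuclideanSpace.single (tIdx j) (1 : ℝ) : E4) := by
  have hev : ∀ᶠ q : ℝ × M in 𝓝 (0, x), torusExp (q.1 • ξ j) • q.2 ∈ e.source := by
    refine (hM.contMDiff_flow (ξ j)).continuous.continuousAt.eventually_mem ?_
    rw [torusExp_zero_smul_smul]
    exact e.open_source.mem_nhds hx
  -- A product neighbourhood gives a time bound `δ` common to all points near `x`, so that the
  -- translation formula holds on a neighbourhood and can be differentiated.
  rw [nhds_prod_eq] at hev
  obtain ⟨p, hp, q, hq, hpq⟩ := Filter.eventually_prod_iff.1 hev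
  obtain ⟨δ, hδ, hball⟩ := Metric.eventually_nhds_iff_ball.1 hp
  filter_upwards [Metric.ball_mem_nhds (0 : ℝ) hδ] with s hs
  filter_upwards [hq] with y hy
  have hmem (r : ℝ) (hr : r ∈ Metric.ball (0 : ℝ) δ) : torusExp (r • ξ j) • y ∈ e.source :=
    hpq (hball r hr) hy
  refine ⟨hmem s hs, ?_⟩
  have hd (r : ℝ) (hr : r ∈ Metric.ball (0 : ℝ) δ) :
      HasDerivAt (fun r : ℝ ↦ e (torusExp (r • ξ j) • y)
        - r • (EuclideanSpace.single (tIdx j) (1 : ℝ) : E4)) 0 r := by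
    have h1 := hM.hasDerivAt_orbit he.mem_atlas (ξ j) y r (hmem r hr)
    rw [he.fundField_eq hM (hmem r hr), mfderiv_coordField he.mem_atlas (hmem r hr)] at h1
    have h2 : HasDerivAt (fun r : ℝ ↦ r • (EuclideanSpace.single (tIdx j) (1 : ℝ) : E4))
        (EuclideanSpace.single (tIdx j) (1 : ℝ)) r := by
      simpa using (hasDerivAt_id r).smul_const (EuclideanSpace.single (tIdx j) (1 : ℝ) : E4)
    have h3 := h1.sub h2
    have h4 : (show E4 from stdField (tIdx j) (e (torusExp (r • ξ j) • y)))
        - EuclideanSpace.single (tIdx j) (1 : ℝ) = 0 := sub_self _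
    exact h3.congr_deriv h4
  -- The chart along the orbit has constant velocity `∂/∂t^j`; the difference with the straight line
  -- has zero derivative on an interval, hence is constant.
  have h5 := (convex_ball (0 : ℝ) δ).is_const_of_fderivWithin_eq_zero (𝕜 := ℝ)
    (fun r hr ↦ (hd r hr).differentiableAt.differentiableWithinAt)
    (fun r hr ↦ by
      rw [fderivWithin_of_isOpen Metric.isOpen_ball hr, (hd r hr).hasFDerivAt.fderiv]
      ext; simp) hs (Metric.mem_ball_self hδ)
  rw [torusExp_zero_smul_smul] at h5
  simpa [sub_eq_iff_eq_add] using h5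

/-- The differential of the action is the identity in a momentum-angle chart. -/
theorem IsAngularChart.eventually_dCoord_actDeriv {x : M} (hx : x ∈ e.source) (j : Fin 2) :
    ∀ᶠ s : ℝ in 𝓝 0, ∀ (k : Fin 4) (v : TangentSpace (𝓡 4) x),
      dCoord e k (torusExp (s • ξ j) • x) (actDeriv (torusExp (s • ξ j)) x v)
        = dCoord e k x v := by
  filter_upwards [he.eventually_translation hM hx j] with s hs k v
  have hsx := hs.self_of_nhds.1
  have h1 := mfderiv_comp x ((chart_mdifferentiable he.mem_atlas).mdifferentiableAt hsx)
    ((hM.contMDiff_smul (torusExp (s • ξ j)) x).mdifferentiableAt (by simp))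
  have h2 : mfderiv (𝓡 4) (𝓡 4) (e ∘ fun y ↦ torusExp (s • ξ j) • y) x
      = mfderiv (𝓡 4) (𝓡 4)
        (fun y ↦ e y + s • (EuclideanSpace.single (tIdx j) (1 : ℝ) : E4)) x := by
    refine Filter.EventuallyEq.mfderiv_eq ?_
    filter_upwards [hs] with y hy
    exact hy.2
  have h3 : mfderiv (𝓡 4) (𝓡 4)
        (fun y ↦ e y + s • (EuclideanSpace.single (tIdx j) (1 : ℝ) : E4)) x
      = mfderiv (𝓡 4) (𝓡 4) e x :=
    (((chart_mdifferentiable he.mem_atlas).mdifferentiableAt hx).hasMFDerivAt.add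
      (hasMFDerivAt_const _ x)).mfderiv.trans (add_zero _)
  have h4 := h1.symm.trans (h2.trans h3)
  exact congrArg (fun L : E4 →L[ℝ] E4 ↦ L v k) h4

end AngularChart

theorem EndSmooth.apply_smoothAt {J : EndField M} (hJ : EndSmooth J) {X : VField M} {x : M}
    (hX : VFieldSmoothAt X x) : VFieldSmoothAt (fun y ↦ J y (X y)) x :=
  ContMDiffAt.clm_bundle_apply (hJ x) hX

/-! ### Normal form of the symplectic form and of both complex structures -/

section DGK

variable [MulAction Torus M] {Ω : BilField M} {μ : M → (LieT →L[ℝ] ℝ)}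
  (hM : IsSymplecticToric Ω μ) {J : EndField M} (hJ : IsDGK Ω μ J)
  {ξ : Module.Basis (Fin 2) ℝ LieT}
  {e : OpenPartialHomeomorph M E4} (he : IsAngularChart μ J ξ e)

theorem IsAntidiagonal.eq_dCoord {Ψ : M → Matrix (Fin 2) (Fin 2) ℝ} (hΨ : IsAntidiagonal e J Ψ)
    (he : e ∈ IsManifold.maximalAtlas (𝓡 4) ∞ M) {y : M} (hy : y ∈ e.source) (i j : Fin 2) :
    Ψ y i j = dCoord e (tIdx i) y (J y (coordField e (muIdx j) y)) := by
  simp [hΨ.t_part y hy, dCoord_coordField he hy]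

include hM he in
-- The coordinate line of `t^l` through `x` is, for small time, the orbit of `exp(sξ_l)`, so
-- invariance along the orbit kills the derivative.
theorem IsAngularChart.partialD_eq_zero {f : M → ℝ} (hf : SmoothIn e f) {x : M}
    (hx : x ∈ e.source) (l : Fin 2)
    (h : ∀ᶠ s : ℝ in 𝓝 0, f (torusExp (s • ξ l) • x) = f x) :
    partialD e (tIdx l) f x = 0 := by
  set ε : E4 := EuclideanSpace.single (tIdx l) (1 : ℝ) with hε
  have h1 : HasDerivAt (fun s : ℝ ↦ e x + s • ε) ε 0 := by
    simpa using ((hasDerivAt_id (0 : ℝ)).smul_const ε).const_add (e x)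
  have h2 : HasFDerivAt (f ∘ e.symm) (fderiv ℝ (f ∘ e.symm) (e x)) (e x + (0 : ℝ) • ε) := by
    simpa using (hf.differentiableAt hx).hasFDerivAt
  have h3 := h2.comp_hasDerivAt (0 : ℝ) h1
  have h4 : HasDerivAt ((f ∘ e.symm) ∘ fun s : ℝ ↦ e x + s • ε) 0 0 := by
    refine (hasDerivAt_const (0 : ℝ) (f x)).congr_of_eventuallyEq ?_
    filter_upwards [h, he.eventually_translation hM hx l] with s hs hs'
    obtain ⟨hs1, hs2⟩ := hs'.self_of_nhds
    simp only [Function.comp_apply]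
    rw [← hs2, e.left_inv hs1, hs]
  exact h3.unique h4

include hM hJ he in
-- The entries of `Ψ` are components of `J∂/∂μ^j`. The action is by translations with trivial
-- differential in the chart, so invariance of `J` makes them independent of the angles.
theorem IsDGK.isToricStructure {Ψ : M → Matrix (Fin 2) (Fin 2) ℝ} (hΨ : IsAntidiagonal e J Ψ) :
    IsToricStructure e J Ψ := by
  have hs (i j : Fin 2) : SmoothIn e (fun y ↦ Ψ y i j) := by
    refine SmoothIn.congr (smoothIn_of_contMDiffAt he.mem_atlas fun y hy ↦ ?_)
      fun y hy ↦ hΨ.eq_dCoord he.mem_atlas hy i j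
    exact dCoord_smoothAt he.mem_atlas hy _
      (hJ.smooth.apply_smoothAt (coordField_smoothAt he.mem_atlas hy _))
  refine ⟨hΨ, hs, fun y hy i j l ↦ he.partialD_eq_zero hM (hs i j) hy l ?_⟩
  filter_upwards [he.eventually_translation hM hy l, he.eventually_dCoord_actDeriv hM hy l]
    with s hs1 hs2
  obtain ⟨hsx, -⟩ := hs1.self_of_nhds
  have h1 := hΨ.t_part _ hsx (actDeriv (torusExp (s • ξ l)) y (coordField e (muIdx j) y)) i
  rw [hJ.invariant, hs2] at h1
  simp only [hs2, dCoord_coordField he.mem_atlas hy] at h1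
  rw [hΨ.eq_dCoord he.mem_atlas hy i j, h1]
  simp

include hM he in
-- The moment map equation, since `K_j = ∂/∂t^j` and `μ^j` is a coordinate.
theorem IsSymplecticToric.apply_t {x : M} (hx : x ∈ e.source) (j : Fin 2)
    (v : TangentSpace (𝓡 4) x) : Ω x (coordField e (tIdx j) x) v = -dCoord e (muIdx j) x v := by
  rw [← he.fundField_eq hM hx, hM.hamiltonian]
  congr 1
  have h1 : mfderiv (𝓡 4) 𝓘(ℝ, ℝ) (fun y ↦ μ y (ξ j)) x
      = mfderiv (𝓡 4) 𝓘(ℝ, ℝ) ((EuclideanSpace.proj (muIdx j) : E4 →L[ℝ] ℝ) ∘ e) x := by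
    refine Filter.EventuallyEq.mfderiv_eq ?_
    filter_upwards [e.open_source.mem_nhds hx] with y hy
    exact (he.momentum y hy j).symm
  have h2 := mfderiv_comp x (I'' := 𝓘(ℝ, ℝ))
    (EuclideanSpace.proj (muIdx j) : E4 →L[ℝ] ℝ).differentiableAt.mdifferentiableAt
    ((chart_mdifferentiable he.mem_atlas).mdifferentiableAt hx)
  rw [mfderiv_eq_fderiv, ContinuousLinearMap.fderiv] at h2
  exact congrArg (fun L : E4 →L[ℝ] ℝ ↦ L v) (h1.trans h2)

include hM in
theorem IsSymplecticToric.antisymm (x : M) (v w : TangentSpace (𝓡 4) x) :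
    Ω x v w = -Ω x w v := by
  have h := hM.alternating x (v + w)
  simp only [map_add, add_apply, hM.alternating, zero_add, add_zero] at h
  linarith

include hM in
theorem IsSymplecticToric.adjoint_apply (x : M) (v w : TangentSpace (𝓡 4) x) :
    Ω x (J x v) w = Ω x v (sympAdjoint Ω J x w) :=
  sympAdjoint_apply Ω J x (fun v hv ↦ hM.nondegenerate x v fun w ↦ by
    rw [hM.antisymm, hv, neg_zero]) v w

include hM hJ he in
-- The antidiagonality condition gives `JK_j = J^{*ω}k` with `k` tangent to the orbit. Then `ω(JK_i,
-- J^{*ω}k) = ω(J²K_i, k) = dμ^i(k)`, and momenta are constant on orbits.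
theorem IsDGK.omega_J_t {x : M} (hx : x ∈ e.source) (i j : Fin 2) :
    Ω x (J x (coordField e (tIdx i) x)) (J x (coordField e (tIdx j) x)) = 0 := by
  have hK (j : Fin 2) : ∃ k ∈ orbitTangent x, sympAdjoint Ω J x k
      = J x (coordField e (tIdx j) x) := by
    have h1 : J x (coordField e (tIdx j) x) ∈ (orbitTangent x).map (J x).toLinearMap := by
      refine ⟨_, Submodule.subset_span ⟨ξ j, rfl⟩, ?_⟩
      exact congrArg (J x) (he.fundField_eq hM hx j)
    rw [← hJ.antidiagonal x (he.source_subset hx)] at h1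
    exact h1
  have h0 (k : TangentSpace (𝓡 4) x) (hk : k ∈ orbitTangent x) (m : Fin 2) :
      dCoord e (muIdx m) x k = 0 := by
    induction hk using Submodule.span_induction with
    | mem v hv =>
      obtain ⟨η, rfl⟩ := hv
      exact he.dCoord_mu_fundField hM hx m η
    | zero => rw [← dCoordL_apply, map_zero]
    | add v w _ _ hv hw =>
      rw [← dCoordL_apply, map_add, dCoordL_apply, dCoordL_apply, hv, hw, add_zero]
    | smul a v _ hv => rw [← dCoordL_apply, map_smul, dCoordL_apply, hv, smul_zero]
  obtain ⟨k, hk, hk'⟩ := hK j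
  rw [← hk', ← hM.adjoint_apply, hJ.sq, map_neg, neg_apply, hM.apply_t he hx, h0 k hk]
  simp

variable {Ψ : M → Matrix (Fin 2) (Fin 2) ℝ} (hΨ : IsAntidiagonal e J Ψ)
include hM hJ he hΨ

/-- The symplectic form in momentum-angle coordinates. -/
theorem IsDGK.omega_eq {x : M} (hx : x ∈ e.source) (v w : TangentSpace (𝓡 4) x) :
    Ω x v w = ∑ j, (dCoord e (muIdx j) x v * dCoord e (tIdx j) x w
      - dCoord e (tIdx j) x v * dCoord e (muIdx j) x w) := by
  have h := hJ.isToricStructure hM he hΨ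
  have hmm (i j : Fin 2) : Ω x (coordField e (muIdx i) x) (coordField e (muIdx j) x) = 0 := by
    -- The momentum fields are combinations of the `JK_i`, so they span a Lagrangian plane as well.
    have h1 (j : Fin 2) : coordField e (muIdx j) x
        = -∑ i, Ψ x i j • J x (coordField e (tIdx i) x) := by
      have h2 := h.sq he.mem_atlas hx (coordField e (muIdx j) x)
      rw [h.apply_mu he.mem_atlas hx, map_sum] at h2
      simp only [map_smul] at h2
      rw [h2, neg_neg]
    rw [h1 i, h1 j]
    simp only [Fin.sum_univ_two, map_neg, map_add, map_smul, neg_apply, add_apply, smul_apply,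
      hJ.omega_J_t hM he hx]
    simp
  have hmt (i j : Fin 2) : Ω x (coordField e (muIdx i) x) (coordField e (tIdx j) x)
      = if i = j then 1 else 0 := by
    rw [hM.antisymm, hM.apply_t he hx, neg_neg, dCoord_coordField he.mem_atlas hx]
    simp [eq_comm]
  rw [bilForm_apply_eq_sum he.mem_atlas hx]
  simp only [sum_fin4, hmm, hmt, hM.apply_t he hx, dCoord_coordField he.mem_atlas hx]
  simp [Fin.sum_univ_two]
  ring

/-- The symplectic adjoint is antidiagonal, with matrix `-Ψᵀ`. -/
theorem IsDGK.isToricStructure_adjoint :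
    IsToricStructure e (sympAdjoint Ω J) (fun y ↦ -(Ψ y)ᵀ) := by
  have h := hJ.isToricStructure hM he hΨ
  refine ⟨⟨fun x hx ↦ ?_, fun x hx v i ↦ ?_, fun x hx v i ↦ ?_⟩, fun i j ↦ (h.smooth j i).neg,
    fun y hy i j l ↦ ?_⟩
  · exact ((Matrix.isUnit_transpose _).2 (hΨ.isUnit x hx)).neg
  · have h1 := hM.adjoint_apply (J := J) x (coordField e (muIdx i) x) v
    rw [hJ.omega_eq hM he hΨ hx, hJ.omega_eq hM he hΨ hx] at h1
    simp only [hΨ.t_part x hx, hΨ.mu_part x hx, dCoord_coordField he.mem_atlas hx] at h1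
    simp at h1
    rw [← h1]
    simp
  · have h1 := hM.adjoint_apply (J := J) x (coordField e (tIdx i) x) v
    rw [hJ.omega_eq hM he hΨ hx, hJ.omega_eq hM he hΨ hx] at h1
    simp only [hΨ.t_part x hx, hΨ.mu_part x hx, dCoord_coordField he.mem_atlas hx] at h1
    simp at h1
    have h2 : (-(Ψ x)ᵀ)⁻¹ = -((Ψ x)⁻¹)ᵀ := by
      rw [Matrix.transpose_nonsing_inv]
      refine Matrix.inv_eq_left_inv ?_
      have : IsUnit ((Ψ x)ᵀ).det := by
        rw [Matrix.det_transpose]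
        exact (Matrix.isUnit_iff_isUnit_det _).1 (hΨ.isUnit x hx)
      rw [neg_mul_neg, Matrix.nonsing_inv_mul _ this]
    rw [h2]
    simp only [Matrix.neg_apply, Matrix.transpose_apply, neg_mul, Finset.sum_neg_distrib, neg_neg]
    rw [Fin.sum_univ_two]
    linarith
  · have h1 : partialD e (tIdx l) (fun y ↦ -Ψ y j i) y = 0 := by
      rw [partialD_neg, h.invariant y hy, neg_zero]
    exact h1

end DGK

/-! ### The operator `dd^c` on invariant functions -/

section DDC

variable {e : OpenPartialHomeomorph M E4} (he : e ∈ IsManifold.maximalAtlas (𝓡 4) ∞ M)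
  {I : EndField M} {Φ : M → Matrix (Fin 2) (Fin 2) ℝ} (h : IsToricStructure e I Φ)
include he h

theorem IsToricStructure.ddc_eq_sub {f f₁ f₂ : M → ℝ} (h₁ : SmoothIn e f₁) (h₂ : SmoothIn e f₂)
    (r : ℝ) (hf : ∀ y ∈ e.source, f y = f₁ y - r * f₂ y) {x : M} (hx : x ∈ e.source)
    (v w : TangentSpace (𝓡 4) x) : ddc I f x v w = ddc I f₁ x v w - r * ddc I f₂ x v w := by
  have hfs : SmoothIn e f := (h₁.sub ((SmoothIn.const r).mul h₂)).congr hf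
  have hp (y : M) (hy : y ∈ e.source) (m : Fin 4) :
      partialD e m f y = partialD e m f₁ y - r * partialD e m f₂ y := by
    rw [partialD_congr m hf hy, partialD_sub m h₁ ((SmoothIn.const r).mul h₂) hy,
      partialD_mul m (SmoothIn.const r) h₂ hy, partialD_const]
    ring
  have hd (k : Fin 4) (y : M) (hy : y ∈ e.source) : dc I f y (coordField e k y)
      = dc I f₁ y (coordField e k y) - r * dc I f₂ y (coordField e k y) := by
    rw [dc_coordField he hfs hy, dc_coordField he h₁ hy, dc_coordField he h₂ hy]
    simp only [hp y hy, Fin.sum_univ_four]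
    ring
  have hs₁ := h.dc_smooth he h₁
  have hs₂ := h.dc_smooth he h₂
  have hpd (k l : Fin 4) : partialD e k (fun y ↦ dc I f y (coordField e l y)) x
      = partialD e k (fun y ↦ dc I f₁ y (coordField e l y)) x
        - r * partialD e k (fun y ↦ dc I f₂ y (coordField e l y)) x := by
    rw [partialD_congr k (hd l) hx, partialD_sub k (hs₁ l) ((SmoothIn.const r).mul (hs₂ l)) hx,
      partialD_mul k (SmoothIn.const r) (hs₂ l) hx, partialD_const]
    ring
  unfold ddc
  rw [dOne_eq_sum he (h.dc_smooth he hfs) hx, dOne_eq_sum he hs₁ hx, dOne_eq_sum he hs₂ hx,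
    Finset.mul_sum, ← Finset.sum_sub_distrib]
  refine Finset.sum_congr rfl fun k _ ↦ ?_
  rw [Finset.mul_sum, ← Finset.sum_sub_distrib]
  refine Finset.sum_congr rfl fun l _ ↦ ?_
  rw [dOne_coordField he (h.dc_smooth he hfs) hx, dOne_coordField he hs₁ hx,
    dOne_coordField he hs₂ hx, hpd, hpd]
  ring

variable {f : M → ℝ} (hf : SmoothIn e f)
  (hinv : ∀ y ∈ e.source, ∀ l, partialD e (tIdx l) f y = 0)
include hf

omit h in
-- For invariant `f` this is the only part of `d^c f`: its coefficients depend on the momenta, so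
-- `dd^c f` has only momentum-angle components.
theorem IsAntidiagonal.dc_t (h : IsAntidiagonal e I Φ) {y : M} (hy : y ∈ e.source) (j : Fin 2) :
    dc I f y (coordField e (tIdx j) y) = ∑ i, (Φ y)⁻¹ i j * partialD e (muIdx i) f y := by
  rw [dc_coordField he hf hy, sum_fin4]
  simp [h.t_part y hy, h.mu_part y hy, dCoord_coordField he hy]

include hinv

omit h in
theorem IsAntidiagonal.dc_mu (h : IsAntidiagonal e I Φ) {y : M} (hy : y ∈ e.source) (j : Fin 2) :
    dc I f y (coordField e (muIdx j) y) = 0 := by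
  rw [dc_coordField he hf hy, sum_fin4]
  simp [h.t_part y hy, h.mu_part y hy, dCoord_coordField he hy, hinv y hy]

theorem IsToricStructure.ddc_mu_mu {x : M} (hx : x ∈ e.source) (k l : Fin 2) :
    ddc I f x (coordField e (muIdx k) x) (coordField e (muIdx l) x) = 0 := by
  rw [ddc, dOne_coordField he (h.dc_smooth he hf) hx,
    partialD_congr _ (fun y hy ↦ h.anti.dc_mu he hf hinv hy _) hx,
    partialD_congr _ (fun y hy ↦ h.anti.dc_mu he hf hinv hy _) hx, partialD_const, partialD_const,
    sub_zero]

theorem IsToricStructure.partialD_dc_t {x : M} (hx : x ∈ e.source) (k l : Fin 2) :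
    partialD e (tIdx k) (fun y ↦ dc I f y (coordField e (tIdx l) y)) x = 0 := by
  have h1 (i : Fin 2) : partialD e (tIdx k) (partialD e (muIdx i) f) x = 0 := by
    rw [partialD_comm _ _ hf hx, partialD_congr _ (fun y hy ↦ hinv y hy k) hx, partialD_const]
  rw [partialD_congr _ (fun y hy ↦ h.anti.dc_t he hf hy l) hx]
  simp only [Fin.sum_univ_two]
  have hs (i : Fin 2) := h.smooth_inv i l
  rw [partialD_add _ ((hs 0).mul (hf.partialD _)) ((hs 1).mul (hf.partialD _)) hx,
    partialD_mul _ (hs 0) (hf.partialD _) hx, partialD_mul _ (hs 1) (hf.partialD _) hx, h1, h1,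
    h.inv_invariant he hx, h.inv_invariant he hx]
  ring

theorem IsToricStructure.ddc_t_t {x : M} (hx : x ∈ e.source) (k l : Fin 2) :
    ddc I f x (coordField e (tIdx k) x) (coordField e (tIdx l) x) = 0 := by
  rw [ddc, dOne_coordField he (h.dc_smooth he hf) hx, h.partialD_dc_t he hf hinv hx,
    h.partialD_dc_t he hf hinv hx, sub_zero]

theorem IsToricStructure.ddc_mu_t {x : M} (hx : x ∈ e.source) (k l : Fin 2) :
    ddc I f x (coordField e (muIdx k) x) (coordField e (tIdx l) x)
      = partialD e (muIdx k) (fun y ↦ ∑ i, (Φ y)⁻¹ i l * partialD e (muIdx i) f y) x := by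
  rw [ddc, dOne_coordField he (h.dc_smooth he hf) hx,
    partialD_congr (tIdx l) (fun y hy ↦ h.anti.dc_mu he hf hinv hy _) hx, partialD_const,
    partialD_congr _ (fun y hy ↦ h.anti.dc_t he hf hy l) hx, sub_zero]

end DDC

/-! ### Partial derivatives of rational expressions -/

/-- `f` is smooth in the chart `e`, with `k`-th partial derivative `f'` at `x`. -/
structure HasPartial (e : OpenPartialHomeomorph M E4) (k : Fin 4) (x : M) (f : M → ℝ) (f' : ℝ) :
    Prop where
  mem : x ∈ e.source
  smooth : SmoothIn e f
  eq : partialD e k f x = f'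

namespace HasPartial

variable {e : OpenPartialHomeomorph M E4} {k : Fin 4} {x : M} {f g : M → ℝ} {f' g' : ℝ}

theorem add (hf : HasPartial e k x f f') (hg : HasPartial e k x g g') :
    HasPartial e k x (fun y ↦ f y + g y) (f' + g') :=
  ⟨hf.mem, hf.smooth.add hg.smooth, by rw [partialD_add k hf.smooth hg.smooth hf.mem, hf.eq, hg.eq]⟩

theorem sub (hf : HasPartial e k x f f') (hg : HasPartial e k x g g') :
    HasPartial e k x (fun y ↦ f y - g y) (f' - g') :=
  ⟨hf.mem, hf.smooth.sub hg.smooth, by rw [partialD_sub k hf.smooth hg.smooth hf.mem, hf.eq, hg.eq]⟩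

theorem neg (hf : HasPartial e k x f f') : HasPartial e k x (fun y ↦ -f y) (-f') :=
  ⟨hf.mem, hf.smooth.neg, by rw [partialD_neg, hf.eq]⟩

theorem mul (hf : HasPartial e k x f f') (hg : HasPartial e k x g g') :
    HasPartial e k x (fun y ↦ f y * g y) (f' * g x + f x * g') :=
  ⟨hf.mem, hf.smooth.mul hg.smooth, by rw [partialD_mul k hf.smooth hg.smooth hf.mem, hf.eq, hg.eq]⟩

theorem div (hf : HasPartial e k x f f') (hg : HasPartial e k x g g')
    (h0 : ∀ y ∈ e.source, g y ≠ 0) :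
    HasPartial e k x (fun y ↦ f y / g y) ((f' * g x - f x * g') / (g x) ^ 2) :=
  ⟨hf.mem, hf.smooth.div hg.smooth h0,
    by rw [partialD_div k hf.smooth hg.smooth hf.mem h0, hf.eq, hg.eq]⟩

theorem const (hx : x ∈ e.source) (r : ℝ) : HasPartial e k x (fun _ ↦ r) 0 :=
  ⟨hx, SmoothIn.const r, partialD_const k r⟩

theorem congr (hf : HasPartial e k x f f') (h : ∀ y ∈ e.source, g y = f y) :
    HasPartial e k x g f' :=
  ⟨hf.mem, hf.smooth.congr h, by rw [partialD_congr k h hf.mem, hf.eq]⟩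

theorem congr_partial (hf : HasPartial e k x f f') (h : f' = g') : HasPartial e k x f g' := h ▸ hf

end HasPartial

theorem SmoothIn.hasPartial {e : OpenPartialHomeomorph M E4} {f : M → ℝ} (hf : SmoothIn e f)
    (k : Fin 4) {x : M} (hx : x ∈ e.source) : HasPartial e k x f (ToricGK.partialD e k f x) :=
  ⟨hx, hf, rfl⟩

/-! ### Change of basis -/

section BasisChange

variable {e : OpenPartialHomeomorph M E4} (he : e ∈ IsManifold.maximalAtlas (𝓡 4) ∞ M)

/-- The wedge product of two alternating bilinear forms as an alternating map. -/
def wedgeAlternating {V : Type*} [AddCommGroup V] [Module ℝ V] (α β : V →ₗ[ℝ] V →ₗ[ℝ] ℝ)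
    (hα : ∀ v, α v v = 0) (hβ : ∀ v, β v v = 0) : V [⋀^Fin 4]→ₗ[ℝ] ℝ where
  toMultilinearMap := MultilinearMap.mk' (wedgeTwoTwo (fun v w ↦ α v w) (fun v w ↦ β v w))
    (fun m i x y ↦ by fin_cases i <;> simp [wedgeTwoTwo, Function.update] <;> ring)
    (fun m i r x ↦ by fin_cases i <;> simp [wedgeTwoTwo, Function.update] <;> ring)
  map_eq_zero_of_eq' := by
    intro v i j hv hij
    have anti (γ : V →ₗ[ℝ] V →ₗ[ℝ] ℝ) (hγ : ∀ v, γ v v = 0) (v w : V) : γ v w = -γ w v := by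
      have h := hγ (v + w)
      simp only [map_add, LinearMap.add_apply, hγ, zero_add, add_zero] at h
      linarith
    have main (i j : Fin 4) (hv : v i = v j) (hij : i < j) :
        wedgeTwoTwo (fun v w ↦ α v w) (fun v w ↦ β v w) v = 0 := by
      have a1 := anti α hα (v 1)
      have a2 := anti β hβ (v 1)
      have a3 := anti α hα (v 2)
      have a4 := anti β hβ (v 2)
      fin_cases i <;> fin_cases j <;> simp at hij <;>
        simp only [Fin.zero_eta, Fin.mk_one, Fin.reduceFinMk] at hv <;>
        simp only [wedgeTwoTwo, hv, hα, hβ]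
      · ring
      · rw [a1 (v 2), a2 (v 2)]; ring
      · rw [anti α hα (v 3) (v 1), anti α hα (v 3) (v 2), anti β hβ (v 3) (v 1),
          anti β hβ (v 3) (v 2)]; ring
      · ring
      · rw [anti α hα (v 3) (v 2), anti β hβ (v 3) (v 2)]; ring
      · ring
    rcases lt_or_gt_of_ne hij with h | h
    · exact main i j hv h
    · exact main j i hv.symm h

theorem bilForm_self_eq_zero (he : e ∈ IsManifold.maximalAtlas (𝓡 4) ∞ M) {x : M}
    (hx : x ∈ e.source) (β : TangentSpace (𝓡 4) x →L[ℝ] TangentSpace (𝓡 4) x →L[ℝ] ℝ)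
    (h : ∀ k l, β (coordField e k x) (coordField e l x) = -β (coordField e l x) (coordField e k x))
    (v : TangentSpace (𝓡 4) x) : β v v = 0 := by
  have h1 := bilForm_apply_eq_sum he hx β v v
  have h2 := h1
  rw [Finset.sum_comm] at h2
  have h3 : β v v = -β v v := by
    conv_rhs => rw [h2]
    rw [h1, ← Finset.sum_neg_distrib]
    refine Finset.sum_congr rfl fun k _ ↦ ?_
    rw [← Finset.sum_neg_distrib]
    refine Finset.sum_congr rfl fun l _ ↦ ?_
    rw [h k l]
    ring
  linarith

include he in
/-- The Hermitian scalar curvature in a chart. -/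
theorem hermScal_eq {ρ F : BilField M} {x : M} (hx : x ∈ e.source) (hρ : ∀ v, ρ x v v = 0)
    (hF : ∀ v, F x v v = 0) :
    hermScal ρ F x = 4 * wedgeTwoTwo (fun v w ↦ ρ x v w) (fun v w ↦ F x v w)
        (fun k ↦ coordField e k x)
      / wedgeTwoTwo (fun v w ↦ F x v w) (fun v w ↦ F x v w) (fun k ↦ coordField e k x) := by
  let toL (β : TangentSpace (𝓡 4) x →L[ℝ] TangentSpace (𝓡 4) x →L[ℝ] ℝ) :
      TangentSpace (𝓡 4) x →ₗ[ℝ] TangentSpace (𝓡 4) x →ₗ[ℝ] ℝ :=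
    (ContinuousLinearMap.coeLM ℝ).comp β.toLinearMap
  have hb : (fun k ↦ coordField e k x) = coordBasis he hx :=
    funext fun k ↦ (coordBasis_apply he hx k).symm
  have key (α β : TangentSpace (𝓡 4) x →L[ℝ] TangentSpace (𝓡 4) x →L[ℝ] ℝ)
      (hα : ∀ v, α v v = 0) (hβ : ∀ v, β v v = 0) :
      wedgeTwoTwo (fun v w ↦ α v w) (fun v w ↦ β v w) (tangentBasis x)
        = wedgeTwoTwo (fun v w ↦ α v w) (fun v w ↦ β v w) (fun k ↦ coordField e k x)
          * (coordBasis he hx).det (tangentBasis x) := by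
    -- Alternating `4`-forms in dimension four are multiples of the determinant, so the same factor
    -- appears above and below in the scalar curvature.
    have h1 := (wedgeAlternating (toL α) (toL β) hα hβ).eq_smul_basis_det (coordBasis he hx)
    have h2 := congrArg (fun A : TangentSpace (𝓡 4) x [⋀^Fin 4]→ₗ[ℝ] ℝ ↦ A (tangentBasis x)) h1
    rw [hb]
    exact h2
  have hdet : (coordBasis he hx).det (tangentBasis x) ≠ 0 :=
    ((coordBasis he hx).isUnit_det (tangentBasis x)).ne_zero
  rw [hermScal, key _ _ hρ hF, key _ _ hF hF, ← mul_assoc, mul_div_mul_right _ _ hdet]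

/-- The matrix of `g` at `x` in the coordinate basis. -/
def coordGram (e : OpenPartialHomeomorph M E4) (g : BilField M) (x : M) :
    Matrix (Fin 4) (Fin 4) ℝ :=
  fun i j ↦ g x (coordField e i x) (coordField e j x)

/-- The matrix of the standard basis of the tangent space in the coordinate basis. -/
def basisChange (e : OpenPartialHomeomorph M E4) (x : M) : Matrix (Fin 4) (Fin 4) ℝ :=
  fun i j ↦ dCoord e j x (tangentBasis x i)

include he in
theorem isUnit_det_basisChange {x : M} (hx : x ∈ e.source) : IsUnit (basisChange e x).det := by
  have h1 : basisChange e x = ((coordBasis he hx).toMatrix (tangentBasis x))ᵀ := by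
    ext i j
    rw [Matrix.transpose_apply, Module.Basis.toMatrix_apply, coordBasis_repr]
    rfl
  rw [h1, Matrix.det_transpose, ← Module.Basis.det_apply]
  exact (coordBasis he hx).isUnit_det (tangentBasis x)

omit [IsManifold (𝓡 4) ∞ M] in
theorem basisChange_mul {x : M} {α : TangentSpace (𝓡 4) x → TangentSpace (𝓡 4) x → ℝ}
    (hα : ∀ v w, α v w = ∑ k, ∑ l, dCoord e k x v * dCoord e l x w
      * α (coordField e k x) (coordField e l x)) :
    Matrix.of (fun i j ↦ α (tangentBasis x i) (tangentBasis x j))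
      = basisChange e x * Matrix.of (fun k l ↦ α (coordField e k x) (coordField e l x))
        * (basisChange e x)ᵀ := by
  ext i j
  rw [Matrix.of_apply, hα]
  simp only [Matrix.mul_apply, Matrix.transpose_apply, Matrix.of_apply, Finset.sum_mul]
  rw [Finset.sum_comm]
  refine Finset.sum_congr rfl fun k _ ↦ Finset.sum_congr rfl fun l _ ↦ ?_
  simp only [basisChange]
  ring

include he in
theorem gram_eq {g : BilField M} {x : M} (hx : x ∈ e.source) :
    gram g x = basisChange e x * coordGram e g x * (basisChange e x)ᵀ :=
  basisChange_mul (α := fun v w ↦ g x v w) (bilForm_apply_eq_sum he hx (g x))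

include he in
theorem normSqOne_eq {g : BilField M} {x : M} (hx : x ∈ e.source)
    (θ : TangentSpace (𝓡 4) x →L[ℝ] ℝ) :
    normSqOne g x θ = ∑ i, ∑ j, (coordGram e g x)⁻¹ i j * θ (coordField e i x)
      * θ (coordField e j x) := by
  have hP := isUnit_det_basisChange he hx
  have hPt : IsUnit (basisChange e x)ᵀ.det := by rwa [Matrix.det_transpose]
  have h1 (A : Matrix (Fin 4) (Fin 4) ℝ) (u : Fin 4 → ℝ) :
      ∑ i, ∑ j, A i j * u i * u j = u ⬝ᵥ (A *ᵥ u) := by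
    simp only [dotProduct, Matrix.mulVec, Finset.mul_sum]
    exact Finset.sum_congr rfl fun i _ ↦ Finset.sum_congr rfl fun j _ ↦ by ring
  have h2 : (fun i ↦ θ (tangentBasis x i)) = basisChange e x *ᵥ fun k ↦ θ (coordField e k x) :=
    funext fun i ↦ oneForm_apply_eq_sum he hx θ _
  unfold normSqOne
  rw [h1 _ fun i ↦ θ (tangentBasis x i), h1 _ fun i ↦ θ (coordField e i x), h2, gram_eq he hx,
    Matrix.mul_inv_rev, Matrix.mul_inv_rev, Matrix.mulVec_mulVec, Matrix.mul_assoc,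
    Matrix.mul_assoc, Matrix.nonsing_inv_mul _ hP, Matrix.mul_one, ← Matrix.mulVec_mulVec,
    Matrix.dotProduct_mulVec, ← Matrix.transpose_nonsing_inv, Matrix.vecMul_transpose,
    Matrix.mulVec_mulVec, Matrix.nonsing_inv_mul _ hP, Matrix.one_mulVec]

include he in
-- The sum is the trace of `Aᵀ G⁻¹ B (G⁻¹)ᵀ`; under `A ↦ PAPᵀ`, `B ↦ PBPᵀ`, `G ↦ PGPᵀ` the base
-- changes cancel by cyclicity of the trace.
theorem innerTwo_eq {g : BilField M} {x : M} (hx : x ∈ e.source)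
    {α β : TangentSpace (𝓡 4) x → TangentSpace (𝓡 4) x → ℝ}
    (hα : ∀ v w, α v w = ∑ k, ∑ l, dCoord e k x v * dCoord e l x w
      * α (coordField e k x) (coordField e l x))
    (hβ : ∀ v w, β v w = ∑ k, ∑ l, dCoord e k x v * dCoord e l x w
      * β (coordField e k x) (coordField e l x)) :
    innerTwo g x α β = (1 / 4 : ℝ) * ∑ i, ∑ j, ∑ k, ∑ l, (coordGram e g x)⁻¹ i k
      * (coordGram e g x)⁻¹ j l * α (coordField e i x) (coordField e j x)
      * β (coordField e k x) (coordField e l x) := by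
  have hP := isUnit_det_basisChange he hx
  have h1 (G A B : Matrix (Fin 4) (Fin 4) ℝ) :
      ∑ i, ∑ j, ∑ k, ∑ l, G i k * G j l * A i j * B k l = (Aᵀ * (G * B * Gᵀ)).trace := by
    simp only [Matrix.trace, Matrix.diag_apply, Matrix.mul_apply, Matrix.transpose_apply,
      Finset.mul_sum, Finset.sum_mul]
    rw [Finset.sum_comm]
    refine Finset.sum_congr rfl fun j _ ↦ Finset.sum_congr rfl fun i _ ↦ ?_
    rw [Finset.sum_comm]
    exact Finset.sum_congr rfl fun l _ ↦ Finset.sum_congr rfl fun k _ ↦ by ring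
  have h2 := h1 (gram g x)⁻¹ (Matrix.of fun i j ↦ α (tangentBasis x i) (tangentBasis x j))
    (Matrix.of fun i j ↦ β (tangentBasis x i) (tangentBasis x j))
  have h3 := h1 (coordGram e g x)⁻¹ (Matrix.of fun i j ↦ α (coordField e i x) (coordField e j x))
    (Matrix.of fun i j ↦ β (coordField e i x) (coordField e j x))
  unfold innerTwo
  refine congrArg (fun r ↦ (1 / 4 : ℝ) * r) (h2.trans (Eq.trans ?_ h3.symm))
  rw [basisChange_mul hα, basisChange_mul hβ, gram_eq he hx]
  set P := basisChange e x
  set G := coordGram e g x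
  set A := Matrix.of fun i j ↦ α (coordField e i x) (coordField e j x)
  set B := Matrix.of fun i j ↦ β (coordField e i x) (coordField e j x)
  have hPt : IsUnit Pᵀ.det := by rwa [Matrix.det_transpose]
  have e1 : (P * G * Pᵀ)⁻¹ = Pᵀ⁻¹ * G⁻¹ * P⁻¹ := by
    rw [Matrix.mul_inv_rev, Matrix.mul_inv_rev, Matrix.mul_assoc]
  have e2 : (P * G * Pᵀ)⁻¹ * (P * B * Pᵀ) * (P * G * Pᵀ)⁻¹ᵀ = Pᵀ⁻¹ * (G⁻¹ * B * G⁻¹ᵀ) * P⁻¹ := by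
    have e3 : (Pᵀ⁻¹ * G⁻¹ * P⁻¹)ᵀ = Pᵀ⁻¹ * G⁻¹ᵀ * P⁻¹ := by
      rw [Matrix.transpose_mul, Matrix.transpose_mul, Matrix.transpose_nonsing_inv Pᵀ,
        Matrix.transpose_transpose, Matrix.transpose_nonsing_inv P, Matrix.mul_assoc]
    rw [e1, e3]
    calc _ = Pᵀ⁻¹ * G⁻¹ * (P⁻¹ * P) * B * (Pᵀ * Pᵀ⁻¹) * G⁻¹ᵀ * P⁻¹ := by
          simp only [Matrix.mul_assoc]
      _ = _ := by
          rw [Matrix.nonsing_inv_mul _ hP, Matrix.mul_nonsing_inv _ hPt]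
          simp only [Matrix.mul_assoc, Matrix.mul_one]
  rw [e2, Matrix.transpose_mul, Matrix.transpose_mul, Matrix.transpose_transpose]
  calc _ = (P * (Aᵀ * ((Pᵀ * Pᵀ⁻¹) * (G⁻¹ * B * G⁻¹ᵀ)) * P⁻¹)).trace := by
        simp only [Matrix.mul_assoc]
    _ = _ := by
        rw [Matrix.mul_nonsing_inv _ hPt, Matrix.one_mul, Matrix.trace_mul_comm, Matrix.mul_assoc,
          Matrix.nonsing_inv_mul _ hP, Matrix.mul_one]

end BasisChange

/-! ### Toric Hermitian structures -/

/-- The determinant of the symmetric matrix with entries `a, b, b, d`. -/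
def detSym (a b d : M → ℝ) (y : M) : ℝ := a y * d y - b y * b y

/-- The determinant of the matrix with entries `a, b + c, b - c, d`. -/
def detFull (a b d c : M → ℝ) (y : M) : ℝ := detSym a b d y + c y * c y

/-- The entries `a, b + c, b - c, d` of a matrix that depends only on the momenta, with closed rows
and columns, and with positive symmetric part. -/
structure IsToricPotential (e : OpenPartialHomeomorph M E4) (a b d c : M → ℝ) : Prop where
  smooth_a : SmoothIn e a
  smooth_b : SmoothIn e b
  smooth_d : SmoothIn e d
  smooth_c : SmoothIn e c
  invariant_a : ∀ y ∈ e.source, ∀ l, partialD e (tIdx l) a y = 0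
  invariant_b : ∀ y ∈ e.source, ∀ l, partialD e (tIdx l) b y = 0
  invariant_d : ∀ y ∈ e.source, ∀ l, partialD e (tIdx l) d y = 0
  const_c : ∀ y ∈ e.source, ∀ k, partialD e k c y = 0
  closed_ab : ∀ y ∈ e.source, partialD e (muIdx 0) b y = partialD e (muIdx 1) a y
  closed_bd : ∀ y ∈ e.source, partialD e (muIdx 0) d y = partialD e (muIdx 1) b y
  pos : ∀ y ∈ e.source, 0 < detSym a b d y

/-- The first component of the gradient of the determinant, up to the factor `det S`. -/
def gradFst (e : OpenPartialHomeomorph M E4) (a b d : M → ℝ) (y : M) : ℝ :=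
  d y * partialD e (muIdx 0) (detSym a b d) y - b y * partialD e (muIdx 1) (detSym a b d) y

/-- The second component of the gradient of the determinant, up to the factor `det S`. -/
def gradSnd (e : OpenPartialHomeomorph M E4) (a b d : M → ℝ) (y : M) : ℝ :=
  a y * partialD e (muIdx 1) (detSym a b d) y - b y * partialD e (muIdx 0) (detSym a b d) y

/-- The trace of the Hessian of the determinant, up to the factor `det S`. -/
def lapDet (e : OpenPartialHomeomorph M E4) (a b d : M → ℝ) (y : M) : ℝ :=
  d y * partialD e (muIdx 0) (partialD e (muIdx 0) (detSym a b d)) y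
    - 2 * (b y * partialD e (muIdx 0) (partialD e (muIdx 1) (detSym a b d)) y)
    + a y * partialD e (muIdx 1) (partialD e (muIdx 1) (detSym a b d)) y

/-- The squared norm of the gradient of the determinant, up to the factor `det S`. -/
def normGrad (e : OpenPartialHomeomorph M E4) (a b d : M → ℝ) (y : M) : ℝ :=
  partialD e (muIdx 0) (detSym a b d) y * gradFst e a b d y
    + partialD e (muIdx 1) (detSym a b d) y * gradSnd e a b d y

/-- The scalar curvature in terms of the ratio `q = det S / det Ψ`. -/
def toricScal (e : OpenPartialHomeomorph M E4) (a b d c : M → ℝ) (y : M) : ℝ :=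
  (2 * (detSym a b d y / detFull a b d c y) - 1)
      * (lapDet e a b d y / detSym a b d y ^ 2 - normGrad e a b d y / detSym a b d y ^ 3)
    + (3 * (detSym a b d y / detFull a b d c y) - 4 * (detSym a b d y / detFull a b d c y) ^ 2)
      * (normGrad e a b d y / detSym a b d y ^ 3)

namespace IsToricPotential

variable {e : OpenPartialHomeomorph M E4} {a b d c : M → ℝ} (h : IsToricPotential e a b d c)
include h

/-- The passage from `J` to `J^{*ω}`, up to an overall sign of the matrix. -/
theorem neg : IsToricPotential e a b d (fun y ↦ -c y) :=
  { h with
    smooth_c := h.smooth_c.neg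
    const_c := fun y hy k ↦ by rw [partialD_neg, h.const_c y hy, neg_zero] }

theorem smooth_detSym : SmoothIn e (detSym a b d) :=
  (h.smooth_a.mul h.smooth_d).sub (h.smooth_b.mul h.smooth_b)

theorem smooth_detFull : SmoothIn e (detFull a b d c) :=
  h.smooth_detSym.add (h.smooth_c.mul h.smooth_c)

theorem detFull_pos {y : M} (hy : y ∈ e.source) : 0 < detFull a b d c y :=
  add_pos_of_pos_of_nonneg (h.pos y hy) (mul_self_nonneg _)

theorem partialD_detSym {y : M} (hy : y ∈ e.source) (k : Fin 4) :
    partialD e k (detSym a b d) y = partialD e k a y * d y + a y * partialD e k d y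
      - 2 * (b y * partialD e k b y) := by
  have h1 := (((h.smooth_a.hasPartial k hy).mul (h.smooth_d.hasPartial k hy)).sub
    ((h.smooth_b.hasPartial k hy).mul (h.smooth_b.hasPartial k hy))).eq
  refine Eq.trans h1 ?_
  ring

theorem invariant_detSym {y : M} (hy : y ∈ e.source) (l : Fin 2) :
    partialD e (tIdx l) (detSym a b d) y = 0 := by
  rw [h.partialD_detSym hy, h.invariant_a y hy, h.invariant_b y hy, h.invariant_d y hy]
  ring

/-- `det Ψ = det S + c²` with `c` constant, so both determinants have the same differential. -/
theorem hasPartial_detFull {y : M} (hy : y ∈ e.source) (k : Fin 4) :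
    HasPartial e k y (detFull a b d c) (partialD e k (detSym a b d) y) := by
  refine ((h.smooth_detSym.hasPartial k hy).add
    ((h.smooth_c.hasPartial k hy).mul (h.smooth_c.hasPartial k hy))).congr_partial ?_
  rw [h.const_c y hy]
  ring

theorem hasPartial_gradFst {y : M} (hy : y ∈ e.source) (k : Fin 4) :
    HasPartial e k y (gradFst e a b d)
      (partialD e k d y * partialD e (muIdx 0) (detSym a b d) y
        + d y * partialD e k (partialD e (muIdx 0) (detSym a b d)) y
        - (partialD e k b y * partialD e (muIdx 1) (detSym a b d) y
          + b y * partialD e k (partialD e (muIdx 1) (detSym a b d)) y)) :=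
  ((h.smooth_d.hasPartial k hy).mul ((h.smooth_detSym.partialD _).hasPartial k hy)).sub
    ((h.smooth_b.hasPartial k hy).mul ((h.smooth_detSym.partialD _).hasPartial k hy))

theorem hasPartial_gradSnd {y : M} (hy : y ∈ e.source) (k : Fin 4) :
    HasPartial e k y (gradSnd e a b d)
      (partialD e k a y * partialD e (muIdx 1) (detSym a b d) y
        + a y * partialD e k (partialD e (muIdx 1) (detSym a b d)) y
        - (partialD e k b y * partialD e (muIdx 0) (detSym a b d) y
          + b y * partialD e k (partialD e (muIdx 0) (detSym a b d)) y)) :=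
  ((h.smooth_a.hasPartial k hy).mul ((h.smooth_detSym.partialD _).hasPartial k hy)).sub
    ((h.smooth_b.hasPartial k hy).mul ((h.smooth_detSym.partialD _).hasPartial k hy))

theorem partialD_comm_detSym {y : M} (hy : y ∈ e.source) :
    partialD e (muIdx 1) (partialD e (muIdx 0) (detSym a b d)) y
      = partialD e (muIdx 0) (partialD e (muIdx 1) (detSym a b d)) y :=
  partialD_comm _ _ h.smooth_detSym hy

/-- The rows `(d, -b)` and `(-b, a)` of the cofactor matrix are divergence free because `S` is
closed; only second derivatives of the determinant survive. -/
theorem div_grad {y : M} (hy : y ∈ e.source) :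
    partialD e (muIdx 0) (gradFst e a b d) y + partialD e (muIdx 1) (gradSnd e a b d) y
      = lapDet e a b d y := by
  rw [(h.hasPartial_gradFst hy _).eq, (h.hasPartial_gradSnd hy _).eq, h.closed_ab y hy,
    h.closed_bd y hy, h.partialD_comm_detSym hy, lapDet]
  ring

/-- The function `log det g|_K = log (det S / (det Ψ)²)`. -/
theorem hasPartial_log {y : M} (hy : y ∈ e.source) (k : Fin 4) :
    HasPartial e k y (fun y ↦ Real.log (detSym a b d y) - 2 * Real.log (detFull a b d c y))
      (partialD e k (detSym a b d) y * (1 / detSym a b d y - 2 / detFull a b d c y)) := by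
  have hD := (h.pos y hy).ne'
  have hE := (h.detFull_pos hy).ne'
  have h1 : SmoothIn e (fun y ↦ Real.log (detSym a b d y)) :=
    h.smooth_detSym.log fun y hy ↦ (h.pos y hy).ne'
  have h2 : SmoothIn e (fun y ↦ Real.log (detFull a b d c y)) :=
    h.smooth_detFull.log fun y hy ↦ (h.detFull_pos hy).ne'
  refine ((h1.hasPartial k hy).sub ((HasPartial.const hy 2).mul
    (h2.hasPartial k hy))).congr_partial ?_
  rw [partialD_log k h.smooth_detSym hy hD, partialD_log k h.smooth_detFull hy hE,
    (h.hasPartial_detFull hy k).eq]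
  ring

end IsToricPotential

/-- The metric `∑ S_{ij} dμ^i dμ^j + (det S / det Ψ) ∑ S^{ij} dt^i dt^j`. -/
structure IsBlockMetric (e : OpenPartialHomeomorph M E4) (g : BilField M) (a b d c : M → ℝ) :
    Prop where
  symm : ∀ y ∈ e.source, ∀ v w : TangentSpace (𝓡 4) y, g y v w = g y w v
  mu_mu : ∀ y ∈ e.source, ∀ i j, g y (coordField e (muIdx i) y) (coordField e (muIdx j) y)
    = !![a y, b y; b y, d y] i j
  mu_t : ∀ y ∈ e.source, ∀ i j, g y (coordField e (muIdx i) y) (coordField e (tIdx j) y) = 0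
  t_t : ∀ y ∈ e.source, ∀ i j, g y (coordField e (tIdx i) y) (coordField e (tIdx j) y)
    = !![d y / detFull a b d c y, -b y / detFull a b d c y;
        -b y / detFull a b d c y, a y / detFull a b d c y] i j

/-- The matrix with entries `a, b + c, b - c, d`, up to the sign `σ`. -/
def fullMatrix (a b d c : M → ℝ) (σ : ℝ) (y : M) : Matrix (Fin 2) (Fin 2) ℝ :=
  !![σ * a y, σ * (b y + c y); σ * (b y - c y), σ * d y]

/-! ### The fundamental form of the block metric -/

section Hermitian

variable {e : OpenPartialHomeomorph M E4} (he : e ∈ IsManifold.maximalAtlas (𝓡 4) ∞ M)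
  {a b d c : M → ℝ} (h : IsToricPotential e a b d c) {g : BilField M}
  (hg : IsBlockMetric e g a b d c) {I : EndField M} {σ : ℝ} (hσ : σ * σ = 1)
  (hI : IsToricStructure e I (fullMatrix a b d c σ))

include h hσ in
theorem IsToricPotential.inv_fullMatrix {y : M} (hy : y ∈ e.source) :
    (fullMatrix a b d c σ y)⁻¹
      = !![σ * d y / detFull a b d c y, -(σ * (b y + c y)) / detFull a b d c y;
          -(σ * (b y - c y)) / detFull a b d c y, σ * a y / detFull a b d c y] := by
  have hE := (h.detFull_pos hy).ne'
  refine Matrix.inv_eq_left_inv ?_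
  have hσ' : σ ^ 2 = 1 := by rw [sq, hσ]
  ext i j
  fin_cases i <;> fin_cases j <;> simp [fullMatrix, Matrix.mul_apply, Fin.sum_univ_two] <;>
    field_simp <;> simp only [hσ', detFull, detSym] <;> ring

include h hg in
-- The angular block is the cofactor matrix of `S` divided by `E`, of determinant `D/E²`.
theorem IsBlockMetric.det_tGram {y : M} (hy : y ∈ e.source) :
    (tGram e g y).det = detSym a b d y / detFull a b d c y ^ 2 := by
  have hE := (h.detFull_pos hy).ne'
  rw [Matrix.det_fin_two]
  simp only [tGram, hg.t_t y hy]
  simp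
  field_simp
  simp only [detSym]
  ring

include h hg in
theorem IsBlockMetric.log_det {y : M} (hy : y ∈ e.source) : Real.log (tGram e g y).det
    = Real.log (detSym a b d y) - 2 * Real.log (detFull a b d c y) := by
  have hE := (h.detFull_pos hy).ne'
  rw [hg.det_tGram h hy, Real.log_div (h.pos y hy).ne' (by positivity), Real.log_pow]
  norm_num

include he h hg hI

/-- Orthogonality of `IK_i` and `K_j` holds because `I` sends angles to momenta and the metric is
block diagonal. -/
theorem IsBlockMetric.isToricMetric : IsToricMetric e I g := by
  have hd (y : M) (hy : y ∈ e.source) := (h.detFull_pos hy).ne'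
  refine ⟨fun i j ↦ ?_, hg.symm, fun y hy i j ↦ ?_, fun y hy ↦ ?_⟩
  · refine SmoothIn.congr ?_ fun y hy ↦ hg.t_t y hy i j
    fin_cases i <;> fin_cases j
    · exact h.smooth_d.div h.smooth_detFull hd
    · exact h.smooth_b.neg.div h.smooth_detFull hd
    · exact h.smooth_b.neg.div h.smooth_detFull hd
    · exact h.smooth_a.div h.smooth_detFull hd
  · rw [hI.apply_t he hy]
    simp [Fin.sum_univ_two, hg.mu_t y hy]
  · have hE := hd y hy
    have hD := (h.pos y hy).ne'
    rw [hg.det_tGram h hy]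
    positivity

omit h in
theorem IsBlockMetric.fundForm_mu_mu {y : M} (hy : y ∈ e.source) (i j : Fin 2) :
    fundForm g I y (coordField e (muIdx i) y) (coordField e (muIdx j) y) = 0 := by
  have h1 : fundForm g I y (coordField e (muIdx i) y) (coordField e (muIdx j) y)
    = g y (I y (coordField e (muIdx i) y)) (coordField e (muIdx j) y) := rfl
  rw [h1, hI.apply_mu he hy, hg.symm y hy]
  simp [Fin.sum_univ_two, hg.mu_t y hy]

omit h in
theorem IsBlockMetric.fundForm_t_t {y : M} (hy : y ∈ e.source) (i j : Fin 2) :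
    fundForm g I y (coordField e (tIdx i) y) (coordField e (tIdx j) y) = 0 := by
  have h1 : fundForm g I y (coordField e (tIdx i) y) (coordField e (tIdx j) y)
    = g y (I y (coordField e (tIdx i) y)) (coordField e (tIdx j) y) := rfl
  rw [h1, hI.apply_t he hy]
  simp [Fin.sum_univ_two, hg.mu_t y hy]

theorem IsBlockMetric.fundForm_mu_t {y : M} (hy : y ∈ e.source) (i j : Fin 2) :
    fundForm g I y (coordField e (muIdx i) y) (coordField e (tIdx j) y)
      = !![σ * (detSym a b d y + c y * b y) / detFull a b d c y,
            -(σ * (c y * a y)) / detFull a b d c y;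
          σ * (c y * d y) / detFull a b d c y,
            σ * (detSym a b d y - c y * b y) / detFull a b d c y] i j := by
  have hE := (h.detFull_pos hy).ne'
  have h1 : fundForm g I y (coordField e (muIdx i) y) (coordField e (tIdx j) y)
    = g y (I y (coordField e (muIdx i) y)) (coordField e (tIdx j) y) := rfl
  rw [h1, hI.apply_mu he hy]
  simp only [Fin.sum_univ_two, map_add, map_smul, add_apply, smul_apply, hg.t_t y hy]
  fin_cases i <;> fin_cases j <;> simp [fullMatrix] <;> field_simp <;>
    (try simp only [detSym]) <;> ring

include hσ

theorem IsBlockMetric.fundForm_t_mu {y : M} (hy : y ∈ e.source) (i j : Fin 2) :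
    fundForm g I y (coordField e (tIdx j) y) (coordField e (muIdx i) y)
      = -fundForm g I y (coordField e (muIdx i) y) (coordField e (tIdx j) y) := by
  have hE := (h.detFull_pos hy).ne'
  have h1 : fundForm g I y (coordField e (tIdx j) y) (coordField e (muIdx i) y)
    = g y (I y (coordField e (tIdx j) y)) (coordField e (muIdx i) y) := rfl
  rw [h1, hI.apply_t he hy, hg.fundForm_mu_t he h hI hy, h.inv_fullMatrix hσ hy]
  simp only [Fin.sum_univ_two, map_neg, map_add, map_smul, neg_apply, add_apply, smul_apply,
    hg.mu_mu y hy]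
  fin_cases i <;> fin_cases j <;> simp <;> field_simp <;> (try simp only [detSym]) <;> ring

theorem IsBlockMetric.fundForm_antisymm {y : M} (hy : y ∈ e.source) (k l : Fin 4) :
    fundForm g I y (coordField e k y) (coordField e l y)
      = -fundForm g I y (coordField e l y) (coordField e k y) := by
  obtain ⟨i, rfl⟩ | ⟨i, rfl⟩ := fin4_cases k <;> obtain ⟨j, rfl⟩ | ⟨j, rfl⟩ := fin4_cases l
  · rw [hg.fundForm_mu_mu he hI hy, hg.fundForm_mu_mu he hI hy, neg_zero]
  · rw [hg.fundForm_t_mu he h hσ hI hy, neg_neg]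
  · rw [hg.fundForm_t_mu he h hσ hI hy]
  · rw [hg.fundForm_t_t he hI hy, hg.fundForm_t_t he hI hy, neg_zero]

theorem IsBlockMetric.fundForm_smooth (k l : Fin 4) :
    SmoothIn e (fun y ↦ fundForm g I y (coordField e k y) (coordField e l y)) := by
  have hmt (i j : Fin 2) : SmoothIn e
      (fun y ↦ fundForm g I y (coordField e (muIdx i) y) (coordField e (tIdx j) y)) := by
    refine SmoothIn.congr ?_ fun y hy ↦ hg.fundForm_mu_t he h hI hy i j
    have hd (y : M) (hy : y ∈ e.source) := (h.detFull_pos hy).ne'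
    have hs := SmoothIn.const (e := e) σ
    fin_cases i <;> fin_cases j
    · exact (hs.mul (h.smooth_detSym.add (h.smooth_c.mul h.smooth_b))).div h.smooth_detFull hd
    · exact (hs.mul (h.smooth_c.mul h.smooth_a)).neg.div h.smooth_detFull hd
    · exact (hs.mul (h.smooth_c.mul h.smooth_d)).div h.smooth_detFull hd
    · exact (hs.mul (h.smooth_detSym.sub (h.smooth_c.mul h.smooth_b))).div h.smooth_detFull hd
  obtain ⟨i, rfl⟩ | ⟨i, rfl⟩ := fin4_cases k <;> obtain ⟨j, rfl⟩ | ⟨j, rfl⟩ := fin4_cases l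
  · exact (SmoothIn.const 0).congr fun y hy ↦ hg.fundForm_mu_mu he hI hy i j
  · exact hmt i j
  · exact (hmt j i).neg.congr fun y hy ↦ hg.fundForm_t_mu he h hσ hI hy j i
  · exact (SmoothIn.const 0).congr fun y hy ↦ hg.fundForm_t_t he hI hy i j

end Hermitian

/-! ### The Hermitian scalar curvature in terms of determinants -/

section HermitianScalar

/-- The numerator `4 ρ ∧ F`. Here `φ` stands for `(1/D - 2/E)/E` and `ψ` for its derivative with
respect to `D`, where `E - D` is constant; `W₁₀` is the derivative of `W₁` in the direction 0. The
hypothesis `hW` removes the second-order terms odd in `c`, and `D + c² = E` collects the even ones.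
-/
theorem hermScal_algebra {a b d c D E σ D₀ D₁ W₀ W₁ W₀₀ W₀₁ W₁₀ W₁₁ D₀₀ D₀₁ D₁₁ T : ℝ}
    (hE : E ≠ 0) (hσ : σ * σ = 1) (hE' : E = D + c * c)
    (hW₀ : W₀ = d * D₀ - b * D₁) (hW₁ : W₁ = a * D₁ - b * D₀) (hT : W₀₀ + W₁₁ = T)
    (hT' : T = d * D₀₀ - 2 * (b * D₀₁) + a * D₁₁)
    (hW : -b * W₀₀ - d * W₁₀ + a * W₀₁ + b * W₁₁ = 0) (φ ψ : ℝ) :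
    4 * (0 * 0
        - -(1 / 2 : ℝ) * (σ * (ψ * D₀ * (W₀ + c * D₁) + φ * (W₀₀ + c * D₀₁)))
          * (σ * (D - c * b) / E)
        + -(1 / 2 : ℝ) * (σ * (ψ * D₀ * (W₁ - c * D₀) + φ * (W₁₀ - c * D₀₀)))
          * (σ * (c * d) / E)
        + -(1 / 2 : ℝ) * (σ * (ψ * D₁ * (W₀ + c * D₁) + φ * (W₀₁ + c * D₁₁)))
          * (-(σ * (c * a)) / E)
        - -(1 / 2 : ℝ) * (σ * (ψ * D₁ * (W₁ - c * D₀) + φ * (W₁₁ - c * D₀₁)))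
          * (σ * (D + c * b) / E)
        + 0 * 0)
      = 2 * (ψ * (D₀ * W₀ + D₁ * W₁) + φ * T) := by
  have hi : E * E⁻¹ = 1 := mul_inv_cancel₀ hE
  subst hW₀ hW₁
  linear_combination (2 * E⁻¹ * φ * σ ^ 2 * D) * hT + (2 * σ ^ 2 * E⁻¹ * φ * c) * hW
    - (2 * σ ^ 2 * E⁻¹ * φ * c ^ 2) * hT'
    - (2 * σ ^ 2 * E⁻¹ * (ψ * (D₀ * (d * D₀ - b * D₁) + D₁ * (a * D₁ - b * D₀)) + φ * T)) * hE'
    + 2 * σ ^ 2 * (ψ * (D₀ * (d * D₀ - b * D₁) + D₁ * (a * D₁ - b * D₀)) + φ * T) * hi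
    + 2 * (ψ * (D₀ * (d * D₀ - b * D₁) + D₁ * (a * D₁ - b * D₀)) + φ * T) * hσ

variable {e : OpenPartialHomeomorph M E4} (he : e ∈ IsManifold.maximalAtlas (𝓡 4) ∞ M)
  {a b d c : M → ℝ} (h : IsToricPotential e a b d c) {g : BilField M}
  (hg : IsBlockMetric e g a b d c) {I : EndField M} {σ : ℝ} (hσ : σ * σ = 1)
  (hI : IsToricStructure e I (fullMatrix a b d c σ))

include he h hg hI in
/-- The Chern–Ricci form in terms of the determinants of `S` and `Ψ`. -/
theorem IsBlockMetric.chernRicci_eq [T2Space M] (hN : Integrable I) {ρ : BilField M}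
    (hρ : IsChernRicciForm g I ρ) {x : M} (hx : x ∈ e.source) (v w : TangentSpace (𝓡 4) x) :
    ρ x v w = -(1 / 2 : ℝ) * ddc I (fun y ↦ Real.log (detSym a b d y)) x v w
      + ddc I (fun y ↦ Real.log (detFull a b d c y)) x v w := by
  rw [hρ.eq_ddc he hI (hg.isToricMetric he h hI) hN hx v w,
    hI.ddc_eq_sub he (h.smooth_detSym.log fun y hy ↦ (h.pos y hy).ne')
      (h.smooth_detFull.log fun y hy ↦ (h.detFull_pos hy).ne') 2 (fun y hy ↦ hg.log_det h hy) hx]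
  ring

namespace IsToricPotential

include h

theorem hasPartial_factor {y : M} (hy : y ∈ e.source) (k : Fin 4) :
    HasPartial e k y
      (fun y ↦ (1 / detSym a b d y - 2 / detFull a b d c y) / detFull a b d c y)
      ((-(1 / detSym a b d y ^ 2) / detFull a b d c y
        - 1 / (detSym a b d y * detFull a b d c y ^ 2) + 4 / detFull a b d c y ^ 3)
          * partialD e k (detSym a b d) y) := by
  have hD := (h.pos y hy).ne'
  have hE := (h.detFull_pos hy).ne'
  have hE' : ∀ y ∈ e.source, detFull a b d c y ≠ 0 := fun y hy ↦ (h.detFull_pos hy).ne'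
  refine ((((HasPartial.const hy 1).div (h.smooth_detSym.hasPartial k hy)
    fun y hy ↦ (h.pos y hy).ne').sub ((HasPartial.const hy 2).div (h.hasPartial_detFull hy k)
      hE')).div (h.hasPartial_detFull hy k) hE').congr_partial ?_
  field_simp
  ring

/-- The components of `d^c log det g|_K` and their derivatives. -/
theorem hasPartial_dcFst {y : M} (hy : y ∈ e.source) (k : Fin 4) :
    HasPartial e k y (fun y ↦ σ * ((1 / detSym a b d y - 2 / detFull a b d c y)
        / detFull a b d c y * (gradFst e a b d y + c y * partialD e (muIdx 1) (detSym a b d) y)))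
      (σ * ((-(1 / detSym a b d y ^ 2) / detFull a b d c y
        - 1 / (detSym a b d y * detFull a b d c y ^ 2) + 4 / detFull a b d c y ^ 3)
          * partialD e k (detSym a b d) y
          * (gradFst e a b d y + c y * partialD e (muIdx 1) (detSym a b d) y)
        + (1 / detSym a b d y - 2 / detFull a b d c y) / detFull a b d c y
          * (partialD e k (gradFst e a b d) y
            + c y * partialD e k (partialD e (muIdx 1) (detSym a b d)) y))) := by
  refine ((HasPartial.const hy σ).mul ((h.hasPartial_factor hy k).mul
    (((h.hasPartial_gradFst hy k).smooth.hasPartial k hy).add ((h.smooth_c.hasPartial k hy).mul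
      ((h.smooth_detSym.partialD _).hasPartial k hy))))).congr_partial ?_
  rw [h.const_c y hy]
  ring

theorem hasPartial_dcSnd {y : M} (hy : y ∈ e.source) (k : Fin 4) :
    HasPartial e k y (fun y ↦ σ * ((1 / detSym a b d y - 2 / detFull a b d c y)
        / detFull a b d c y * (gradSnd e a b d y - c y * partialD e (muIdx 0) (detSym a b d) y)))
      (σ * ((-(1 / detSym a b d y ^ 2) / detFull a b d c y
        - 1 / (detSym a b d y * detFull a b d c y ^ 2) + 4 / detFull a b d c y ^ 3)
          * partialD e k (detSym a b d) y
          * (gradSnd e a b d y - c y * partialD e (muIdx 0) (detSym a b d) y)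
        + (1 / detSym a b d y - 2 / detFull a b d c y) / detFull a b d c y
          * (partialD e k (gradSnd e a b d) y
            - c y * partialD e k (partialD e (muIdx 0) (detSym a b d)) y))) := by
  refine ((HasPartial.const hy σ).mul ((h.hasPartial_factor hy k).mul
    (((h.hasPartial_gradSnd hy k).smooth.hasPartial k hy).sub ((h.smooth_c.hasPartial k hy).mul
      ((h.smooth_detSym.partialD _).hasPartial k hy))))).congr_partial ?_
  rw [h.const_c y hy]
  ring

end IsToricPotential

include he h hg hσ hI

/-- Both `ρ` and `F` have only momentum-angle components, so the two wedge products are combinations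
of products of these. The sign `σ` occurs squared and the terms odd in `c` cancel, so one formula
serves `J` and `J^{*ω}`. -/
theorem IsBlockMetric.hermScal_eq_toricScal [T2Space M] (hN : Integrable I) {ρ : BilField M}
    (hρ : IsChernRicciForm g I ρ) {x : M} (hx : x ∈ e.source) :
    hermScal ρ (fundForm g I) x = toricScal e a b d c x := by
  set f : M → ℝ := fun y ↦ Real.log (detSym a b d y) - 2 * Real.log (detFull a b d c y) with hf
  have hfs : SmoothIn e f := (h.hasPartial_log hx 0).smooth
  have hinv (y : M) (hy : y ∈ e.source) (l : Fin 2) : partialD e (tIdx l) f y = 0 := by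
    rw [(h.hasPartial_log hy _).eq, h.invariant_detSym hy, zero_mul]
  have hρf (v w : TangentSpace (𝓡 4) x) : ρ x v w = -(1 / 2 : ℝ) * ddc I f x v w := by
    rw [hg.chernRicci_eq he h hI hN hρ hx,
      hI.ddc_eq_sub (f := f) he (h.smooth_detSym.log fun y hy ↦ (h.pos y hy).ne')
        (h.smooth_detFull.log fun y hy ↦ (h.detFull_pos hy).ne') 2 (fun y _ ↦ rfl) hx]
    ring
  have hmm (i j : Fin 2) : ρ x (coordField e (muIdx i) x) (coordField e (muIdx j) x) = 0 := by
    rw [hρf, hI.ddc_mu_mu he hfs hinv hx, mul_zero]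
  have htt (i j : Fin 2) : ρ x (coordField e (tIdx i) x) (coordField e (tIdx j) x) = 0 := by
    rw [hρf, hI.ddc_t_t he hfs hinv hx, mul_zero]
  have hanti (k l : Fin 4) : ρ x (coordField e k x) (coordField e l x)
      = -ρ x (coordField e l x) (coordField e k x) := by
    rw [hρf, hρf, ddc, ddc, dOne_coordField he (hI.dc_smooth he hfs) hx,
      dOne_coordField he (hI.dc_smooth he hfs) hx]
    ring
  have hD := (h.pos x hx).ne'
  have hE := (h.detFull_pos hx).ne'
  have hdc0 (y : M) (hy : y ∈ e.source) :
      ∑ i, (fullMatrix a b d c σ y)⁻¹ i 0 * partialD e (muIdx i) f y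
        = σ * ((1 / detSym a b d y - 2 / detFull a b d c y) / detFull a b d c y
          * (gradFst e a b d y + c y * partialD e (muIdx 1) (detSym a b d) y)) := by
    rw [h.inv_fullMatrix hσ hy, Fin.sum_univ_two, (h.hasPartial_log hy _).eq,
      (h.hasPartial_log hy _).eq]
    simp [gradFst]
    ring
  have hmt0 (k : Fin 2) := (hρf (coordField e (muIdx k) x) (coordField e (tIdx 0) x)).trans
    (congrArg (fun r ↦ -(1 / 2 : ℝ) * r) ((hI.ddc_mu_t he hfs hinv hx k 0).trans
      ((h.hasPartial_dcFst (σ := σ) hx (muIdx k)).congr hdc0).eq))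
  have hdc1 (y : M) (hy : y ∈ e.source) :
      ∑ i, (fullMatrix a b d c σ y)⁻¹ i 1 * partialD e (muIdx i) f y
        = σ * ((1 / detSym a b d y - 2 / detFull a b d c y) / detFull a b d c y
          * (gradSnd e a b d y - c y * partialD e (muIdx 0) (detSym a b d) y)) := by
    rw [h.inv_fullMatrix hσ hy, Fin.sum_univ_two, (h.hasPartial_log hy _).eq,
      (h.hasPartial_log hy _).eq]
    simp [gradSnd]
    ring
  have hmt1 (k : Fin 2) := (hρf (coordField e (muIdx k) x) (coordField e (tIdx 1) x)).trans
    (congrArg (fun r ↦ -(1 / 2 : ℝ) * r) ((hI.ddc_mu_t he hfs hinv hx k 1).trans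
      ((h.hasPartial_dcSnd (σ := σ) hx (muIdx k)).congr hdc1).eq))
  have hFmt := hg.fundForm_mu_t he h hI hx
  have hFmm := hg.fundForm_mu_mu he hI hx
  have hFtt := hg.fundForm_t_t he hI hx
  rw [hermScal_eq he hx (bilForm_self_eq_zero he hx (ρ x) hanti)
    (bilForm_self_eq_zero he hx _ (hg.fundForm_antisymm he h hσ hI hx))]
  have i0 : (0 : Fin 4) = muIdx 0 := rfl
  have i1 : (1 : Fin 4) = muIdx 1 := rfl
  have i2 : (2 : Fin 4) = tIdx 0 := rfl
  have i3 : (3 : Fin 4) = tIdx 1 := rfl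
  simp only [wedgeTwoTwo, i0, i1, i2, i3]
  rw [hmm, htt, hFmm, hFtt, hmt0, hmt0, hmt1, hmt1, hFmt, hFmt, hFmt, hFmt]
  simp only [Matrix.of_apply, Matrix.cons_val_zero, Matrix.cons_val_one, Matrix.cons_val',
    Matrix.cons_val_fin_one]
  have hT := h.div_grad hx
  -- The vanishing of the part odd in `c`: the Hessian terms cancel by symmetry, and the first-order
  -- terms by closedness of `S` together with `dD = d(ad - b²)`.
  have hT' : -b x * partialD e (muIdx 0) (gradFst e a b d) x
      - d x * partialD e (muIdx 0) (gradSnd e a b d) x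
      + a x * partialD e (muIdx 1) (gradFst e a b d) x
      + b x * partialD e (muIdx 1) (gradSnd e a b d) x = 0 := by
    rw [(h.hasPartial_gradFst hx _).eq, (h.hasPartial_gradSnd hx _).eq,
      (h.hasPartial_gradFst hx _).eq, (h.hasPartial_gradSnd hx _).eq, h.partialD_comm_detSym hx,
      h.partialD_detSym hx, h.partialD_detSym hx, h.closed_ab x hx, h.closed_bd x hx]
    ring
  rw [h.partialD_comm_detSym hx]
  -- The denominator `F ∧ F` on the coordinate frame. Its sign reflects the ordering `(μ^0, μ^1,
  -- t^0, t^1)` of the frame.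
  have hden : ∀ {a b d c D E : ℝ}, E ≠ 0 → D = a * d - b * b → E = D + c * c →
      0 * 0 - σ * (D + c * b) / E * (σ * (D - c * b) / E) + -(σ * (c * a)) / E * (σ * (c * d) / E)
        + σ * (c * d) / E * (-(σ * (c * a)) / E) - σ * (D - c * b) / E * (σ * (D + c * b) / E)
        + 0 * 0 = -2 * D / E := by
    intro a b d c D E hE h1 h2
    have hσ' : σ ^ 2 = 1 := by rw [sq, hσ]
    field_simp
    rw [hσ']
    linear_combination 2 * D * h2 + 2 * c ^ 2 * h1
  rw [hermScal_algebra (D := detSym a b d x) (D₀ := partialD e (muIdx 0) (detSym a b d) x)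
    (D₁ := partialD e (muIdx 1) (detSym a b d) x) (W₀ := gradFst e a b d x)
    (W₁ := gradSnd e a b d x) hE hσ rfl rfl rfl hT rfl hT',
    hden (D := detSym a b d x) hE rfl rfl, toricScal, normGrad]
  field_simp
  ring

end HermitianScalar

/-! ### The Lee form and its differential -/

section LeeForm

variable {e : OpenPartialHomeomorph M E4} (he : e ∈ IsManifold.maximalAtlas (𝓡 4) ∞ M)
  {a b d c : M → ℝ} (h : IsToricPotential e a b d c) {g : BilField M}
  (hg : IsBlockMetric e g a b d c) {I : EndField M} {σ : ℝ} (hσ : σ * σ = 1)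
  (hI : IsToricStructure e I (fullMatrix a b d c σ))

include he h hg hI in
theorem IsBlockMetric.partialD_fundForm {y : M} (hy : y ∈ e.source) (k : Fin 4) (i j : Fin 2) :
    partialD e k (fun y ↦ fundForm g I y (coordField e (muIdx i) y) (coordField e (tIdx j) y)) y
      = !![σ * ((partialD e k (detSym a b d) y + c y * partialD e k b y) * detFull a b d c y
              - (detSym a b d y + c y * b y) * partialD e k (detSym a b d) y)
              / detFull a b d c y ^ 2,
            -(σ * (c y * (partialD e k a y * detFull a b d c y
              - a y * partialD e k (detSym a b d) y))) / detFull a b d c y ^ 2;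
          σ * (c y * (partialD e k d y * detFull a b d c y
              - d y * partialD e k (detSym a b d) y)) / detFull a b d c y ^ 2,
            σ * ((partialD e k (detSym a b d) y - c y * partialD e k b y) * detFull a b d c y
              - (detSym a b d y - c y * b y) * partialD e k (detSym a b d) y)
              / detFull a b d c y ^ 2] i j := by
  have hE := (h.detFull_pos hy).ne'
  have hd (y : M) (hy : y ∈ e.source) := (h.detFull_pos hy).ne'
  have pσ : HasPartial e k y (fun _ ↦ σ) 0 := HasPartial.const hy σ
  have pa := h.smooth_a.hasPartial k hy
  have pb := h.smooth_b.hasPartial k hy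
  have pd := h.smooth_d.hasPartial k hy
  have pc : HasPartial e k y c 0 := ⟨hy, h.smooth_c, h.const_c y hy k⟩
  have pD := h.smooth_detSym.hasPartial k hy
  have pE := h.hasPartial_detFull hy k
  rw [partialD_congr k (fun y hy ↦ hg.fundForm_mu_t he h hI hy i j) hy]
  fin_cases i <;> fin_cases j
  · refine ((pσ.mul (pD.add (pc.mul pb))).div pE hd).eq.trans ?_
    simp
    ring
  · refine ((pσ.mul (pc.mul pa)).neg.div pE hd).eq.trans ?_
    simp
    ring
  · refine ((pσ.mul (pc.mul pd)).div pE hd).eq.trans ?_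
    simp
    ring
  · refine ((pσ.mul (pD.sub (pc.mul pb))).div pE hd).eq.trans ?_
    simp
    ring

include he h hg hσ hI

/-- The equations `dF = θ ∧ F` in momentum-angle coordinates. -/
theorem IsBlockMetric.leeForm_equations {θ : OneForm M} (hθ : IsLeeForm g I θ) {y : M}
    (hy : y ∈ e.source) :
    (∀ i : Fin 2, θ y (coordField e (tIdx 1) y)
        * fundForm g I y (coordField e (muIdx i) y) (coordField e (tIdx 0) y)
      - θ y (coordField e (tIdx 0) y)
        * fundForm g I y (coordField e (muIdx i) y) (coordField e (tIdx 1) y) = 0) ∧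
    ∀ j : Fin 2, θ y (coordField e (muIdx 0) y)
        * fundForm g I y (coordField e (muIdx 1) y) (coordField e (tIdx j) y)
      - θ y (coordField e (muIdx 1) y)
        * fundForm g I y (coordField e (muIdx 0) y) (coordField e (tIdx j) y)
      = partialD e (muIdx 0)
          (fun y ↦ fundForm g I y (coordField e (muIdx 1) y) (coordField e (tIdx j) y)) y
        - partialD e (muIdx 1)
          (fun y ↦ fundForm g I y (coordField e (muIdx 0) y) (coordField e (tIdx j) y)) y := by
  have hz := bilForm_self_eq_zero he hy _ (hg.fundForm_antisymm he h hσ hI hy)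
  have halt (v w : TangentSpace (𝓡 4) y) : fundForm g I y v w = -fundForm g I y w v := by
    have h1 := hz (v + w)
    simp only [map_add, add_apply, hz, zero_add, add_zero] at h1
    linarith
  have hd := dTwo_coordField he (hg.fundForm_smooth he h hσ hI) hy halt
  have hneg (k : Fin 4) (i j : Fin 2) : partialD e k
      (fun y ↦ fundForm g I y (coordField e (tIdx j) y) (coordField e (muIdx i) y)) y
      = -partialD e k
        (fun y ↦ fundForm g I y (coordField e (muIdx i) y) (coordField e (tIdx j) y)) y := by
    rw [partialD_congr k (fun y hy ↦ hg.fundForm_t_mu he h hσ hI hy i j) hy, partialD_neg]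
  have hmm (k : Fin 4) (i j : Fin 2) : partialD e k
      (fun y ↦ fundForm g I y (coordField e (muIdx i) y) (coordField e (muIdx j) y)) y = 0 := by
    rw [partialD_congr k (fun y hy ↦ hg.fundForm_mu_mu he hI hy i j) hy, partialD_const]
  have htt (k : Fin 4) (i j : Fin 2) : partialD e k
      (fun y ↦ fundForm g I y (coordField e (tIdx i) y) (coordField e (tIdx j) y)) y = 0 := by
    rw [partialD_congr k (fun y hy ↦ hg.fundForm_t_t he hI hy i j) hy, partialD_const]
  have hmt (l i j : Fin 2) : partialD e (tIdx l)
      (fun y ↦ fundForm g I y (coordField e (muIdx i) y) (coordField e (tIdx j) y)) y = 0 := by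
    rw [hg.partialD_fundForm he h hI hy, h.invariant_detSym hy, h.invariant_a y hy,
      h.invariant_b y hy, h.invariant_d y hy]
    fin_cases i <;> fin_cases j <;> simp
  constructor
  · intro i
    have h1 := hθ.eq y (coordField e (muIdx i) y) (coordField e (tIdx 0) y)
      (coordField e (tIdx 1) y)
    rw [hd, htt, hneg, hmt, hmt, hg.fundForm_t_t he hI hy, hg.fundForm_t_mu he h hσ hI hy] at h1
    linarith
  · intro j
    have h1 := hθ.eq y (coordField e (muIdx 0) y) (coordField e (muIdx 1) y)
      (coordField e (tIdx j) y)
    rw [hd, hmm, hneg, hg.fundForm_mu_mu he hI hy, hg.fundForm_t_mu he h hσ hI hy] at h1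
    linarith

/-- On two angles and one momentum `dF` vanishes by invariance. The matrix of `F` on momenta and
angles has determinant `D/E`, so the resulting homogeneous system has only the zero solution. -/
theorem IsBlockMetric.leeForm_t {θ : OneForm M} (hθ : IsLeeForm g I θ) {y : M}
    (hy : y ∈ e.source) (j : Fin 2) : θ y (coordField e (tIdx j) y) = 0 := by
  have hE := (h.detFull_pos hy).ne'
  have hD := (h.pos y hy).ne'
  have hσ0 : σ ≠ 0 := by rintro rfl; simp at hσ
  have h1 := (hg.leeForm_equations he h hσ hI hθ hy).1
  have h0 := h1 0
  replace h1 := h1 1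
  rw [hg.fundForm_mu_t he h hI hy, hg.fundForm_mu_t he h hI hy] at h0 h1
  simp at h0 h1
  field_simp at h0 h1
  have hDe : detSym a b d y = a y * d y - b y * b y := rfl
  have key : detSym a b d y * detFull a b d c y ≠ 0 := mul_ne_zero hD hE
  have hFe : detFull a b d c y = detSym a b d y + c y * c y := rfl
  have e0 : θ y (coordField e (tIdx 0) y) = 0 := by
    refine (mul_eq_zero.1 ?_).resolve_left key
    -- Cramer's rule: the other unknown is eliminated, and the cleared determinant `D² + c²(ad -
    -- b²)` equals `DE`.
    linear_combination (σ * c y * d y) * h0 - σ * (detSym a b d y + c y * b y) * h1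
      + σ ^ 2 * θ y (coordField e (tIdx 0) y) * c y ^ 2 * hDe
      + σ ^ 2 * θ y (coordField e (tIdx 0) y) * detSym a b d y * hFe
      - θ y (coordField e (tIdx 0) y) * detSym a b d y * detFull a b d c y * hσ
  have e1 : θ y (coordField e (tIdx 1) y) = 0 := by
    refine (mul_eq_zero.1 ?_).resolve_left key
    linear_combination σ * (detSym a b d y - c y * b y) * h0 + (σ * c y * a y) * h1
      + σ ^ 2 * θ y (coordField e (tIdx 1) y) * c y ^ 2 * hDe
      + σ ^ 2 * θ y (coordField e (tIdx 1) y) * detSym a b d y * hFe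
      - θ y (coordField e (tIdx 1) y) * detSym a b d y * detFull a b d c y * hσ
  fin_cases j
  · exact e0
  · exact e1

/-- A linear system with the same matrix. Closedness of `S` cancels the derivatives of single
entries on the right-hand side, so only the gradient of `D` remains. -/
theorem IsBlockMetric.leeForm_mu {θ : OneForm M} (hθ : IsLeeForm g I θ) {y : M}
    (hy : y ∈ e.source) :
    θ y (coordField e (muIdx 0) y)
      = -(c y * gradSnd e a b d y) / (detFull a b d c y * detSym a b d y) ∧
    θ y (coordField e (muIdx 1) y)
      = c y * gradFst e a b d y / (detFull a b d c y * detSym a b d y) := by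
  have hE := (h.detFull_pos hy).ne'
  have hD := (h.pos y hy).ne'
  have hσ0 : σ ≠ 0 := by rintro rfl; simp at hσ
  have h1 := (hg.leeForm_equations he h hσ hI hθ hy).2
  have h0 := h1 0
  replace h1 := h1 1
  rw [hg.fundForm_mu_t he h hI hy, hg.fundForm_mu_t he h hI hy,
    hg.partialD_fundForm he h hI hy, hg.partialD_fundForm he h hI hy] at h0 h1
  rw [h.closed_bd y hy] at h0
  rw [h.closed_ab y hy] at h1
  simp at h0 h1
  field_simp at h0 h1
  have hDe : detSym a b d y = a y * d y - b y * b y := rfl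
  have hFe : detFull a b d c y = detSym a b d y + c y * c y := rfl
  rw [eq_div_iff (mul_ne_zero hE hD), eq_div_iff (mul_ne_zero hE hD)]
  refine ⟨mul_left_cancel₀ hE ?_, mul_left_cancel₀ hE ?_⟩
  · rw [gradSnd]
    linear_combination c y * a y * h0 + (detSym a b d y + c y * b y) * h1
      + detSym a b d y * (detFull a b d c y * θ y (coordField e (muIdx 0) y)
        + partialD e (muIdx 0) (detSym a b d) y) * hFe
      + c y ^ 2 * (detFull a b d c y * θ y (coordField e (muIdx 0) y)
        + partialD e (muIdx 0) (detSym a b d) y) * hDe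
  · rw [gradFst]
    linear_combination -(detSym a b d y - c y * b y) * h0 + c y * d y * h1
      + detSym a b d y * (detFull a b d c y * θ y (coordField e (muIdx 1) y)
        + partialD e (muIdx 1) (detSym a b d) y) * hFe
      + c y ^ 2 * (detFull a b d c y * θ y (coordField e (muIdx 1) y)
        + partialD e (muIdx 1) (detSym a b d) y) * hDe

omit he hg hσ hI in
theorem IsToricPotential.smooth_ratio {f : M → ℝ} (hf : SmoothIn e f) :
    SmoothIn e (fun y ↦ c y * f y / (detFull a b d c y * detSym a b d y)) :=
  (h.smooth_c.mul hf).div (h.smooth_detFull.mul h.smooth_detSym)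
    fun y hy ↦ mul_ne_zero (h.detFull_pos hy).ne' (h.pos y hy).ne'

/-- Read off from the explicit components; the coordinate formula for `dθ` requires it. -/
theorem IsBlockMetric.leeForm_smooth {θ : OneForm M} (hθ : IsLeeForm g I θ) (k : Fin 4) :
    SmoothIn e (fun y ↦ θ y (coordField e k y)) := by
  obtain ⟨i, rfl⟩ | ⟨i, rfl⟩ := fin4_cases k
  · fin_cases i
    · have h1 : SmoothIn e (gradSnd e a b d) :=
        (h.smooth_a.mul (h.smooth_detSym.partialD _)).sub
          (h.smooth_b.mul (h.smooth_detSym.partialD _))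
      refine (h.smooth_ratio h1).neg.congr fun y hy ↦ ?_
      exact ((hg.leeForm_mu he h hσ hI hθ hy).1).trans (neg_div _ _)
    · have h1 : SmoothIn e (gradFst e a b d) :=
        (h.smooth_d.mul (h.smooth_detSym.partialD _)).sub
          (h.smooth_b.mul (h.smooth_detSym.partialD _))
      exact (h.smooth_ratio h1).congr fun y hy ↦ (hg.leeForm_mu he h hσ hI hθ hy).2
  · exact (SmoothIn.const 0).congr fun y hy ↦ hg.leeForm_t he h hσ hI hθ hy i

omit he hg hσ hI in
theorem IsToricPotential.hasPartial_ratio {f : M → ℝ} {f' : ℝ} {k : Fin 4} {y : M}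
    (hf : HasPartial e k y f f') :
    HasPartial e k y (fun y ↦ c y * f y / (detFull a b d c y * detSym a b d y))
      (c y * (f' / (detFull a b d c y * detSym a b d y)
        - f y * partialD e k (detSym a b d) y * (detFull a b d c y + detSym a b d y)
          / (detFull a b d c y * detSym a b d y) ^ 2)) := by
  have hy := hf.mem
  have hE := (h.detFull_pos hy).ne'
  have hD := (h.pos y hy).ne'
  have pc : HasPartial e k y c 0 := ⟨hy, h.smooth_c, h.const_c y hy k⟩
  refine ((pc.mul hf).div ((h.hasPartial_detFull hy k).mul (h.smooth_detSym.hasPartial k hy))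
    fun y hy ↦ mul_ne_zero (h.detFull_pos hy).ne' (h.pos y hy).ne').congr_partial ?_
  field_simp
  ring

/-- The differential of the Lee form. -/
theorem IsBlockMetric.dOne_leeForm_mu {θ : OneForm M} (hθ : IsLeeForm g I θ) {x : M}
    (hx : x ∈ e.source) :
    dOne θ x (coordField e (muIdx 0) x) (coordField e (muIdx 1) x)
      = c x * (lapDet e a b d x / (detFull a b d c x * detSym a b d x)
        - normGrad e a b d x * (detFull a b d c x + detSym a b d x)
          / (detFull a b d c x * detSym a b d x) ^ 2) := by
  have hs1 := (h.hasPartial_gradFst hx (muIdx 0)).smooth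
  have hs2 := (h.hasPartial_gradSnd hx (muIdx 1)).smooth
  -- The curl of `c(-W₁, W₀)/(DE)` is `c` times the divergence of `W/(DE)`, and `div W` is known
  -- from `div_grad`.
  rw [dOne_coordField he (hg.leeForm_smooth he h hσ hI hθ) hx,
    partialD_congr _ (fun y hy ↦ (hg.leeForm_mu he h hσ hI hθ hy).2) hx,
    partialD_congr _ (fun y hy ↦ ((hg.leeForm_mu he h hσ hI hθ hy).1).trans (neg_div _ _)) hx,
    partialD_neg, (h.hasPartial_ratio (hs1.hasPartial (muIdx 0) hx)).eq,
    (h.hasPartial_ratio (hs2.hasPartial (muIdx 1) hx)).eq, ← h.div_grad hx, normGrad]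
  ring

theorem IsBlockMetric.dOne_leeForm_t {θ : OneForm M} (hθ : IsLeeForm g I θ) {x : M}
    (hx : x ∈ e.source) (i j : Fin 2) :
    dOne θ x (coordField e (tIdx i) x) (coordField e (tIdx j) x) = 0 := by
  rw [dOne_coordField he (hg.leeForm_smooth he h hσ hI hθ) hx,
    partialD_congr _ (fun y hy ↦ hg.leeForm_t he h hσ hI hθ hy _) hx,
    partialD_congr _ (fun y hy ↦ hg.leeForm_t he h hσ hI hθ hy _) hx, partialD_const,
    partialD_const, sub_zero]

omit he hσ hI in
theorem IsBlockMetric.inv_coordGram {x : M} (hx : x ∈ e.source) :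
    (coordGram e g x)⁻¹ = !![d x / detSym a b d x, -b x / detSym a b d x, 0, 0;
      -b x / detSym a b d x, a x / detSym a b d x, 0, 0;
      0, 0, a x * detFull a b d c x / detSym a b d x, b x * detFull a b d c x / detSym a b d x;
      0, 0, b x * detFull a b d c x / detSym a b d x,
        d x * detFull a b d c x / detSym a b d x] := by
  have hE := (h.detFull_pos hx).ne'
  have hD := (h.pos x hx).ne'
  have hG : coordGram e g x = !![a x, b x, 0, 0; b x, d x, 0, 0;
      0, 0, d x / detFull a b d c x, -b x / detFull a b d c x;
      0, 0, -b x / detFull a b d c x, a x / detFull a b d c x] := by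
    have hmm := hg.mu_mu x hx
    have hmt := hg.mu_t x hx
    have htm (i j : Fin 2) : g x (coordField e (tIdx j) x) (coordField e (muIdx i) x) = 0 := by
      rw [hg.symm x hx, hmt]
    have htt := hg.t_t x hx
    ext i j
    fin_cases i <;> fin_cases j
    exacts [hmm 0 0, hmm 0 1, hmt 0 0, hmt 0 1, hmm 1 0, hmm 1 1, hmt 1 0, hmt 1 1,
      htm 0 0, htm 1 0, htt 0 0, htt 0 1, htm 0 1, htm 1 1, htt 1 0, htt 1 1]
  rw [hG]
  refine Matrix.inv_eq_left_inv ?_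
  ext i j
  have hDe : detSym a b d x = a x * d x - b x * b x := rfl
  fin_cases i <;> fin_cases j <;> simp [Matrix.mul_apply, Fin.sum_univ_four] <;> field_simp <;>
    (try rw [hDe]) <;> ring

theorem IsBlockMetric.normSq_leeForm {θ : OneForm M} (hθ : IsLeeForm g I θ) {x : M}
    (hx : x ∈ e.source) :
    normSqOne g x (θ x) = c x ^ 2 * normGrad e a b d x
      / (detFull a b d c x ^ 2 * detSym a b d x ^ 2) := by
  have hE := (h.detFull_pos hx).ne'
  have hD := (h.pos x hx).ne'
  have i0 : (0 : Fin 4) = muIdx 0 := rfl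
  have i1 : (1 : Fin 4) = muIdx 1 := rfl
  have i2 : (2 : Fin 4) = tIdx 0 := rfl
  have i3 : (3 : Fin 4) = tIdx 1 := rfl
  have hm0 := (hg.leeForm_mu he h hσ hI hθ hx).1
  have hm1 := (hg.leeForm_mu he h hσ hI hθ hx).2
  have ht := hg.leeForm_t he h hσ hI hθ hx
  rw [normSqOne_eq he hx, hg.inv_coordGram h hx]
  rw [← i0] at hm0
  rw [← i1] at hm1
  have ht0 : θ x (coordField e 2 x) = 0 := ht 0
  have ht1 : θ x (coordField e 3 x) = 0 := ht 1
  simp [Fin.sum_univ_four, hm0, hm1, ht0, ht1]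
  have hDe : detSym a b d x = a x * d x - b x * b x := rfl
  field_simp
  simp only [normGrad, gradFst, gradSnd, hDe]
  ring

end LeeForm

/-! ### The Abreu expression, the angle function and the commutator -/

section ScalarFormula

variable {e : OpenPartialHomeomorph M E4} (he : e ∈ IsManifold.maximalAtlas (𝓡 4) ∞ M)
  {a b d c : M → ℝ} (h : IsToricPotential e a b d c)

include h in
/-- The Abreu expression in terms of the determinant of `S`. -/
theorem IsToricPotential.abreu {A : M → Matrix (Fin 2) (Fin 2) ℝ}
    (hA : ∀ y ∈ e.source, A y = !![a y, b y; b y, d y]) {x : M} (hx : x ∈ e.source) :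
    -∑ i, ∑ j, partialD e (muIdx i) (partialD e (muIdx j) (fun y ↦ (A y)⁻¹ i j)) x
      = lapDet e a b d x / detSym a b d x ^ 2
        - 2 * (normGrad e a b d x / detSym a b d x ^ 3) := by
  have hD (y : M) (hy : y ∈ e.source) := (h.pos y hy).ne'
  have hinv (y : M) (hy : y ∈ e.source) : (A y)⁻¹
      = !![d y / detSym a b d y, -b y / detSym a b d y;
          -b y / detSym a b d y, a y / detSym a b d y] := by
    have hDy := hD y hy
    rw [hA y hy]
    refine Matrix.inv_eq_left_inv ?_
    have hDe : detSym a b d y = a y * d y - b y * b y := rfl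
    ext i j
    fin_cases i <;> fin_cases j <;> simp [Matrix.mul_apply, Fin.sum_univ_two] <;> field_simp <;>
      (try rw [hDe]) <;> ring
  have p00 (y : M) (hy : y ∈ e.source) (k : Fin 4) :
      HasPartial e k y (fun y ↦ (A y)⁻¹ 0 0) _ :=
    ((h.smooth_d.hasPartial k hy).div (h.smooth_detSym.hasPartial k hy) hD).congr
      fun y hy ↦ by rw [hinv y hy]; rfl
  have p01 (y : M) (hy : y ∈ e.source) (k : Fin 4) :
      HasPartial e k y (fun y ↦ (A y)⁻¹ 0 1) _ :=
    ((h.smooth_b.hasPartial k hy).neg.div (h.smooth_detSym.hasPartial k hy) hD).congr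
      fun y hy ↦ by rw [hinv y hy]; rfl
  have p10 (y : M) (hy : y ∈ e.source) (k : Fin 4) :
      HasPartial e k y (fun y ↦ (A y)⁻¹ 1 0) _ :=
    ((h.smooth_b.hasPartial k hy).neg.div (h.smooth_detSym.hasPartial k hy) hD).congr
      fun y hy ↦ by rw [hinv y hy]; rfl
  have p11 (y : M) (hy : y ∈ e.source) (k : Fin 4) :
      HasPartial e k y (fun y ↦ (A y)⁻¹ 1 1) _ :=
    ((h.smooth_a.hasPartial k hy).div (h.smooth_detSym.hasPartial k hy) hD).congr
      fun y hy ↦ by rw [hinv y hy]; rfl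
  -- Each row of `S⁻¹` is a divergence-free cofactor row divided by `D`, so its divergence is
  -- `-W_i/D²`. A second divergence is then governed by `div_grad`.
  have r0 : ∀ y ∈ e.source, partialD e (muIdx 0) (fun y ↦ (A y)⁻¹ 0 0) y
      + partialD e (muIdx 1) (fun y ↦ (A y)⁻¹ 0 1) y
        = -gradFst e a b d y / (detSym a b d y * detSym a b d y) := fun y hy ↦ by
    have hDy := hD y hy
    rw [(p00 y hy _).eq, (p01 y hy _).eq, h.closed_bd y hy, gradFst]
    field_simp
    ring
  have r1 : ∀ y ∈ e.source, partialD e (muIdx 0) (fun y ↦ (A y)⁻¹ 1 0) y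
      + partialD e (muIdx 1) (fun y ↦ (A y)⁻¹ 1 1) y
        = -gradSnd e a b d y / (detSym a b d y * detSym a b d y) := fun y hy ↦ by
    have hDy := hD y hy
    rw [(p10 y hy _).eq, (p11 y hy _).eq, h.closed_ab y hy, gradSnd]
    field_simp
    ring
  have pD (k : Fin 4) := (h.smooth_detSym.hasPartial k hx).mul (h.smooth_detSym.hasPartial k hx)
  have hDD (y : M) (hy : y ∈ e.source) := mul_ne_zero (hD y hy) (hD y hy)
  have q0 := (((h.hasPartial_gradFst hx (muIdx 0)).smooth.hasPartial _ hx).neg.div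
    (pD (muIdx 0)) hDD).congr r0
  have q1 := (((h.hasPartial_gradSnd hx (muIdx 1)).smooth.hasPartial _ hx).neg.div
    (pD (muIdx 1)) hDD).congr r1
  have s0 := partialD_add (muIdx 0) ((p00 x hx 0).smooth.partialD (muIdx 0))
    ((p01 x hx 0).smooth.partialD (muIdx 1)) hx
  have s1 := partialD_add (muIdx 1) ((p10 x hx 0).smooth.partialD (muIdx 0))
    ((p11 x hx 0).smooth.partialD (muIdx 1)) hx
  simp only [Fin.sum_univ_two]
  rw [← s0, ← s1, q0.eq, q1.eq, ← h.div_grad hx, normGrad]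
  have hDx := hD x hx
  field_simp
  ring

variable {Ω : BilField M} {J : EndField M}
  (hg : IsBlockMetric e (metric Ω J) a b d c)
  (hJ : IsToricStructure e J (fullMatrix a b d c 1))
  (hJ' : IsToricStructure e (sympAdjoint Ω J) (fullMatrix a b d (fun y ↦ -c y) (-1)))
include he h hJ hJ'

omit hJ in
theorem IsToricPotential.inv_fullMatrix_adjoint {y : M} (hy : y ∈ e.source) :
    (fullMatrix a b d (fun y ↦ -c y) (-1) y)⁻¹
      = !![-d y / detFull a b d c y, (b y - c y) / detFull a b d c y;
          (b y + c y) / detFull a b d c y, -a y / detFull a b d c y] := by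
  have hE : detFull a b d (fun y ↦ -c y) y = detFull a b d c y := by simp [detFull]
  rw [h.neg.inv_fullMatrix (by norm_num) hy, hE]
  ext i j
  fin_cases i <;> fin_cases j <;> simp
  ring

theorem IsToricPotential.angleFn_eq {x : M} (hx : x ∈ e.source) :
    angleFn Ω J x = 1 - 2 * (detSym a b d x / detFull a b d c x) := by
  have hE := (h.detFull_pos hx).ne'
  have hc (k : Fin 4) : ((J x).comp (sympAdjoint Ω J x)).toLinearMap (coordField e k x)
    = J x (sympAdjoint Ω J x (coordField e k x)) := rfl
  rw [angleFn, trace_eq_sum_dCoord he hx, sum_fin4]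
  simp only [hc, hJ.anti.t_part x hx, hJ.anti.mu_part x hx, hJ'.anti.t_part x hx,
    hJ'.anti.mu_part x hx, dCoord_coordField he hx, h.inv_fullMatrix (one_mul 1) hx,
    h.inv_fullMatrix_adjoint he hJ' hx]
  simp [Fin.sum_univ_two, fullMatrix]
  field_simp
  simp only [detFull, detSym]
  ring

/-- The commutator `[J, J^{*ω}]` preserves the span of the momentum directions. -/
theorem IsToricPotential.comm_mu {x : M} (hx : x ∈ e.source) (i : Fin 2) :
    J x (sympAdjoint Ω J x (coordField e (muIdx i) x))
        - sympAdjoint Ω J x (J x (coordField e (muIdx i) x))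
      = (4 * c x / detFull a b d c x) •
        (!![-b x, a x; -d x, b x] i 0 • coordField e (muIdx 0) x
          + !![-b x, a x; -d x, b x] i 1 • coordField e (muIdx 1) x) := by
  have hE := (h.detFull_pos hx).ne'
  refine eq_of_dCoord_eq he hx fun k ↦ ?_
  simp only [← dCoordL_apply, map_sub, map_add, map_smul]
  simp only [dCoordL_apply]
  obtain ⟨j, rfl⟩ | ⟨j, rfl⟩ := fin4_cases k
  · simp only [hJ.anti.t_part x hx, hJ.anti.mu_part x hx, hJ'.anti.t_part x hx,
      hJ'.anti.mu_part x hx, dCoord_coordField he hx, h.inv_fullMatrix (one_mul 1) hx,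
      h.inv_fullMatrix_adjoint he hJ' hx]
    fin_cases i <;> fin_cases j <;> simp [Fin.sum_univ_two, fullMatrix] <;> field_simp <;> ring
  · simp only [hJ.anti.t_part x hx, hJ.anti.mu_part x hx, hJ'.anti.t_part x hx,
      hJ'.anti.mu_part x hx, dCoord_coordField he hx, h.inv_fullMatrix (one_mul 1) hx,
      h.inv_fullMatrix_adjoint he hJ' hx]
    simp

include hg

/-- The product `(-b, a; -d, b)S` is `det S` times the standard antisymmetric matrix. -/
theorem IsBlockMetric.commForm_mu_mu {x : M} (hx : x ∈ e.source) (i j : Fin 2) :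
    commForm Ω J x (coordField e (muIdx i) x) (coordField e (muIdx j) x)
      = 4 * c x * detSym a b d x / detFull a b d c x * !![0, 1; -1, 0] i j := by
  have hE := (h.detFull_pos hx).ne'
  rw [commForm, h.comm_mu he hJ hJ' hx]
  simp only [map_add, map_smul, add_apply, smul_apply, hg.mu_mu x hx]
  fin_cases i <;> fin_cases j <;> simp [detSym, -mul_eq_zero] <;> ring

theorem IsBlockMetric.commForm_mu_t {x : M} (hx : x ∈ e.source) (i j : Fin 2) :
    commForm Ω J x (coordField e (muIdx i) x) (coordField e (tIdx j) x) = 0 := by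
  rw [commForm, h.comm_mu he hJ hJ' hx]
  simp [hg.mu_t x hx]

omit h in
theorem IsBlockMetric.commForm_t_mu {x : M} (hx : x ∈ e.source) (i j : Fin 2) :
    commForm Ω J x (coordField e (tIdx i) x) (coordField e (muIdx j) x) = 0 := by
  have h1 (m : Fin 2) : dCoord e (muIdx m) x (J x (sympAdjoint Ω J x (coordField e (tIdx i) x))
      - sympAdjoint Ω J x (J x (coordField e (tIdx i) x))) = 0 := by
    rw [← dCoordL_apply, map_sub, dCoordL_apply, dCoordL_apply, hJ.anti.mu_part x hx,
      hJ'.anti.mu_part x hx]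
    simp [hJ.anti.t_part x hx, hJ'.anti.t_part x hx, dCoord_coordField he hx]
  rw [commForm, hg.symm x hx, oneForm_apply_eq_sum he hx, sum_fin4]
  simp [h1, hg.mu_t x hx]

/-- The commutator form has no mixed components and `dθ` no angular ones, so only `dμ^0 ∧ dμ^1`
contributes. Its coefficients are paired with weight `½ det S⁻¹`, the half coming from the
normalization of the inner product. -/
theorem IsBlockMetric.innerTwo_comm {θ : OneForm M} (hθ : IsLeeForm (metric Ω J) J θ) {x : M}
    (hx : x ∈ e.source) :
    innerTwo (metric Ω J) x (commForm Ω J x) (dOne θ x)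
      = 2 * c x / detFull a b d c x
        * dOne θ x (coordField e (muIdx 0) x) (coordField e (muIdx 1) x) := by
  have hE := (h.detFull_pos hx).ne'
  have hD := (h.pos x hx).ne'
  have hθs := hg.leeForm_smooth he h (one_mul 1) hJ hθ
  have hcomm (v w : TangentSpace (𝓡 4) x) : commForm Ω J x v w
      = ((metric Ω J x).comp ((J x).comp (sympAdjoint Ω J x)
        - (sympAdjoint Ω J x).comp (J x))) v w := rfl
  have hanti : dOne θ x (coordField e (muIdx 1) x) (coordField e (muIdx 0) x)
      = -dOne θ x (coordField e (muIdx 0) x) (coordField e (muIdx 1) x) := by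
    rw [dOne_coordField he hθs hx, dOne_coordField he hθs hx, neg_sub]
  have hdiag (k : Fin 4) : dOne θ x (coordField e k x) (coordField e k x) = 0 := by
    rw [dOne_coordField he hθs hx, sub_self]
  have cmm := hg.commForm_mu_mu he h hJ hJ' hx
  have cmt := hg.commForm_mu_t he h hJ hJ' hx
  have ctm := hg.commForm_t_mu he hJ hJ' hx
  have dtt := hg.dOne_leeForm_t he h (one_mul 1) hJ hθ hx
  rw [innerTwo_eq he hx
    (fun v w ↦ by simp only [hcomm]; exact bilForm_apply_eq_sum he hx _ v w)
    (dOne_eq_sum he hθs hx), hg.inv_coordGram h hx]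
  have i0 : (0 : Fin 4) = muIdx 0 := rfl
  have i1 : (1 : Fin 4) = muIdx 1 := rfl
  have i2 : (2 : Fin 4) = tIdx 0 := rfl
  have i3 : (3 : Fin 4) = tIdx 1 := rfl
  simp only [Fin.sum_univ_four]
  rw [i0, i1, i2, i3]
  simp only [cmm, cmt, ctm, dtt, hdiag, hanti]
  simp only [← i0, ← i1, ← i2, ← i3]
  simp
  field_simp
  simp only [detSym]
  ring

end ScalarFormula

/-! ### Toric structures of symplectic type -/

section Symplectic

/-- The off-diagonal entry of the symmetric part of `Ψ`. -/
def symOff (Ψ : M → Matrix (Fin 2) (Fin 2) ℝ) (y : M) : ℝ := (1 / 2 : ℝ) * (Ψ y 0 1 + Ψ y 1 0)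

/-- The off-diagonal entry of the antisymmetric part of `Ψ`. -/
def antiOff (Ψ : M → Matrix (Fin 2) (Fin 2) ℝ) (y : M) : ℝ := (1 / 2 : ℝ) * (Ψ y 0 1 - Ψ y 1 0)

omit [TopologicalSpace M] [ChartedSpace E4 M] [IsManifold (𝓡 4) ∞ M] in
theorem eq_fullMatrix (Ψ : M → Matrix (Fin 2) (Fin 2) ℝ) :
    Ψ = fullMatrix (fun y ↦ Ψ y 0 0) (symOff Ψ) (fun y ↦ Ψ y 1 1) (antiOff Ψ) 1 := by
  funext y
  ext i j
  fin_cases i <;> fin_cases j <;> simp [fullMatrix, symOff, antiOff] <;> ring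

omit [TopologicalSpace M] [ChartedSpace E4 M] [IsManifold (𝓡 4) ∞ M] in
theorem neg_transpose_eq_fullMatrix (Ψ : M → Matrix (Fin 2) (Fin 2) ℝ) :
    (fun y ↦ -(Ψ y)ᵀ) = fullMatrix (fun y ↦ Ψ y 0 0) (symOff Ψ) (fun y ↦ Ψ y 1 1)
      (fun y ↦ -antiOff Ψ y) (-1) := by
  funext y
  ext i j
  fin_cases i <;> fin_cases j <;> simp [fullMatrix, symOff, antiOff] <;> ring

omit [TopologicalSpace M] [ChartedSpace E4 M] [IsManifold (𝓡 4) ∞ M] in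
theorem symPart_eq (Ψ : M → Matrix (Fin 2) (Fin 2) ℝ) (y : M) :
    symPart Ψ y = !![Ψ y 0 0, symOff Ψ y; symOff Ψ y, Ψ y 1 1] := by
  ext i j
  fin_cases i <;> fin_cases j <;> simp [symPart, symOff] <;> ring

omit [TopologicalSpace M] [ChartedSpace E4 M] [IsManifold (𝓡 4) ∞ M] in
theorem det_symPart (Ψ : M → Matrix (Fin 2) (Fin 2) ℝ) (y : M) :
    (symPart Ψ y).det = detSym (fun y ↦ Ψ y 0 0) (symOff Ψ) (fun y ↦ Ψ y 1 1) y := by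
  rw [symPart_eq, Matrix.det_fin_two]
  simp [detSym]

omit [TopologicalSpace M] [ChartedSpace E4 M] [IsManifold (𝓡 4) ∞ M] in
theorem det_eq_detFull (Ψ : M → Matrix (Fin 2) (Fin 2) ℝ) (y : M) :
    (Ψ y).det = detFull (fun y ↦ Ψ y 0 0) (symOff Ψ) (fun y ↦ Ψ y 1 1) (antiOff Ψ) y := by
  rw [Matrix.det_fin_two]
  simp only [detFull, detSym, symOff, antiOff]
  ring

variable [MulAction Torus M] {Ω : BilField M} {μ : M → (LieT →L[ℝ] ℝ)}
  (hM : IsSymplecticToric Ω μ) {J : EndField M} (hJ : IsDGK Ω μ J)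
  {ξ : Module.Basis (Fin 2) ℝ LieT}
  {e : OpenPartialHomeomorph M E4} (he : IsAngularChart μ J ξ e)
  {Ψ : M → Matrix (Fin 2) (Fin 2) ℝ} (hΨ : IsAntidiagonal e J Ψ)
include hM hJ he hΨ

/-- The symmetric part of `Ψ` is positive definite because `J` is tamed. -/
theorem IsDGK.det_symPart_pos {x : M} (hx : x ∈ e.source) :
    0 < detSym (fun y ↦ Ψ y 0 0) (symOff Ψ) (fun y ↦ Ψ y 1 1) x := by
  have hq (r s : ℝ) (hrs : r ≠ 0 ∨ s ≠ 0) :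
      0 < Ψ x 0 0 * r ^ 2 + 2 * symOff Ψ x * r * s + Ψ x 1 1 * s ^ 2 := by
    set v : TangentSpace (𝓡 4) x := r • coordField e (muIdx 0) x + s • coordField e (muIdx 1) x
      with hv
    have hc (k : Fin 4) : dCoord e k x v = r * (if k = muIdx 0 then 1 else 0)
        + s * (if k = muIdx 1 then 1 else 0) := by
      rw [hv, ← dCoordL_apply, map_add, map_smul, map_smul, dCoordL_apply, dCoordL_apply,
        dCoord_coordField he.mem_atlas hx, dCoord_coordField he.mem_atlas hx]
      rfl
    have hv0 : v ≠ 0 := by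
      intro h0
      have hz (k : Fin 4) : dCoord e k x v = 0 := by rw [h0, ← dCoordL_apply, map_zero]
      have h1 := hz (muIdx 0)
      have h2 := hz (muIdx 1)
      rw [hc] at h1 h2
      simp at h1 h2
      rcases hrs with h | h
      · exact h h1
      · exact h h2
    have h1 := hJ.tamed x v hv0
    rw [hJ.omega_eq hM he hΨ hx] at h1
    simp only [hΨ.t_part x hx, hΨ.mu_part x hx, hc] at h1
    simp [Fin.sum_univ_two] at h1
    rw [symOff]
    linarith
  have ha := hq 1 0 (by simp)
  -- At the vector `(-b, a)` the quadratic form of `S` equals `a · det S`, and `a > 0` is its value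
  -- at `(1, 0)`.
  have hb := hq (-symOff Ψ x) (Ψ x 0 0) (by right; simp at ha; exact ha.ne')
  simp at ha
  have h2 : 0 < Ψ x 0 0 * (Ψ x 0 0 * Ψ x 1 1 - symOff Ψ x * symOff Ψ x) := by
    linarith
  exact (mul_pos_iff_of_pos_left ha).1 h2

/-- Integrability of `J` closes the rows of `Ψ`, that of `J^{*ω}` (matrix `-Ψᵀ`) closes the columns.
Comparing the two gives equal momentum derivatives of `Ψ₀₁` and `Ψ₁₀`: the antisymmetric part is
constant and the symmetric part closed. -/
theorem IsDGK.isToricPotential :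
    IsToricPotential e (fun y ↦ Ψ y 0 0) (symOff Ψ) (fun y ↦ Ψ y 1 1) (antiOff Ψ) := by
  have h := hJ.isToricStructure hM he hΨ
  have h' := hJ.isToricStructure_adjoint hM he hΨ
  have hs := h.smooth
  have hhalf : SmoothIn e (fun _ ↦ (1 / 2 : ℝ)) := SmoothIn.const _
  have hoff (k : Fin 4) (y : M) (hy : y ∈ e.source) : partialD e k (symOff Ψ) y
      = (1 / 2 : ℝ) * (partialD e k (fun y ↦ Ψ y 0 1) y + partialD e k (fun y ↦ Ψ y 1 0) y) := by
    refine ((HasPartial.const hy (1 / 2)).mul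
      (((hs 0 1).hasPartial k hy).add ((hs 1 0).hasPartial k hy))).eq.trans ?_
    ring
  have hanti (k : Fin 4) (y : M) (hy : y ∈ e.source) : partialD e k (antiOff Ψ) y
      = (1 / 2 : ℝ) * (partialD e k (fun y ↦ Ψ y 0 1) y - partialD e k (fun y ↦ Ψ y 1 0) y) := by
    refine ((HasPartial.const hy (1 / 2)).mul
      (((hs 0 1).hasPartial k hy).sub ((hs 1 0).hasPartial k hy))).eq.trans ?_
    ring
  have hcl (y : M) (hy : y ∈ e.source) (i : Fin 2) := h.closed he.mem_atlas hJ.integrable hy i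
  have hcl' (y : M) (hy : y ∈ e.source) (i : Fin 2) :
      partialD e (muIdx 0) (fun y ↦ Ψ y 1 i) y = partialD e (muIdx 1) (fun y ↦ Ψ y 0 i) y := by
    have h1 := h'.closed he.mem_atlas hJ.integrable_adjoint hy i
    simp only [Matrix.neg_apply, Matrix.transpose_apply, partialD_neg] at h1
    linarith
  refine ⟨hs 0 0, hhalf.mul ((hs 0 1).add (hs 1 0)), hs 1 1, hhalf.mul ((hs 0 1).sub (hs 1 0)),
    fun y hy l ↦ h.invariant y hy 0 0 l, fun y hy l ↦ ?_, fun y hy l ↦ h.invariant y hy 1 1 l,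
    fun y hy k ↦ ?_, fun y hy ↦ ?_, fun y hy ↦ ?_, fun y hy ↦ hJ.det_symPart_pos hM he hΨ hy⟩
  · rw [hoff _ y hy, h.invariant y hy, h.invariant y hy]
    ring
  · rw [hanti _ y hy]
    have e1 := hcl y hy
    have e2 := hcl' y hy
    obtain ⟨i, rfl⟩ | ⟨i, rfl⟩ := fin4_cases k
    · fin_cases i
      · have := (e1 0).trans (e2 0).symm
        simp only [Fin.zero_eta]
        rw [this]
        ring
      · have := (e2 1).symm.trans (e1 1)
        simp only [Fin.mk_one]
        rw [this]
        ring
    · rw [h.invariant y hy, h.invariant y hy]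
      ring
  · rw [hoff _ y hy, hcl y hy 0, hcl' y hy 0]
    ring
  · rw [hoff _ y hy, ← hcl y hy 1, ← hcl' y hy 1]
    ring

/-- With `ω = ∑ dμ^j ∧ dt^j`, the metric has the symmetric part of `Ψ` on momenta and that of `Ψ⁻¹`
on angles; the latter is the cofactor matrix of `S` over `det Ψ`. -/
theorem IsDGK.isBlockMetric :
    IsBlockMetric e (metric Ω J) (fun y ↦ Ψ y 0 0) (symOff Ψ) (fun y ↦ Ψ y 1 1) (antiOff Ψ) := by
  refine ⟨fun y hy v w ↦ ?_, fun y hy i j ↦ ?_, fun y hy i j ↦ ?_, fun y hy i j ↦ ?_⟩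
  · rw [metric_apply, metric_apply]
    ring
  · rw [metric_apply, hJ.omega_eq hM he hΨ hy, hJ.omega_eq hM he hΨ hy]
    simp only [hΨ.t_part y hy, hΨ.mu_part y hy, dCoord_coordField he.mem_atlas hy]
    fin_cases i <;> fin_cases j <;> simp [symOff] <;> ring
  · rw [metric_apply, hJ.omega_eq hM he hΨ hy, hJ.omega_eq hM he hΨ hy]
    simp [hΨ.t_part y hy, hΨ.mu_part y hy, dCoord_coordField he.mem_atlas hy]
  · have h := hJ.isToricPotential hM he hΨ
    have hinv : (Ψ y)⁻¹ = _ :=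
      (congrArg (fun A ↦ (A y)⁻¹) (eq_fullMatrix Ψ)).trans (h.inv_fullMatrix (one_mul 1) hy)
    rw [metric_apply, hJ.omega_eq hM he hΨ hy, hJ.omega_eq hM he hΨ hy]
    simp only [hΨ.t_part y hy, hΨ.mu_part y hy, dCoord_coordField he.mem_atlas hy, hinv]
    fin_cases i <;> fin_cases j <;> simp <;> ring

end Symplectic

/-- The identity between the two expressions of the Hermitian scalar curvature. -/
theorem toricScal_eq {e : OpenPartialHomeomorph M E4} {a b d c : M → ℝ}
    (h : IsToricPotential e a b d c) {x : M} (hx : x ∈ e.source) :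
    toricScal e a b d c x
      = lapDet e a b d x / detSym a b d x ^ 2 - 2 * (normGrad e a b d x / detSym a b d x ^ 3)
        + (4 - 2 * (1 - 2 * (detSym a b d x / detFull a b d c x)))
          / (1 - (1 - 2 * (detSym a b d x / detFull a b d c x)))
          * (c x ^ 2 * normGrad e a b d x / (detFull a b d c x ^ 2 * detSym a b d x ^ 2))
        - 2 * (2 * c x / detFull a b d c x
            * (c x * (lapDet e a b d x / (detFull a b d c x * detSym a b d x)
              - normGrad e a b d x * (detFull a b d c x + detSym a b d x)
                / (detFull a b d c x * detSym a b d x) ^ 2)))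
          / (1 - (1 - 2 * (detSym a b d x / detFull a b d c x))) := by
  have hD := (h.pos x hx).ne'
  have hE := (h.detFull_pos hx).ne'
  have hc : c x ^ 2 = detFull a b d c x - detSym a b d x := by
    simp only [detFull]
    ring
  have h1 : 1 - (1 - 2 * (detSym a b d x / detFull a b d c x))
      = 2 * (detSym a b d x / detFull a b d c x) := by ring
  rw [h1, toricScal]
  field_simp
  -- After clearing denominators, `c² = E - D` is the only relation needed.
  rw [hc]
  ring

end ToricGK

end

/-! ### The Chern–Ricci form and the Hermitian scalar curvatures -/

open ToricGK

theorem theorem6p13 {M : Type*} [TopologicalSpace M] [T2Space M] [CompactSpace M]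
    [ConnectedSpace M] [ChartedSpace E4 M] [IsManifold (𝓡 4) ∞ M] [MulAction Torus M]
    (Ω : BilField M) (μ : M → (LieT →L[ℝ] ℝ)) (hM : IsSymplecticToric Ω μ)
    (J : EndField M) (hJ : IsDGK Ω μ J)
    (ξ : Module.Basis (Fin 2) ℝ LieT)
    (e : OpenPartialHomeomorph M E4) (he : IsAngularChart μ J ξ e)
    (Ψ : M → Matrix (Fin 2) (Fin 2) ℝ) (hΨ : IsAntidiagonal e J Ψ)
    (θ : OneForm M) (hθ : IsLeeForm (metric Ω J) J θ)
    (ρ ρ' : BilField M) (hρ : IsChernRicciForm (metric Ω J) J ρ)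
    (hρ' : IsChernRicciForm (metric Ω J) (sympAdjoint Ω J) ρ')
    (x : M) (hx : x ∈ e.source) :
    (∀ v w : TangentSpace (𝓡 4) x,
      ρ x v w = -(1 / 2 : ℝ) * ddc J (fun y ↦ Real.log (symPart Ψ y).det) x v w
        + ddc J (fun y ↦ Real.log (Ψ y).det) x v w) ∧
    hermScal ρ (fundForm (metric Ω J) J) x
      = -∑ i, ∑ j, partialD e (muIdx i) (partialD e (muIdx j) (fun y ↦ (symPart Ψ y)⁻¹ i j)) x
        + (4 - 2 * angleFn Ω J x) / (1 - angleFn Ω J x) * normSqOne (metric Ω J) x (θ x)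
        - 2 * innerTwo (metric Ω J) x (commForm Ω J x) (dOne θ x) / (1 - angleFn Ω J x) ∧
    hermScal ρ' (fundForm (metric Ω J) (sympAdjoint Ω J)) x
      = hermScal ρ (fundForm (metric Ω J) J) x := by
  have hat := he.mem_atlas
  have h := hJ.isToricPotential hM he hΨ
  have hg := hJ.isBlockMetric hM he hΨ
  have hS := hJ.isToricStructure hM he hΨ
  have hS' := hJ.isToricStructure_adjoint hM he hΨ
  rw [eq_fullMatrix Ψ] at hS
  rw [neg_transpose_eq_fullMatrix Ψ] at hS'
  have hdet (y : M) : detFull (fun y ↦ Ψ y 0 0) (symOff Ψ) (fun y ↦ Ψ y 1 1)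
      (fun y ↦ -antiOff Ψ y) y
      = detFull (fun y ↦ Ψ y 0 0) (symOff Ψ) (fun y ↦ Ψ y 1 1) (antiOff Ψ) y := by
    simp [detFull]
  -- The metric sees only `c²`, so it also has the block form for the data `(a, b, d, -c)` of
  -- `J^{*ω}`.
  have hg' : IsBlockMetric e (metric Ω J) (fun y ↦ Ψ y 0 0) (symOff Ψ) (fun y ↦ Ψ y 1 1)
      (fun y ↦ -antiOff Ψ y) :=
    ⟨hg.symm, hg.mu_mu, hg.mu_t, fun y hy i j ↦ by rw [hdet]; exact hg.t_t y hy i j⟩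
  have hu := hg.hermScal_eq_toricScal hat h (one_mul 1) hS hJ.integrable hρ hx
  have hu' := hg'.hermScal_eq_toricScal hat h.neg (by norm_num) hS' hJ.integrable_adjoint hρ' hx
  refine ⟨fun v w ↦ ?_, ?_, ?_⟩
  · simp only [det_symPart]
    simp only [det_eq_detFull]
    exact hg.chernRicci_eq hat h hS hJ.integrable hρ hx v w
  · rw [hu, h.abreu (fun y _ ↦ symPart_eq Ψ y) hx, h.angleFn_eq hat hS hS' hx,
      hg.normSq_leeForm hat h (one_mul 1) hS hθ hx, hg.innerTwo_comm hat h hS hS' hθ hx,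
      hg.dOne_leeForm_mu hat h (one_mul 1) hS hθ hx]
    exact toricScal_eq h hx
  · rw [hu, hu', toricScal, toricScal, hdet]
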